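/- **Computation model.** Programs run on a pointer machine over the reals with unit-cost steps. A word holds a real number, the null pointer, or a pointer to an immutable cell of two words. A program is a finite set of mutually recursive first-order functions. Each of the following takes one step: reading a variable, a rational constant, addition or subtraction of two reals, the test $x\le y$, the null test, allocating a cell, reading a component of a cell, binding a variable, and a function call. The size of a stored value is its number of words and cells, without sharing. **Theorem.** There is an absolute constant $k$ such that for every (constant) dimension $d\ge 1$ there are a constant $C$ and one program, depending only on $d$, that form a dynamic data structure for exact similarity join under the $\ell_1$ metric. Put $L(n)=C\,(\lfloor\log_2 n\rfloor+1)^{kd}$ for $n\ge1$ and $L(0)=C$. For every threshold $r>0$ and all finite sets $A,B\subset\mathbb R^d$, given as lists in arbitrary order, with $n=|A|+|B|$: 1. (Construction) the data structure for $(A,B,r)$ is built in at most $(n+1)\,L(n)$ steps, that is, in $\tilde O(n)$ time. 2. (Updates) after the construction, every finite sequence of insertions of points into $A$ or $B$ and deletions of points from $A$ or $B$ is processed, one update at a time, in at most $\sum_i L(n_i)$ steps in total, where $n_i$ is the value of $|A|+|B|$ after the $i$-th update; that is, in $\tilde O(1)$ amortized time per update. (Inserting a point that is present and deleting a point that is absent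 leave the set unchanged.) After the construction and after every such sequence of updates, if $A,B$ are now the current sets and $n=|A|+|B|$: 3. (Size) the data structure has size at most $(n+1)\,L(n)$, that is, $\tilde O(n)$. 4. (Enumeration) an enumeration query reports every pair $(a,b)\in A\times B$ with $\|a-b\|_1\le r$ exactly once, reports nothing else, and terminates; the time from the start to the first result, between any two consecutive results, and from the last result to termination (or from the start to termination, if there is no result) is at most $L(n)$, that is, the delay is $\tilde O(1)$. -/

import Mathlib

namespace SimJoin

/-! ### The machine: first-order programs over cons cells and real numbers -/

/-- What a memory word can hold: a real number, the null pointer, or a pointer to an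
(immutable) cell with two words. -/
inductive Val : Type
  | real (x : ℝ)
  | nil
  | cons (a b : Val)

/-- Number of words and cells of a stored value.  Shared substructures are counted once for each
occurrence, so this bounds the memory taken by the value from above. -/
def Val.size : Val → ℕ
  | .real _ => 1
  | .nil => 1
  | .cons a b => a.size + b.size + 1

/-- The null-terminated linked list of the given values. -/
def Val.ofList (l : List Val) : Val := l.foldr Val.cons Val.nil

/-- Expressions over a set `F` of names of (mutually recursive, one-argument) functions.
`var i` is the `i`-th most recently bound variable.  The arithmetic on reals is restricted to
rational constants, addition, subtraction and comparison; reals cannot be rounded, and no other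
computation on their digits is available. -/
inductive Expr (F : Type) : Type
  | var (i : ℕ)
  | const (q : ℚ)
  | add (e₁ e₂ : Expr F)
  | sub (e₁ e₂ : Expr F)
  /-- `ifLe e₁ e₂ e₃ e₄`: if `e₁ ≤ e₂` then `e₃` else `e₄`. -/
  | ifLe (e₁ e₂ e₃ e₄ : Expr F)
  | nil
  | cons (e₁ e₂ : Expr F)
  | fst (e : Expr F)
  | snd (e : Expr F)
  /-- `ifNil e e₁ e₂`: if `e` is the null pointer then `e₁`; if `e` is a cell then `e₂`. -/
  | ifNil (e e₁ e₂ : Expr F)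
  /-- `bind e₁ e₂`: evaluate `e₁`, then `e₂` with the result as the new variable `0`. -/
  | bind (e₁ e₂ : Expr F)
  | call (f : F) (e : Expr F)

/-- `Eval body env e v t`: with the function bodies `body` and the variables `env`, the expression
`e` evaluates to `v` in exactly `t` steps.  Every evaluated node of an expression is one step;
each is a constant number of steps of a pointer machine or a random-access machine with real
arithmetic at unit cost, so that bounds for this machine hold for those models too.
Ill-typed operations and non-terminating computations have no value. -/
inductive Eval {F : Type} (body : F → Expr F) : List Val → Expr F → Val → ℕ → Prop
  | var {env : List Val} {i : ℕ} {v : Val} (h : env[i]? = some v) :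
      Eval body env (.var i) v 1
  | const {env : List Val} {q : ℚ} :
      Eval body env (.const q) (.real (q : ℝ)) 1
  | add {env : List Val} {e₁ e₂ : Expr F} {x y : ℝ} {t₁ t₂ : ℕ}
      (h₁ : Eval body env e₁ (.real x) t₁) (h₂ : Eval body env e₂ (.real y) t₂) :
      Eval body env (.add e₁ e₂) (.real (x + y)) (t₁ + t₂ + 1)
  | sub {env : List Val} {e₁ e₂ : Expr F} {x y : ℝ} {t₁ t₂ : ℕ}
      (h₁ : Eval body env e₁ (.real x) t₁) (h₂ : Eval body env e₂ (.real y) t₂) :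
      Eval body env (.sub e₁ e₂) (.real (x - y)) (t₁ + t₂ + 1)
  | ifLe_true {env : List Val} {e₁ e₂ e₃ e₄ : Expr F} {x y : ℝ} {v : Val} {t₁ t₂ t₃ : ℕ}
      (h₁ : Eval body env e₁ (.real x) t₁) (h₂ : Eval body env e₂ (.real y) t₂)
      (hle : x ≤ y) (h₃ : Eval body env e₃ v t₃) :
      Eval body env (.ifLe e₁ e₂ e₃ e₄) v (t₁ + t₂ + t₃ + 1)
  | ifLe_false {env : List Val} {e₁ e₂ e₃ e₄ : Expr F} {x y : ℝ} {v : Val} {t₁ t₂ t₄ : ℕ}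
      (h₁ : Eval body env e₁ (.real x) t₁) (h₂ : Eval body env e₂ (.real y) t₂)
      (hlt : y < x) (h₄ : Eval body env e₄ v t₄) :
      Eval body env (.ifLe e₁ e₂ e₃ e₄) v (t₁ + t₂ + t₄ + 1)
  | nil {env : List Val} :
      Eval body env .nil .nil 1
  | cons {env : List Val} {e₁ e₂ : Expr F} {v w : Val} {t₁ t₂ : ℕ}
      (h₁ : Eval body env e₁ v t₁) (h₂ : Eval body env e₂ w t₂) :
      Eval body env (.cons e₁ e₂) (.cons v w) (t₁ + t₂ + 1)
  | fst {env : List Val} {e : Expr F} {v w : Val} {t : ℕ}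
      (h : Eval body env e (.cons v w) t) :
      Eval body env (.fst e) v (t + 1)
  | snd {env : List Val} {e : Expr F} {v w : Val} {t : ℕ}
      (h : Eval body env e (.cons v w) t) :
      Eval body env (.snd e) w (t + 1)
  | ifNil_nil {env : List Val} {e e₁ e₂ : Expr F} {v : Val} {t t₁ : ℕ}
      (h : Eval body env e .nil t) (h₁ : Eval body env e₁ v t₁) :
      Eval body env (.ifNil e e₁ e₂) v (t + t₁ + 1)
  | ifNil_cons {env : List Val} {e e₁ e₂ : Expr F} {a b v : Val} {t t₂ : ℕ}
      (h : Eval body env e (.cons a b) t) (h₂ : Eval body env e₂ v t₂) :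
      Eval body env (.ifNil e e₁ e₂) v (t + t₂ + 1)
  | bind {env : List Val} {e₁ e₂ : Expr F} {v w : Val} {t₁ t₂ : ℕ}
      (h₁ : Eval body env e₁ v t₁) (h₂ : Eval body (v :: env) e₂ w t₂) :
      Eval body env (.bind e₁ e₂) w (t₁ + t₂ + 1)
  | call {env : List Val} {f : F} {e : Expr F} {v w : Val} {t₁ t₂ : ℕ}
      (h₁ : Eval body env e v t₁) (h₂ : Eval body [v] (body f) w t₂) :
      Eval body env (.call f e) w (t₁ + t₂ + 1)

/-- Evaluation is deterministic: value and number of steps are unique. -/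
theorem Eval.det {F : Type} {body : F → Expr F} {env : List Val} {e : Expr F} {v w : Val}
    {t s : ℕ} (h : Eval body env e v t) (h' : Eval body env e w s) : v = w ∧ t = s := by
  induction h generalizing w s with
  | var h => cases h' with | var k => simp_all
  | const => cases h'; simp
  | nil => cases h'; simp
  | add _ _ i₁ i₂ =>
    cases h' with
    | add k₁ k₂ =>
      obtain ⟨a₁, rfl⟩ := i₁ k₁
      obtain ⟨a₂, rfl⟩ := i₂ k₂
      simp_all
  | sub _ _ i₁ i₂ =>
    cases h' with
    | sub k₁ k₂ =>
      obtain ⟨a₁, rfl⟩ := i₁ k₁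
      obtain ⟨a₂, rfl⟩ := i₂ k₂
      simp_all
  | cons _ _ i₁ i₂ =>
    cases h' with
    | cons k₁ k₂ =>
      obtain ⟨a₁, rfl⟩ := i₁ k₁
      obtain ⟨a₂, rfl⟩ := i₂ k₂
      simp_all
  | ifLe_true _ _ hle _ i₁ i₂ i₃ =>
    cases h' with
    | ifLe_true k₁ k₂ _ k₃ =>
      obtain ⟨_, rfl⟩ := i₁ k₁
      obtain ⟨_, rfl⟩ := i₂ k₂
      obtain ⟨rfl, rfl⟩ := i₃ k₃
      simp
    | ifLe_false k₁ k₂ hlt _ =>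
      have a₁ := (i₁ k₁).1
      have a₂ := (i₂ k₂).1
      simp only [Val.real.injEq] at a₁ a₂
      linarith
  | ifLe_false _ _ hlt _ i₁ i₂ i₃ =>
    cases h' with
    | ifLe_false k₁ k₂ _ k₃ =>
      obtain ⟨_, rfl⟩ := i₁ k₁
      obtain ⟨_, rfl⟩ := i₂ k₂
      obtain ⟨rfl, rfl⟩ := i₃ k₃
      simp
    | ifLe_true k₁ k₂ hle _ =>
      have a₁ := (i₁ k₁).1
      have a₂ := (i₂ k₂).1
      simp only [Val.real.injEq] at a₁ a₂
      linarith
  | fst _ i =>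
    cases h' with
    | fst k =>
      obtain ⟨a, rfl⟩ := i k
      simp_all
  | snd _ i =>
    cases h' with
    | snd k =>
      obtain ⟨a, rfl⟩ := i k
      simp_all
  | ifNil_nil _ _ i i₁ =>
    cases h' with
    | ifNil_nil k k₁ =>
      obtain ⟨_, rfl⟩ := i k
      obtain ⟨rfl, rfl⟩ := i₁ k₁
      simp
    | ifNil_cons k _ => cases (i k).1
  | ifNil_cons _ _ i i₂ =>
    cases h' with
    | ifNil_nil k _ => cases (i k).1
    | ifNil_cons k k₂ =>
      obtain ⟨_, rfl⟩ := i k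
      obtain ⟨rfl, rfl⟩ := i₂ k₂
      simp
  | bind _ _ i₁ i₂ =>
    cases h' with
    | bind k₁ k₂ =>
      obtain ⟨rfl, rfl⟩ := i₁ k₁
      obtain ⟨rfl, rfl⟩ := i₂ k₂
      simp
  | call _ _ i₁ i₂ =>
    cases h' with
    | call k₁ k₂ =>
      obtain ⟨rfl, rfl⟩ := i₁ k₁
      obtain ⟨rfl, rfl⟩ := i₂ k₂
      simp

/-! ### Dynamic similarity-join instances -/

/-- A point of `ℝ^d` with the `ℓ₁` metric. -/
abbrev Pt (d : ℕ) : Type := PiLp 1 (fun _ : Fin d => ℝ)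

/-- An instance: the two finite point sets. -/
structure Inst (d : ℕ) where
  A : Finset (Pt d)
  B : Finset (Pt d)

/-- The input size `n = |A| + |B|`. -/
def Inst.card {d : ℕ} (S : Inst d) : ℕ := S.A.card + S.B.card

/-- Insertion of a point into, or deletion of a point from, one of the two sets. -/
inductive Update (d : ℕ) : Type
  | insertA (p : Pt d)
  | deleteA (p : Pt d)
  | insertB (p : Pt d)
  | deleteB (p : Pt d)

open Classical in
/-- The instance after an update. -/
noncomputable def Update.apply {d : ℕ} : Update d → Inst d → Inst d
  | .insertA p, S => ⟨insert p S.A, S.B⟩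
  | .deleteA p, S => ⟨S.A.erase p, S.B⟩
  | .insertB p, S => ⟨S.A, insert p S.B⟩
  | .deleteB p, S => ⟨S.A, S.B.erase p⟩

/-- The instance after a sequence of updates. -/
noncomputable def Inst.after {d : ℕ} (S : Inst d) (us : List (Update d)) : Inst d :=
  us.foldl (fun S' u => u.apply S') S

/-- The list `l` contains every point of `A` exactly once, in any order. -/
def Lists {d : ℕ} (l : List (Pt d)) (A : Finset (Pt d)) : Prop :=
  l.Nodup ∧ ∀ p, p ∈ l ↔ p ∈ A

/-- A point is stored as the linked list of its `d` coordinates. -/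
def encPt {d : ℕ} (p : Pt d) : Val := Val.ofList (List.ofFn fun i => Val.real (p i))

/-- The input of the construction: threshold and two lists of points. -/
def encInput {d : ℕ} (r : ℝ) (lA lB : List (Pt d)) : Val :=
  .cons (.real r) (.cons (Val.ofList (lA.map encPt)) (Val.ofList (lB.map encPt)))

/-! ### Data structures -/

/-- The code of a dynamic data structure: function bodies and the entry points of its
operations. -/
structure Code (F : Type) where
  body : F → Expr F
  build : F
  insertA : F
  deleteA : F
  insertB : F
  deleteB : F
  first : F
  next : F

/-- Calling the function `f` with the argument `x` returns `y` after `t` steps. -/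
def Code.Run {F : Type} (P : Code F) (f : F) (x y : Val) (t : ℕ) : Prop :=
  Eval P.body [x] (P.body f) y t

/-- Performing one update turns the stored structure `s` into `s'` in `t` steps. -/
def Code.RunUpdate {F : Type} (P : Code F) {d : ℕ} (s : Val) (u : Update d) (s' : Val) (t : ℕ) :
    Prop :=
  match u with
  | .insertA p => P.Run P.insertA (.cons (encPt p) s) s' t
  | .deleteA p => P.Run P.deleteA (.cons (encPt p) s) s' t
  | .insertB p => P.Run P.insertB (.cons (encPt p) s) s' t
  | .deleteB p => P.Run P.deleteB (.cons (encPt p) s) s' t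

/-- Performing a sequence of updates, starting from the structure `s`, gives `s'` and takes `t`
steps in total. -/
inductive Code.RunUpdates {F : Type} (P : Code F) {d : ℕ} :
    Val → List (Update d) → Val → ℕ → Prop
  | nil {s : Val} : Code.RunUpdates P s [] s 0
  | cons {s s' s'' : Val} {u : Update d} {us : List (Update d)} {t T : ℕ}
      (h : P.RunUpdate s u s' t) (hs : Code.RunUpdates P s' us s'' T) :
      Code.RunUpdates P s (u :: us) s'' (t + T)

/-- `P.Enumerates δ f s l`: the enumeration that starts with calling `f` on `s` and goes on by
calling `next` on the state handed over by the previous call reports exactly the list `l` of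
pairs, in this order, and then terminates.  Each call either reports one pair together with a new
state, or returns the null pointer, which is the end of the enumeration.  The time before the
first result, between two consecutive results, and after the last result is at most `δ`. -/
inductive Code.Enumerates {F : Type} (P : Code F) {d : ℕ} (δ : ℕ) :
    F → Val → List (Pt d × Pt d) → Prop
  | done {f : F} {s : Val} {t : ℕ} (h : P.Run f s .nil t) (ht : t ≤ δ) :
      Code.Enumerates P δ f s []
  | report {f : F} {s s' : Val} {a b : Pt d} {l : List (Pt d × Pt d)} {t : ℕ}
      (h : P.Run f s (.cons (.cons (encPt a) (encPt b)) s') t) (ht : t ≤ δ)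
      (hl : Code.Enumerates P δ P.next s' l) :
      Code.Enumerates P δ f s ((a, b) :: l)

/-- The factor `(log n + 1) ^ c`, with the integer logarithm to base `2` (and `log 0 = 0`). -/
def polylog (c n : ℕ) : ℕ := (Nat.log 2 n + 1) ^ c

/-- The sum of the amortized costs `cost n` over a sequence of updates, where `n` is at each
update the size of the instance that it produces. -/
noncomputable def amortized {d : ℕ} (cost : ℕ → ℕ) : Inst d → List (Update d) → ℕ
  | _, [] => 0
  | S, u :: us => cost (u.apply S).card + amortized cost (u.apply S) us

end SimJoin

/-! A point is handled as the list of its coordinates behind a flag, `0` for `A` and `1` for `B`.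
Once the sign of `x_i - y_i` is known, `|x_i - y_i|` is linear, so each point can absorb its own
signed coordinate into an accumulated sum. These sums start at `0` on `A` and at `r` on `B`; when
all coordinates are used up, a pair is in the join iff the sum of `a` is at most the sum of `b`
(`join_iff`).

The signs are found by a multi-level range tree. A tree of level `m` is a balanced search tree with
the elements in its leaves, sorted by the first of the `m` coordinates that are left. Two different
elements are separated at exactly one node, and their order there gives the sign. Each node
therefore carries two secondary trees of level `m - 1`: one for the `A`-elements on the left and the
`B`-elements on the right, with the coordinate subtracted, and one for the opposite pairs, with the
coordinate added. On level `0` the key is the accumulated sum, and the pairs of the join that a node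
separates form a product of an `A`-part and a `B`-part. Ties do no harm, since the flag puts `A`
before `B` among equal keys (`ord_lt_ord_iff`). Hence every pair of the join appears at one place
only (`mem_pairs`, `nodup_pairs`).

On each level an element lies in logarithmically many nodes, which gives the bounds for construction
and size (`buildSpec`, `size_enc_le`). Updates use partial rebuilding: a node built with `W`
elements is rebuilt when its number `u` of updates would exceed `W / 4`. Until then weights drop by
a constant factor towards the leaves (`rank_lt`), and a potential proportional to `u` pays for the
next rebuilding (`updSpec`).

The enumeration keeps a stack of trees and products still to be reported. Flags in the nodes keep
empty entries off the stack, so every expansion of an entry leads towards a pair, and the delay is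
proportional to the height (`calls_next`). -/

namespace SimJoin

/-! ### A weakest-precondition calculus for the machine -/

/-- `P` holds for the `i`-th entry of the environment, which exists. -/
def onVar : List Val → ℕ → (Val → Prop) → Prop
  | [], _, _ => False
  | v :: _, 0, P => P v
  | _ :: env, i + 1, P => onVar env i P

/-- The value is a real number that satisfies `P`. -/
def onReal : Val → (ℝ → Prop) → Prop
  | .real x, P => P x
  | _, _ => False

/-- The value is a cell whose components satisfy `P`. -/
def onCons : Val → (Val → Val → Prop) → Prop
  | .cons a b, P => P a b
  | _, _ => False

/-- The value is the null pointer and `P` holds, or it is a cell and `Q` holds. -/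
def onNil : Val → Prop → Prop → Prop
  | .nil, P, _ => P
  | .cons _ _, _, Q => Q
  | .real _, _, _ => False

/-- Calling `f` on `v` returns a value and takes a time that satisfy `Q`. -/
def Calls {F : Type} (body : F → Expr F) (f : F) (v : Val) (Q : Val → ℕ → Prop) : Prop :=
  ∃ w s, Eval body [v] (body f) w s ∧ Q w s

theorem Calls.mono {F : Type} {body : F → Expr F} {f : F} {v : Val} {Q Q' : Val → ℕ → Prop}
    (h : Calls body f v Q) (hQ : ∀ w s, Q w s → Q' w s) : Calls body f v Q' := by
  obtain ⟨w, s, h, hq⟩ := h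
  exact ⟨w, s, h, hQ _ _ hq⟩

/-- Weakest precondition: evaluation of the expression ends with a value and a time that
satisfy `Q`. -/
def wp {F : Type} (body : F → Expr F) : Expr F → List Val → (Val → ℕ → Prop) → Prop
  | .var i, env, Q => onVar env i fun v => Q v 1
  | .const q, _, Q => Q (.real (q : ℝ)) 1
  | .add e₁ e₂, env, Q => wp body e₁ env fun v t => wp body e₂ env fun w s =>
      onReal v fun x => onReal w fun y => Q (.real (x + y)) (t + s + 1)
  | .sub e₁ e₂, env, Q => wp body e₁ env fun v t => wp body e₂ env fun w s =>
      onReal v fun x => onReal w fun y => Q (.real (x - y)) (t + s + 1)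
  | .ifLe e₁ e₂ e₃ e₄, env, Q => wp body e₁ env fun v t => wp body e₂ env fun w s =>
      onReal v fun x => onReal w fun y =>
        (x ≤ y → wp body e₃ env fun z k => Q z (t + s + k + 1)) ∧
        (y < x → wp body e₄ env fun z k => Q z (t + s + k + 1))
  | .nil, _, Q => Q .nil 1
  | .cons e₁ e₂, env, Q => wp body e₁ env fun v t => wp body e₂ env fun w s =>
      Q (.cons v w) (t + s + 1)
  | .fst e, env, Q => wp body e env fun v t => onCons v fun a _ => Q a (t + 1)
  | .snd e, env, Q => wp body e env fun v t => onCons v fun _ b => Q b (t + 1)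
  | .ifNil e e₁ e₂, env, Q => wp body e env fun v t => onNil v
      (wp body e₁ env fun w s => Q w (t + s + 1)) (wp body e₂ env fun w s => Q w (t + s + 1))
  | .bind e₁ e₂, env, Q => wp body e₁ env fun v t =>
      wp body e₂ (v :: env) fun w s => Q w (t + s + 1)
  | .call f e, env, Q => wp body e env fun v t => Calls body f v fun w s => Q w (t + s + 1)

theorem onVar_iff {env : List Val} {i : ℕ} {P : Val → Prop} :
    onVar env i P ↔ ∃ v, env[i]? = some v ∧ P v := by
  induction env generalizing i with
  | nil => simp [onVar]
  | cons v env ih => cases i <;> simp [onVar, ih]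

theorem exists_of_onReal {v : Val} {P : ℝ → Prop} (h : onReal v P) : ∃ x, v = .real x ∧ P x := by
  cases v <;> simp_all [onReal]

theorem exists_of_onCons {v : Val} {P : Val → Val → Prop} (h : onCons v P) :
    ∃ a b, v = .cons a b ∧ P a b := by
  cases v <;> simp_all [onCons]

/-- Soundness of the calculus. Function calls are kept opaque in `wp`, so structural induction on
the expression suffices; recursion of the program is treated by separate inductions for the single
functions. -/
theorem exists_eval_of_wp {F : Type} {body : F → Expr F} {e : Expr F} {env : List Val}
    {Q : Val → ℕ → Prop} (h : wp body e env Q) : ∃ v t, Eval body env e v t ∧ Q v t := by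
  induction e generalizing env Q with
  | var i =>
    obtain ⟨v, hv, hQ⟩ := onVar_iff.1 h
    exact ⟨v, 1, .var hv, hQ⟩
  | const q => exact ⟨_, _, .const, h⟩
  | nil => exact ⟨_, _, .nil, h⟩
  | add e₁ e₂ i₁ i₂ =>
    obtain ⟨v, t, h₁, h⟩ := i₁ h
    obtain ⟨w, s, h₂, h⟩ := i₂ h
    obtain ⟨x, rfl, h''⟩ := exists_of_onReal h
    obtain ⟨y, rfl, hh⟩ := exists_of_onReal h''
    exact ⟨_, _, .add h₁ h₂, hh⟩
  | sub e₁ e₂ i₁ i₂ =>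
    obtain ⟨v, t, h₁, h⟩ := i₁ h
    obtain ⟨w, s, h₂, h⟩ := i₂ h
    obtain ⟨x, rfl, h''⟩ := exists_of_onReal h
    obtain ⟨y, rfl, hh⟩ := exists_of_onReal h''
    exact ⟨_, _, .sub h₁ h₂, hh⟩
  | ifLe e₁ e₂ e₃ e₄ i₁ i₂ i₃ i₄ =>
    obtain ⟨v, t, h₁, h⟩ := i₁ h
    obtain ⟨w, s, h₂, h⟩ := i₂ h
    obtain ⟨x, rfl, h''⟩ := exists_of_onReal h
    obtain ⟨y, rfl, hh, hh'⟩ := exists_of_onReal h''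
    rcases le_or_gt x y with hxy | hxy
    · obtain ⟨z, k, h₃, h⟩ := i₃ (hh hxy)
      exact ⟨_, _, .ifLe_true h₁ h₂ hxy h₃, h⟩
    · obtain ⟨z, k, h₄, h⟩ := i₄ (hh' hxy)
      exact ⟨_, _, .ifLe_false h₁ h₂ hxy h₄, h⟩
  | cons e₁ e₂ i₁ i₂ =>
    obtain ⟨v, t, h₁, h⟩ := i₁ h
    obtain ⟨w, s, h₂, h⟩ := i₂ h
    exact ⟨_, _, .cons h₁ h₂, h⟩
  | fst e i =>
    obtain ⟨v, t, h₁, h⟩ := i h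
    obtain ⟨a, b, rfl, h⟩ := exists_of_onCons h
    exact ⟨_, _, .fst h₁, h⟩
  | snd e i =>
    obtain ⟨v, t, h₁, h⟩ := i h
    obtain ⟨a, b, rfl, h⟩ := exists_of_onCons h
    exact ⟨_, _, .snd h₁, h⟩
  | ifNil e e₁ e₂ i i₁ i₂ =>
    obtain ⟨v, t, h₁, h⟩ := i h
    cases v with
    | real x => exact h.elim
    | nil =>
      obtain ⟨z, k, h₃, h⟩ := i₁ h
      exact ⟨_, _, .ifNil_nil h₁ h₃, h⟩
    | cons a b =>
      obtain ⟨z, k, h₃, h⟩ := i₂ h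
      exact ⟨_, _, .ifNil_cons h₁ h₃, h⟩
  | bind e₁ e₂ i₁ i₂ =>
    obtain ⟨v, t, h₁, h⟩ := i₁ h
    obtain ⟨w, s, h₂, h⟩ := i₂ h
    exact ⟨_, _, .bind h₁ h₂, h⟩
  | call f e i =>
    obtain ⟨v, t, h₁, w, s, h₂, h⟩ := i h
    exact ⟨_, _, .call h₁ h₂, h⟩

/-! ### The program -/

/-- The functions of the program. -/
inductive Fn : Type
  | lexLe | le | or | and | half | merge | sort | len | toP | dist | leaf | mk | secs | build | flat | del
  | rebuild | updSec | upd | pushP | pushX | next | first | items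
  | buildMain | insertA | deleteA | insertB | deleteB

namespace Prog

abbrev X := Expr Fn
abbrev v0 : X := .var 0
abbrev v1 : X := .var 1
abbrev v2 : X := .var 2
abbrev v3 : X := .var 3
abbrev ff : X := .nil
abbrev tt : X := .cons .nil .nil

/-- The coordinates that an item has left. -/
abbrev coords (i : X) : X := .snd (.snd i)
/-- The accumulated signed sum of the coordinates of an item that have been used. -/
abbrev acc (i : X) : X := .fst (.snd i)
/-- The sort key of an item. -/
abbrev key (i : X) : X := .ifNil (coords i) (acc i) (.fst (coords i))
/-- The side of an item: `0` or `1`. -/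
abbrev side (i : X) : X := .fst (.fst i)
/-- Use up the first coordinate of an item with the sign `-`. -/
abbrev plus (i : X) : X :=
  .cons (.fst i) (.cons (.sub (acc i) (.fst (coords i))) (.snd (coords i)))
/-- Use up the first coordinate of an item with the sign `+`. -/
abbrev minus (i : X) : X :=
  .cons (.fst i) (.cons (.add (acc i) (.fst (coords i))) (.snd (coords i)))

/-- A tree is stored as flags and a body. The body is null for the empty tree, has a null first
component for a leaf, and is `((router, fuel), ((left, right), (secP, secM)))` for an inner node.
The argument of `router`, `fuel` and the like is the body alone. The fuel is the real number `W - 4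
* u`, which needs no multiplication to be maintained. -/
abbrev empty : X := .cons (.cons ff (.cons ff ff)) .nil
abbrev hasA (t : X) : X := .fst (.fst t)
abbrev hasB (t : X) : X := .fst (.snd (.fst t))
abbrev hasJ (t : X) : X := .snd (.snd (.fst t))
abbrev router (b : X) : X := .fst (.fst b)
abbrev fuel (b : X) : X := .snd (.fst b)
abbrev left (b : X) : X := .fst (.fst (.snd b))
abbrev right (b : X) : X := .snd (.fst (.snd b))
abbrev secP (b : X) : X := .fst (.snd (.snd b))
abbrev secM (b : X) : X := .snd (.snd (.snd b))

abbrev lexLe : X :=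
  .ifNil (.fst v0) tt <| .ifNil (.snd v0) ff <|
    .ifLe (.fst (.fst v0)) (.fst (.snd v0))
      (.ifLe (.fst (.snd v0)) (.fst (.fst v0))
        (.call .lexLe (.cons (.snd (.fst v0)) (.snd (.snd v0)))) tt) ff

/-- The whole element, with the flag in front, breaks ties of the key. -/
abbrev le : X :=
  .call .lexLe (.cons (.cons (key (.fst v0)) (.fst (.fst v0)))
    (.cons (key (.snd v0)) (.fst (.snd v0))))

abbrev or : X := .ifNil (.fst v0) (.snd v0) tt
abbrev and : X := .ifNil (.fst v0) ff (.snd v0)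

/-- Split the first list after half of the length of the second list. -/
abbrev half : X :=
  .ifNil (.snd v0) (.cons .nil (.fst v0)) <| .ifNil (.snd (.snd v0)) (.cons .nil (.fst v0)) <|
    .bind (.call .half (.cons (.snd (.fst v0)) (.snd (.snd (.snd v0))))) <|
      .cons (.cons (.fst (.fst v1)) (.fst v0)) (.snd v0)

abbrev merge : X :=
  .ifNil (.fst v0) (.snd v0) <| .ifNil (.snd v0) (.fst v0) <|
    .ifNil (.call .le (.cons (.fst (.fst v0)) (.fst (.snd v0))))
      (.cons (.fst (.snd v0)) (.call .merge (.cons (.fst v0) (.snd (.snd v0)))))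
      (.cons (.fst (.fst v0)) (.call .merge (.cons (.snd (.fst v0)) (.snd v0))))

abbrev sort : X :=
  .ifNil v0 .nil <| .ifNil (.snd v0) v0 <|
    .bind (.call .half (.cons v0 v0)) <|
      .call .merge (.cons (.call .sort (.fst v0)) (.call .sort (.snd v0)))

abbrev len : X := .ifNil v0 (.const 0) (.add (.const 1) (.call .len (.snd v0)))

/-- For a flag and an item: which secondary tree the item belongs to, if the flag tells whether
it belongs to the right subtree. -/
abbrev toP : X :=
  .ifLe (side (.snd v0)) (.const 0) (.ifNil (.fst v0) tt ff) (.ifNil (.fst v0) ff tt)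

/-- Distribute the items of a list to the lists for the two secondary trees. -/
abbrev dist : X :=
  .ifNil (.fst (.snd v0)) (.snd (.snd v0)) <|
    .bind (.fst (.fst (.snd v0))) <|
      .call .dist <| .cons (.fst v1) <| .cons (.snd (.fst (.snd v1))) <|
        .ifNil (.call .toP (.cons (.fst v1) v0))
          (.cons (.fst (.snd (.snd v1))) (.cons (minus v0) (.snd (.snd (.snd v1)))))
          (.cons (.cons (plus v0) (.fst (.snd (.snd v1)))) (.snd (.snd (.snd v1))))

abbrev leaf : X :=
  .ifLe (side v0) (.const 0) (.cons (.cons tt (.cons ff ff)) (.cons .nil v0))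
    (.cons (.cons ff (.cons tt ff)) (.cons .nil v0))

/-- Put the flags in front of the body of an inner node. -/
abbrev mk : X :=
  .bind (.call .or (.cons (hasA (left v0)) (hasA (right v0)))) <|
  .bind (.call .or (.cons (hasB (left v1)) (hasB (right v1)))) <|
  .bind (.call .or (.cons (hasJ (left v2)) (hasJ (right v2)))) <|
  .bind (.ifNil (coords (router v3)) (.call .and (.cons (hasA (left v3)) (hasB (right v3))))
      (.call .or (.cons (hasJ (secP v3)) (hasJ (secM v3))))) <|
    .cons (.cons v3 (.cons v2 (.call .or (.cons v1 v0)))) (.var 4)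

/-- Build the secondary trees for two lists of items. -/
abbrev secs : X :=
  .ifNil (coords (.fst (.snd v0))) (.cons empty empty) <|
    .bind (.call .dist (.cons tt (.cons (.snd v0)
      (.call .dist (.cons ff (.cons (.fst v0) (.cons .nil .nil))))))) <|
    .cons (.call .build (.fst v0)) (.call .build (.snd v0))

/-- After sorting and halving, the router is the least element of the right half and the fuel is the
number of elements. -/
abbrev build : X :=
  .ifNil v0 empty <| .ifNil (.snd v0) (.call .leaf (.fst v0)) <|
    .bind (.call .sort v0) <|
    .bind (.call .half (.cons v0 v0)) <|
    .bind (.call .secs v0) <|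
    .call .mk <| .cons (.cons (.fst (.snd v1)) (.call .len v3)) <|
      .cons (.cons (.call .build (.fst v1)) (.call .build (.snd v1))) v0

abbrev flat : X :=
  .ifNil (.snd (.fst v0)) (.snd v0) <|
  .ifNil (.fst (.snd (.fst v0))) (.cons (.snd (.snd (.fst v0))) (.snd v0)) <|
    .call .flat <| .cons (left (.snd (.fst v0))) <|
      .call .flat <| .cons (right (.snd (.fst v0))) (.snd v0)

/-- Delete an item from a list. -/
abbrev del : X :=
  .ifNil (.snd v0) .nil <|
  .bind (.call .del (.cons (.fst v0) (.snd (.snd v0)))) <|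
    .ifNil (.call .le (.cons (.fst v1) (.fst (.snd v1)))) (.cons (.fst (.snd v1)) v0) <|
      .ifNil (.call .le (.cons (.fst (.snd v1)) (.fst v1))) (.cons (.fst (.snd v1)) v0) v0

/-- The item is deleted in either case, so that the insertion of a present item creates no
duplicate. -/
abbrev rebuild : X :=
  .bind (.call .del (.cons (.fst (.snd v0)) (.call .flat (.cons (.snd (.snd v0)) .nil)))) <|
    .call .build (.ifNil (.fst v1) v0 (.cons (.fst (.snd v1)) v0))

/-- Update the secondary trees of a node.  The first flag tells whether the item belongs to the
right subtree. -/
abbrev updSec : X :=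
  .bind (.snd (.snd (.snd v0))) <|
  .bind (.fst (.snd (.snd v1))) <|
  .ifNil (coords (router v1)) (.cons (secP v1) (secM v1)) <|
  .ifNil (.call .toP (.cons (.fst v2) v0))
    (.cons (secP v1) (.call .upd (.cons (.fst (.snd v2)) (.cons (minus v0) (secM v1)))))
    (.cons (.call .upd (.cons (.fst (.snd v2)) (.cons (plus v0) (secP v1)))) (secM v1))

/-- Insert an item into a tree (if the flag is set) or delete it. -/
abbrev upd : X :=
  .ifNil (.snd (.snd (.snd v0))) (.call .rebuild v0) <|
  .ifNil (.fst (.snd (.snd (.snd v0)))) (.call .rebuild v0) <|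
  -- The fuel `W - 4 * u` is at least `4` iff one more update keeps `4 * u ≤ W`.
  .ifLe (.const 4) (fuel (.snd (.snd (.snd v0))))
    (.bind (.snd (.snd (.snd v0))) <|
      .bind (.call .le (.cons (router v0) (.fst (.snd v1)))) <|
      .bind (.ifNil v0
          (.cons (.call .upd (.cons (.fst v2) (.cons (.fst (.snd v2)) (left v1)))) (right v1))
          (.cons (left v1)
            (.call .upd (.cons (.fst v2) (.cons (.fst (.snd v2)) (right v1)))))) <|
      .bind (.call .updSec (.cons v1 (.cons (.fst v3) (.cons (.fst (.snd v3)) v2)))) <|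
      .call .mk <| .cons (.cons (router v3) (.sub (fuel v3) (.const 4))) (.cons v1 v0))
    (.call .rebuild v0)

/-- A stack entry with null first component stands for the join of one tree. Stored trees are never
null, so an entry for a product of two trees is told apart by its first component. -/
abbrev pushP : X := .ifNil (hasJ (.fst v0)) (.snd v0) (.cons (.cons .nil (.fst v0)) (.snd v0))

abbrev pushX : X :=
  .ifNil (hasA (.fst (.fst v0))) (.snd v0) <|
    .ifNil (hasB (.snd (.fst v0))) (.snd v0) v0

/-- Report the next pair. -/
abbrev next : X :=
  .ifNil v0 .nil <|
  .bind (.fst v0) <|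
  .bind (.snd v1) <|
  .ifNil (.fst v1)
    (.bind (.snd (.snd v1)) <|
      .call .next <| .call .pushP <| .cons (left v0) <| .call .pushP <| .cons (right v0) <|
        .ifNil (coords (router v0)) (.call .pushX (.cons (.cons (left v0) (right v0)) v1)) <|
          .call .pushP <| .cons (secP v0) <| .call .pushP <| .cons (secM v0) v1)
    (.ifNil (.fst (.snd (.fst v1)))
      (.ifNil (.fst (.snd (.snd v1)))
        (.cons (.cons (.snd (.fst (.snd (.snd (.fst v1))))) (.snd (.fst (.snd (.snd (.snd v1))))))
          v0)
        (.call .next <| .call .pushX <| .cons (.cons (.fst v1) (left (.snd (.snd v1)))) <|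
          .call .pushX <| .cons (.cons (.fst v1) (right (.snd (.snd v1)))) v0))
      (.call .next <| .call .pushX <| .cons (.cons (left (.snd (.fst v1))) (.snd v1)) <|
        .call .pushX <| .cons (.cons (right (.snd (.fst v1))) (.snd v1)) v0))

abbrev first : X := .call .next (.call .pushP (.cons (.snd v0) .nil))

/-- Turn a list of points into items, in front of a list of items. -/
abbrev items : X :=
  .ifNil (.fst (.snd v0)) (.snd (.snd v0)) <|
    .cons (.cons (.cons (.fst (.fst v0)) (.fst (.fst (.snd v0))))
        (.cons (.snd (.fst v0)) (.fst (.fst (.snd v0))))) <|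
      .call .items (.cons (.fst v0) (.cons (.snd (.fst (.snd v0))) (.snd (.snd v0))))

abbrev buildMain : X :=
  .cons (.fst v0) <| .call .build <|
    .call .items <| .cons (.cons (.const 0) (.const 0)) <| .cons (.fst (.snd v0)) <|
      .call .items <| .cons (.cons (.const 1) (.fst v0)) <| .cons (.snd (.snd v0)) .nil

/-- Update with the item that belongs to a point. -/
abbrev update (op s a : X) : X :=
  .cons (.fst (.snd v0)) <| .call .upd <| .cons op <|
    .cons (.cons (.cons s (.fst v0)) (.cons a (.fst v0))) (.snd (.snd v0))

end Prog

/-- The bodies of the functions. -/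
def body : Fn → Expr Fn
  | .lexLe => Prog.lexLe
  | .le => Prog.le
  | .or => Prog.or
  | .and => Prog.and
  | .half => Prog.half
  | .merge => Prog.merge
  | .sort => Prog.sort
  | .len => Prog.len
  | .toP => Prog.toP
  | .dist => Prog.dist
  | .leaf => Prog.leaf
  | .mk => Prog.mk
  | .secs => Prog.secs
  | .build => Prog.build
  | .flat => Prog.flat
  | .del => Prog.del
  | .rebuild => Prog.rebuild
  | .updSec => Prog.updSec
  | .upd => Prog.upd
  | .pushP => Prog.pushP
  | .pushX => Prog.pushX
  | .next => Prog.next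
  | .first => Prog.first
  | .items => Prog.items
  | .buildMain => Prog.buildMain
  | .insertA => Prog.update Prog.tt (.const 0) (.const 0)
  | .deleteA => Prog.update Prog.ff (.const 0) (.const 0)
  | .insertB => Prog.update Prog.tt (.const 1) (.fst (.snd Prog.v0))
  | .deleteB => Prog.update Prog.ff (.const 1) (.fst (.snd Prog.v0))

/-- The data structure as a program. -/
def code : Code Fn where
  body := body
  build := .buildMain
  insertA := .insertA
  deleteA := .deleteA
  insertB := .insertB
  deleteB := .deleteB
  first := .first
  next := .next

instance : Finite Fn := by
  refine Finite.of_injective (β := Fin 29) (fun f => Fn.casesOn f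
    0 1 2 3 4 5 6 7 8 9 10 11 12 13 14 15 16 17 18 19 20 21 22 23 24 25 26 27 28) ?_
  intro a b h
  cases a <;> cases b <;> first | rfl | exact absurd h (by decide)

/-- The specifications are proved by symbolic execution: `wp` is unfolded on the body, and the
remaining calls are discharged with earlier specifications or the induction hypothesis through
`Calls.mono`. -/
theorem calls_of_wp {f : Fn} {v : Val} {Q : Val → ℕ → Prop} (h : wp body (body f) [v] Q) :
    Calls body f v Q :=
  exists_eval_of_wp h

end SimJoin

namespace SimJoin

/-! ### Encodings -/

/-- A context gives for every element the accumulated sum and the coordinates that are left. -/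
abbrev Ctx : Type := List ℝ → ℝ × List ℝ

def encL (l : List ℝ) : Val := Val.ofList (l.map Val.real)

def encB : Bool → Val
  | true => .cons .nil .nil
  | false => .nil

/-- The complete element stays in the item, for breaking ties and for the output, next to the data
that depend on the context. -/
def item (c : Ctx) (e : List ℝ) : Val := .cons (encL e) (.cons (.real (c e).1) (encL (c e).2))

def encI (c : Ctx) (L : List (List ℝ)) : Val := Val.ofList (L.map (item c))

@[simp] theorem ofList_nil : Val.ofList [] = .nil := rfl
@[simp] theorem ofList_cons (a : Val) (l : List Val) :
    Val.ofList (a :: l) = .cons a (Val.ofList l) := rfl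
@[simp] theorem encL_nil : encL [] = .nil := rfl
@[simp] theorem encL_cons (x : ℝ) (l : List ℝ) : encL (x :: l) = .cons (.real x) (encL l) := rfl
@[simp] theorem encI_nil (c : Ctx) : encI c [] = .nil := rfl
@[simp] theorem encI_cons (c : Ctx) (e : List ℝ) (l : List (List ℝ)) :
    encI c (e :: l) = .cons (item c e) (encI c l) := rfl
@[simp] theorem encB_true : encB true = .cons .nil .nil := rfl
@[simp] theorem encB_false : encB false = .nil := rfl

@[simp] theorem onReal_real (x : ℝ) (P : ℝ → Prop) : onReal (.real x) P ↔ P x := Iff.rfl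
@[simp] theorem onCons_cons (a b : Val) (P : Val → Val → Prop) :
    onCons (.cons a b) P ↔ P a b := Iff.rfl
@[simp] theorem onNil_nil (P Q : Prop) : onNil .nil P Q ↔ P := Iff.rfl
@[simp] theorem onNil_cons (a b : Val) (P Q : Prop) : onNil (.cons a b) P Q ↔ Q := Iff.rfl

theorem onNil_encB (b : Bool) (P Q : Prop) : onNil (encB b) P Q ↔ if b then Q else P := by
  cases b <;> simp [onNil]

/-- The sort key of an element. -/
def keyOf (c : Ctx) (e : List ℝ) : ℝ :=
  match (c e).2 with
  | [] => (c e).1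
  | x :: _ => x

/-- Elements are sorted by this list in lexicographic order. -/
def ord (c : Ctx) (e : List ℝ) : List ℝ := keyOf c e :: e

theorem ord_injective (c : Ctx) : Function.Injective (ord c) := fun _ _ h => (List.cons.inj h).2

/-- For `x ≤ y`, adding `|x - y| = y - x` to the sum of `a` is equivalent to subtracting `x` from
the sum of `a` and `y` from that of `b`. This serves the pairs with `a` on the left; `Ctx.minus`
serves the others. -/
def Ctx.plus (c : Ctx) : Ctx := fun e => ((c e).1 - (c e).2.headD 0, (c e).2.tail)
def Ctx.minus (c : Ctx) : Ctx := fun e => ((c e).1 + (c e).2.headD 0, (c e).2.tail)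

/-- The first entry is the flag `0` or `1`. The default concerns only the empty list, which is never
stored. -/
noncomputable def isA (e : List ℝ) : Bool := decide (e.headD 0 ≤ 0)

/-- Whether an element belongs to the first secondary tree; `g` tells whether it belongs to the
right subtree. -/
noncomputable def toP (g : Bool) (e : List ℝ) : Bool := isA e ^^ g

/-! ### Simple functions of the program -/

theorem calls_or (a b : Bool) :
    Calls body .or (.cons (encB a) (encB b)) fun w s => w = encB (a || b) ∧ s ≤ 10 := by
  apply calls_of_wp
  cases a <;> simp [body, wp, onVar]

theorem calls_and (a b : Bool) :
    Calls body .and (.cons (encB a) (encB b)) fun w s => w = encB (a && b) ∧ s ≤ 10 := by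
  apply calls_of_wp
  cases a <;> simp [body, wp, onVar]

theorem cons_le_cons_iff' {x y : ℝ} {a b : List ℝ} :
    x :: a ≤ y :: b ↔ x < y ∨ x = y ∧ a ≤ b := by
  rw [← not_lt, List.cons_lt_cons_iff, ← not_lt (a := b)]
  rcases lt_trichotomy x y with h | h | h
  · simp [h, h.not_gt, h.ne']
  · simp [h]
  · simp [h, h.not_gt, h.ne']

theorem calls_lexLe (a b : List ℝ) :
    Calls body .lexLe (.cons (encL a) (encL b)) fun w s =>
      w = encB (decide (a ≤ b)) ∧ s ≤ 40 * (a.length + 1) := by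
  induction a generalizing b with
  | nil =>
    apply calls_of_wp
    have : ([] : List ℝ) ≤ b := not_lt.1 (List.not_lt_nil b)
    simp [body, wp, onVar, this]
  | cons x a ih =>
    apply calls_of_wp
    cases b with
    | nil =>
      have : ¬ x :: a ≤ [] := not_le.2 (List.nil_lt_cons x a)
      simp [body, wp, onVar, this]
      omega
    | cons y b =>
      simp only [body, wp, onVar, encL_cons, onCons_cons, onNil_cons, onReal_real]
      refine ⟨fun hxy => ⟨fun hyx => ?_, fun hxy' => ?_⟩, fun hyx => ?_⟩
      · refine (ih b).mono ?_
        rintro _ s ⟨rfl, hs⟩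
        obtain rfl := le_antisymm hxy hyx
        refine ⟨?_, ?_⟩
        · simp [cons_le_cons_iff']
        · simp only [List.length_cons]; omega
      · refine ⟨?_, ?_⟩
        · simp [cons_le_cons_iff', hxy']
        · simp only [List.length_cons]; omega
      · refine ⟨?_, ?_⟩
        · simp [cons_le_cons_iff', hyx.not_gt, hyx.ne']
        · simp only [List.length_cons]; omega

/-- Bound for the time of a comparison of elements with `D` entries. -/
def leTime (D : ℕ) : ℕ := 40 * (D + 3)

theorem calls_le {D : ℕ} (c : Ctx) {x : List ℝ} (hx : x.length = D) (y : List ℝ) :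
    Calls body .le (.cons (item c x) (item c y)) fun w s =>
      w = encB (decide (ord c x ≤ ord c y)) ∧ s ≤ leTime D := by
  apply calls_of_wp
  have key : Calls body .lexLe (.cons (.cons (.real (keyOf c x)) (encL x))
      (.cons (.real (keyOf c y)) (encL y))) fun w s =>
        w = encB (decide (ord c x ≤ ord c y)) ∧ s ≤ 40 * ((ord c x).length + 1) :=
    calls_lexLe (ord c x) (ord c y)
  have hlen : (ord c x).length = D + 1 := by simp [ord, hx]
  rw [hlen] at key
  simp only [body, wp, onVar, item, onCons_cons, leTime]
  have h₁ : ∀ e, (c e).2 = [] → keyOf c e = (c e).1 := fun e h => by simp [keyOf, h]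
  have h₂ : ∀ e z zs, (c e).2 = z :: zs → keyOf c e = z := fun e z zs h => by simp [keyOf, h]
  rcases hcx : (c x).2 with _ | ⟨x₀, xs⟩ <;> rcases hcy : (c y).2 with _ | ⟨y₀, ys⟩ <;>
    (first | rw [h₁ x hcx] at key | rw [h₂ x _ _ hcx] at key) <;>
    (first | rw [h₁ y hcy] at key | rw [h₂ y _ _ hcy] at key) <;>
    simp only [encL_nil, encL_cons, onNil_nil, onNil_cons, onCons_cons] <;>
    refine key.mono ?_ <;> rintro _ s ⟨rfl, hs⟩ <;> exact ⟨rfl, by omega⟩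

/-- The second list is a clock that advances by two cells while the first advances by one. -/
theorem calls_half (s f : List Val) (h : f.length / 2 ≤ s.length) :
    Calls body .half (.cons (Val.ofList s) (Val.ofList f)) fun w t =>
      w = .cons (Val.ofList (s.take (f.length / 2))) (Val.ofList (s.drop (f.length / 2))) ∧
      t ≤ 40 * (f.length + 1) := by
  induction hn : f.length using Nat.strong_induction_on generalizing s f with
  | _ n ih =>
    subst hn
    apply calls_of_wp
    match f, s with
    | [], s => simp [body, wp, onVar]
    | [a], s => simp [body, wp, onVar]
    | a :: b :: f, [] => simp at h
    | a :: b :: f, p :: s =>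
      simp only [body, wp, onVar, ofList_cons, onCons_cons, onNil_cons]
      have h2 : (a :: b :: f).length / 2 = f.length / 2 + 1 := by
        simp only [List.length_cons]; omega
      rw [h2] at h ⊢
      refine (ih f.length (by simp) s f (by simpa using h) rfl).mono ?_
      rintro _ t ⟨rfl, ht⟩
      simp only [onCons_cons, List.take_succ_cons, List.drop_succ_cons, ofList_cons,
        List.length_cons, true_and]
      omega

theorem calls_half_items (c : Ctx) (L : List (List ℝ)) :
    Calls body .half (.cons (encI c L) (encI c L)) fun w t =>
      w = .cons (encI c (L.take (L.length / 2))) (encI c (L.drop (L.length / 2))) ∧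
      t ≤ 40 * (L.length + 1) := by
  have := calls_half (L.map (item c)) (L.map (item c)) (Nat.div_le_self _ _)
  simpa [encI, List.map_take, List.map_drop] using this

theorem calls_merge {D : ℕ} (c : Ctx) (L₁ L₂ : List (List ℝ)) (h₁ : ∀ e ∈ L₁, e.length = D) :
    Calls body .merge (.cons (encI c L₁) (encI c L₂)) fun w t =>
      w = encI c (L₁.merge L₂ fun x y => decide (ord c x ≤ ord c y)) ∧
      t ≤ (leTime D + 40) * (L₁.length + L₂.length + 1) := by
  induction hn : L₁.length + L₂.length generalizing L₁ L₂ with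
  | zero =>
    obtain ⟨rfl, rfl⟩ : L₁ = [] ∧ L₂ = [] := by simpa using hn
    apply calls_of_wp
    simp [body, wp, onVar]
  | succ n ih =>
    apply calls_of_wp
    match L₁, L₂ with
    | [], L₂ =>
      simp [body, wp, onVar]
      nlinarith
    | x :: L₁, [] =>
      simp [body, wp, onVar]
      nlinarith
    | x :: L₁, y :: L₂ =>
      simp only [body, wp, onVar, encI_cons, onCons_cons, onNil_cons]
      refine (calls_le c (h₁ x (by simp)) y).mono ?_
      rintro _ s ⟨rfl, hs⟩
      rw [List.cons_merge_cons, onNil_encB]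
      simp only [List.length_cons] at hn
      split_ifs with hxy
      · refine (ih L₁ (y :: L₂) (fun e he => h₁ e (by simp [he]))
          (by simp only [List.length_cons]; omega)).mono ?_
        rintro _ t ⟨rfl, ht⟩
        refine ⟨by simp, ?_⟩
        rw [Nat.mul_succ]
        omega
      · refine (ih (x :: L₁) L₂ h₁ (by simp only [List.length_cons]; omega)).mono ?_
        rintro _ t ⟨rfl, ht⟩
        refine ⟨by simp, ?_⟩
        rw [Nat.mul_succ]
        omega

/-- Unit of the time bounds for elements with `D` entries. -/
def unit (D : ℕ) : ℕ := 10 * (leTime D + 100)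

/-- Merge sort; `p` bounds the number of halvings, each of which costs one `unit D` per element. -/
theorem calls_sort {D : ℕ} (c : Ctx) (L : List (List ℝ)) (hL : ∀ e ∈ L, e.length = D) (p : ℕ)
    (hp : L.length ≤ 2 ^ p) :
    Calls body .sort (encI c L) fun w t => ∃ L', w = encI c L' ∧ L'.Perm L ∧
      L'.Pairwise (fun x y => ord c x ≤ ord c y) ∧ t ≤ unit D * p * L.length + unit D := by
  induction p generalizing L with
  | zero =>
    apply calls_of_wp
    match L, hp with
    | [], _ =>
      simp only [body, wp, onVar, encI_nil, onNil_nil]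
      refine ⟨[], rfl, List.Perm.refl _, List.Pairwise.nil, ?_⟩
      simp [unit]; omega
    | [x], _ =>
      simp only [body, wp, onVar, encI_nil, encI_cons, onCons_cons, onNil_nil, onNil_cons]
      refine ⟨[x], rfl, List.Perm.refl _, List.pairwise_singleton _ _, ?_⟩
      simp [unit]; omega
    | x :: y :: L, h => simp at h
  | succ p ih =>
    apply calls_of_wp
    match L, hL, hp with
    | [], _, _ =>
      simp only [body, wp, onVar, encI_nil, onNil_nil]
      refine ⟨[], rfl, List.Perm.refl _, List.Pairwise.nil, ?_⟩
      simp [unit]; omega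
    | [x], _, _ =>
      simp only [body, wp, onVar, encI_nil, encI_cons, onCons_cons, onNil_nil, onNil_cons]
      refine ⟨[x], rfl, List.Perm.refl _, List.pairwise_singleton _ _, ?_⟩
      simp [unit]; nlinarith
    | x :: y :: L, hL, hp =>
      have hhalf := calls_half_items c (x :: y :: L)
      set M := x :: y :: L with hM
      have hM2 : 2 ≤ M.length := by simp [hM]
      have hn : M.length / 2 ≤ M.length := Nat.div_le_self _ _
      rw [pow_succ] at hp
      have e1 : (M.take (M.length / 2)).length = M.length / 2 := by simp [hn]
      have e2 : (M.drop (M.length / 2)).length = M.length - M.length / 2 := by simp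
      simp only [body, wp, onVar]
      rw [show encI c M = .cons (item c x) (.cons (item c y) (encI c L)) from rfl] at hhalf ⊢
      simp only [onCons_cons, onNil_cons]
      refine hhalf.mono ?_
      rintro _ t₀ ⟨rfl, ht₀⟩
      simp only [onCons_cons]
      refine (ih _ (fun e he => hL e (List.mem_of_mem_take he)) (by omega)).mono ?_
      rintro _ t₁ ⟨L₁, rfl, p₁, s₁, ht₁⟩
      refine (ih _ (fun e he => hL e (List.mem_of_mem_drop he)) (by omega)).mono ?_
      rintro _ t₂ ⟨L₂, rfl, p₂, s₂, ht₂⟩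
      refine (calls_merge (D := D) c L₁ L₂
        fun e he => hL e (List.mem_of_mem_take (p₁.subset he))).mono ?_
      rintro _ t₃ ⟨rfl, ht₃⟩
      refine ⟨_, rfl, ?_, ?_, ?_⟩
      · refine (List.merge_perm_append _).trans ?_
        refine (p₁.append p₂).trans ?_
        rw [List.take_append_drop]
      · have := List.pairwise_merge (le := fun x y => decide (ord c x ≤ ord c y))
          (fun a b d h h' => by
            simp only [decide_eq_true_eq] at h h' ⊢
            exact h.trans h')
          (fun a b => by simpa using le_total _ _) L₁ L₂ (s₁.imp (by simp)) (s₂.imp (by simp))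
        exact this.imp (by simp)
      · rw [p₁.length_eq, p₂.length_eq, e1, e2] at ht₃
        rw [e1] at ht₁
        rw [e2] at ht₂
        have e3 : M.length / 2 + (M.length - M.length / 2) = M.length := by omega
        rw [e3] at ht₃
        have e4 : unit D * p * (M.length / 2) + unit D * p * (M.length - M.length / 2)
            = unit D * p * M.length := by rw [← mul_add, e3]
        have e5 : unit D * (p + 1) * M.length = unit D * p * M.length + unit D * M.length := by ring
        rw [e5]
        unfold unit at *
        nlinarith

theorem calls_len (l : List Val) :
    Calls body .len (Val.ofList l) fun w t => w = .real l.length ∧ t ≤ 10 * (l.length + 1) := by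
  induction l with
  | nil =>
    apply calls_of_wp
    simp [body, wp, onVar]
  | cons a l ih =>
    apply calls_of_wp
    simp only [body, wp, onVar, ofList_cons, onCons_cons, onNil_cons]
    refine ih.mono ?_
    rintro _ s ⟨rfl, hs⟩
    simp only [onReal_real, List.length_cons]
    refine ⟨?_, by omega⟩
    push_cast
    rw [add_comm]

theorem calls_toP (g : Bool) (c : Ctx) {e : List ℝ} (he : e ≠ []) :
    Calls body .toP (.cons (encB g) (item c e)) fun w s => w = encB (toP g e) ∧ s ≤ 20 := by
  obtain ⟨x, e, rfl⟩ := List.exists_cons_of_ne_nil he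
  apply calls_of_wp
  simp only [body, wp, onVar, item, encL_cons, onCons_cons, onReal_real, toP, isA, List.headD_cons]
  constructor
  · intro h
    have h : x ≤ 0 := by simpa using h
    cases g <;> simp [h]
  · intro h
    have h : ¬ x ≤ 0 := by simpa using h
    cases g <;> simp [h]

/-- The accumulators reverse the order, hence statements up to permutation; the lists are sorted
again anyway when the secondary trees are built. -/
theorem calls_dist (g : Bool) (c : Ctx) (L P M : List (List ℝ)) (hL : ∀ e ∈ L, e ≠ [])
    (hc : ∀ e ∈ L, (c e).2 ≠ []) :
    Calls body .dist (.cons (encB g) (.cons (encI c L) (.cons (encI c.plus P) (encI c.minus M))))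
      fun w s => ∃ P' M', w = .cons (encI c.plus P') (encI c.minus M') ∧
        P'.Perm (L.filter (toP g) ++ P) ∧ M'.Perm (L.filter (fun e => !toP g e) ++ M) ∧
        s ≤ 100 * (L.length + 1) := by
  induction L generalizing P M with
  | nil =>
    apply calls_of_wp
    simp only [body, wp, onVar, encI_nil, onCons_cons, onNil_nil]
    exact ⟨P, M, rfl, by simp, by simp, by simp⟩
  | cons e L ih =>
    apply calls_of_wp
    obtain ⟨x, xs, hx⟩ := List.exists_cons_of_ne_nil (hc e (by simp))
    simp only [body, wp, onVar, encI_cons, onCons_cons, onNil_cons]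
    refine (calls_toP g c (hL e (by simp))).mono ?_
    rintro _ t ⟨rfl, ht⟩
    rw [onNil_encB]
    have hL' : ∀ e ∈ L, e ≠ [] := fun a ha => hL a (by simp [ha])
    have hc' : ∀ e ∈ L, (c e).2 ≠ [] := fun a ha => hc a (by simp [ha])
    split_ifs with hg
    · have := ih (e :: P) M hL' hc'
      simp only [encI_cons, item, Ctx.plus, hx, List.headD_cons, List.tail_cons] at this
      simp only [item, hx, encL_cons, onCons_cons, onReal_real]
      refine this.mono ?_
      rintro _ s ⟨P', M', rfl, hP, hM, hs⟩
      refine ⟨P', M', rfl, ?_, ?_, ?_⟩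
      · rw [List.filter_cons_of_pos hg]
        exact hP.trans List.perm_middle
      · rw [List.filter_cons_of_neg (by simp [hg])]
        exact hM
      · simp only [List.length_cons]; omega
    · have := ih P (e :: M) hL' hc'
      simp only [encI_cons, item, Ctx.minus, hx, List.headD_cons, List.tail_cons] at this
      simp only [item, hx, encL_cons, onCons_cons, onReal_real]
      refine this.mono ?_
      rintro _ s ⟨P', M', rfl, hP, hM, hs⟩
      refine ⟨P', M', rfl, ?_, ?_, ?_⟩
      · rw [List.filter_cons_of_neg hg]
        exact hP
      · rw [List.filter_cons_of_pos (by simp [hg])]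
        exact hM.trans List.perm_middle
      · simp only [List.length_cons]; omega

/-- Equality is tested by two comparisons, which is enough because `ord c` is injective. -/
theorem calls_del {D : ℕ} (c : Ctx) {x : List ℝ} (hx : x.length = D) (L : List (List ℝ))
    (hL : ∀ e ∈ L, e.length = D) :
    Calls body .del (.cons (item c x) (encI c L)) fun w s =>
      w = encI c (L.filter fun e => decide (e ≠ x)) ∧
      s ≤ (2 * leTime D + 60) * (L.length + 1) := by
  induction L with
  | nil =>
    apply calls_of_wp
    simp only [body, wp, onVar, encI_nil, onCons_cons, onNil_nil]
    exact ⟨rfl, by simp only [List.length_nil]; omega⟩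
  | cons y L ih =>
    apply calls_of_wp
    simp only [body, wp, onVar, encI_cons, onCons_cons, onNil_cons]
    refine (ih fun e he => hL e (by simp [he])).mono ?_
    rintro _ s ⟨rfl, hs⟩
    refine (calls_le c hx y).mono ?_
    rintro _ t ⟨rfl, ht⟩
    rw [onNil_encB]
    rw [List.length_cons, Nat.mul_succ]
    split_ifs with h
    · refine (calls_le c (hL y (by simp)) x).mono ?_
      rintro _ t' ⟨rfl, ht'⟩
      rw [onNil_encB]
      split_ifs with h'
      · have : x = y := ord_injective c (le_antisymm (by simpa using h) (by simpa using h'))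
        refine ⟨by simp [this], by omega⟩
      · have : y ≠ x := by rintro rfl; simp at h'
        refine ⟨by rw [List.filter_cons_of_pos (by simp [this])]; rfl, by omega⟩
    · have : y ≠ x := by rintro rfl; simp at h
      refine ⟨by rw [List.filter_cons_of_pos (by simp [this])]; rfl, by omega⟩

end SimJoin

namespace SimJoin

/-! ### Trees -/

/-- The trees of the data structure.  `W` is the number of elements when the node was built, `u`
the number of updates since then, `q` the router, `l` and `r` are the subtrees, `s` and `t` the
secondary trees for the pairs from `l × r` and from `r × l`. -/
inductive JTree : Type
  | nil
  | leaf (e : List ℝ)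
  | node (W u : ℕ) (q : List ℝ) (l r s t : JTree)

namespace JTree

noncomputable def set : JTree → Finset (List ℝ)
  | nil => ∅
  | leaf e => {e}
  | node _ _ _ l r _ _ => l.set ∪ r.set

def wt : JTree → ℕ
  | nil => 0
  | leaf _ => 1
  | node W _ _ _ _ _ _ => W

noncomputable def hasA : JTree → Bool
  | nil => false
  | leaf e => isA e
  | node _ _ _ l r _ _ => l.hasA || r.hasA

noncomputable def hasB : JTree → Bool
  | nil => false
  | leaf e => !isA e
  | node _ _ _ l r _ _ => l.hasB || r.hasB

/-- On level `0` only `l × r` contributes, since an `A`-element on the right has a larger key than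
every `B`-element on the left. -/
noncomputable def hasJ : JTree → ℕ → Bool
  | nil, _ => false
  | leaf _, _ => false
  | node _ _ _ l r _ _, 0 => (l.hasJ 0 || r.hasJ 0) || (l.hasA && r.hasB)
  | node _ _ _ l r s t, m + 1 => (l.hasJ (m + 1) || r.hasJ (m + 1)) || (s.hasJ m || t.hasJ m)

/-- Potential for the amortized analysis, with the weight `G m` for nodes of level `m`. -/
def phi (G : ℕ → ℕ) : JTree → ℕ → ℕ
  | nil, _ => 0
  | leaf _, _ => 0
  | node _ u _ l r s t, m =>
    u * G m + l.phi G m + r.phi G m + s.phi G (m - 1) + t.phi G (m - 1)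

noncomputable def flags (T : JTree) (m : ℕ) : Val :=
  .cons (encB T.hasA) (.cons (encB T.hasB) (encB (T.hasJ m)))

noncomputable def body : JTree → ℕ → Ctx → Val
  | nil, _, _ => .nil
  | leaf e, _, c => .cons .nil (item c e)
  | node W u q l r s t, m, c =>
    .cons (.cons (item c q) (.real ((W : ℝ) - 4 * (u : ℝ)))) <|
      .cons (.cons (.cons (l.flags m) (l.body m c)) (.cons (r.flags m) (r.body m c)))
        (.cons (.cons (s.flags (m - 1)) (s.body (m - 1) c.plus))
          (.cons (t.flags (m - 1)) (t.body (m - 1) c.minus)))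

/-- The stored form of a tree of level `m` in the context `c`. -/
noncomputable def enc (T : JTree) (m : ℕ) (c : Ctx) : Val := .cons (T.flags m) (T.body m c)

/-- The stored form of an inner node without its flags. -/
noncomputable def nodeBody (f : ℝ) (q : List ℝ) (l r s t : JTree) (m : ℕ) (c : Ctx) : Val :=
  .cons (.cons (item c q) (.real f)) <|
    .cons (.cons (l.enc m c) (r.enc m c)) (.cons (s.enc (m - 1) c.plus) (t.enc (m - 1) c.minus))

theorem enc_nil (m : ℕ) (c : Ctx) : nil.enc m c = .cons (.cons .nil (.cons .nil .nil)) .nil := rfl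

theorem enc_leaf (e : List ℝ) (m : ℕ) (c : Ctx) :
    (leaf e).enc m c = .cons ((leaf e).flags m) (.cons .nil (item c e)) := rfl

theorem enc_node (W u : ℕ) (q : List ℝ) (l r s t : JTree) (m : ℕ) (c : Ctx) :
    (node W u q l r s t).enc m c =
      .cons ((node W u q l r s t).flags m)
        (nodeBody ((W : ℝ) - 4 * (u : ℝ)) q l r s t m c) := rfl

/-- The elements of the two subtrees that belong to the first (`b = true`) or to the second
secondary tree. -/
noncomputable def secSet (b : Bool) (L R : Finset (List ℝ)) : Finset (List ℝ) :=
  L.filter (fun e => toP false e = b) ∪ R.filter (fun e => toP true e = b)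

/-- Invariants of an inner node. -/
structure NodeInv (D W u : ℕ) (q : List ℝ) (l r : JTree) (c : Ctx) : Prop where
  length_router : q.length = D
  two_le : 2 ≤ W
  -- Each further inequality is the state right after building, weakened by `u`, since an update
  -- changes a cardinality by at most one.
  four_mul_le : 4 * u ≤ W
  le_card : W ≤ l.set.card + r.set.card + u
  wt_left : l.wt ≤ (W + 1) / 2 + u
  wt_right : r.wt ≤ (W + 1) / 2 + u
  card_left : l.set.card ≤ (W + 1) / 2 + u
  card_right : r.set.card ≤ (W + 1) / 2 + u
  half_le_left : W / 2 ≤ l.set.card + u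
  half_le_right : W / 2 ≤ r.set.card + u
  left_lt : ∀ e ∈ l.set, ord c e < ord c q
  le_right : ∀ e ∈ r.set, ord c q ≤ ord c e

/-- Invariants of a tree of level `m` in the context `c`. -/
def Inv (D : ℕ) : JTree → ℕ → Ctx → Prop
  | nil, _, _ => True
  | leaf e, _, _ => e.length = D
  | node W u q l r s t, 0, c =>
    NodeInv D W u q l r c ∧ l.Inv D 0 c ∧ r.Inv D 0 c ∧ s = nil ∧ t = nil
  | node W u q l r s t, m + 1, c =>
    NodeInv D W u q l r c ∧ l.Inv D (m + 1) c ∧ r.Inv D (m + 1) c ∧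
      s.Inv D m c.plus ∧ t.Inv D m c.minus ∧
      s.set = secSet true l.set r.set ∧ t.set = secSet false l.set r.set

theorem Inv.node_inv {D W u : ℕ} {q : List ℝ} {l r s t : JTree} {m : ℕ} {c : Ctx}
    (h : (node W u q l r s t).Inv D m c) : NodeInv D W u q l r c := by
  cases m <;> exact h.1

theorem Inv.left {D W u : ℕ} {q : List ℝ} {l r s t : JTree} {m : ℕ} {c : Ctx}
    (h : (node W u q l r s t).Inv D m c) : l.Inv D m c := by
  cases m <;> exact h.2.1

theorem Inv.right {D W u : ℕ} {q : List ℝ} {l r s t : JTree} {m : ℕ} {c : Ctx}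
    (h : (node W u q l r s t).Inv D m c) : r.Inv D m c := by
  cases m
  · exact h.2.2.1
  · exact h.2.2.1

theorem Inv.length {D : ℕ} {T : JTree} {m : ℕ} {c : Ctx} (h : T.Inv D m c) {e : List ℝ}
    (he : e ∈ T.set) : e.length = D := by
  induction T with
  | nil => simp [set] at he
  | leaf a =>
    obtain rfl : e = a := by simpa [set] using he
    exact h
  | node W u q l r s t il ir =>
    rcases Finset.mem_union.1 he with he | he
    · exact il h.left he
    · exact ir h.right he

theorem NodeInv.disjoint {D W u : ℕ} {q : List ℝ} {l r : JTree} {c : Ctx}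
    (h : NodeInv D W u q l r c) : Disjoint l.set r.set :=
  Finset.disjoint_left.2 fun _ hl hr => (h.left_lt _ hl).not_ge (h.le_right _ hr)

end JTree

open JTree

/-- The context has `m` coordinates left for all elements with `D` entries. -/
def Ctx.HasLevel (D : ℕ) (c : Ctx) (m : ℕ) : Prop := ∀ e : List ℝ, e.length = D → (c e).2.length = m

theorem Ctx.HasLevel.plus {D m : ℕ} {c : Ctx} (h : c.HasLevel D (m + 1)) : c.plus.HasLevel D m :=
  fun e he => by simp [Ctx.plus, h e he]

theorem Ctx.HasLevel.minus {D m : ℕ} {c : Ctx} (h : c.HasLevel D (m + 1)) : c.minus.HasLevel D m :=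
  fun e he => by simp [Ctx.minus, h e he]

/-! ### Construction of trees -/

theorem calls_leaf (m : ℕ) (c : Ctx) {e : List ℝ} (he : e ≠ []) :
    Calls body .leaf (item c e) fun w s => w = (leaf e).enc m c ∧ s ≤ 30 := by
  obtain ⟨x, e, rfl⟩ := List.exists_cons_of_ne_nil he
  apply calls_of_wp
  simp only [body, wp, onVar, item, encL_cons, onCons_cons, onReal_real, enc_leaf, flags, hasA,
    hasB, hasJ, isA, List.headD_cons]
  constructor
  · intro h
    have h : x ≤ 0 := by simpa using h
    simp [h]
  · intro h
    have h : ¬ x ≤ 0 := by simpa using h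
    simp [h]

/-- The program does not store levels: level `0` is recognized by a router without coordinates left,
which is why the router needs length `D`. -/
theorem calls_mk {D : ℕ} {m : ℕ} {c : Ctx} (hc : c.HasLevel D m) {q : List ℝ} (hq : q.length = D)
    (W u : ℕ) (l r s t : JTree) :
    Calls body .mk (nodeBody ((W : ℝ) - 4 * (u : ℝ)) q l r s t m c) fun w k =>
      w = (node W u q l r s t).enc m c ∧ k ≤ 200 := by
  apply calls_of_wp
  rw [enc_node]
  generalize hf : (W : ℝ) - 4 * (u : ℝ) = f
  simp only [body, wp, onVar, nodeBody, enc, flags, onCons_cons]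
  refine (calls_or _ _).mono ?_
  rintro _ k₁ ⟨rfl, hk₁⟩
  refine (calls_or _ _).mono ?_
  rintro _ k₂ ⟨rfl, hk₂⟩
  refine (calls_or _ _).mono ?_
  rintro _ k₃ ⟨rfl, hk₃⟩
  have hl := hc q hq
  simp only [item, onCons_cons]
  cases m with
  | zero =>
    rw [List.length_eq_zero_iff] at hl
    simp only [hl, encL_nil, onNil_nil]
    refine (calls_and _ _).mono ?_
    rintro _ k₄ ⟨rfl, hk₄⟩
    refine (calls_or _ _).mono ?_
    rintro _ k₅ ⟨rfl, hk₅⟩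
    exact ⟨rfl, by omega⟩
  | succ m =>
    obtain ⟨x, xs, hx⟩ := List.exists_cons_of_length_eq_add_one hl
    simp only [hx, encL_cons, onNil_cons]
    refine (calls_or _ _).mono ?_
    rintro _ k₄ ⟨rfl, hk₄⟩
    refine (calls_or _ _).mono ?_
    rintro _ k₅ ⟨rfl, hk₅⟩
    exact ⟨rfl, by omega⟩

/-- Bound for the time per element for the secondary trees of a tree of level `m`. -/
def secTime (K lam : ℕ) : ℕ → ℕ
  | 0 => 0
  | m + 1 => (lam + 1) * (K * (lam + 1) + secTime K lam m)

/-- Bound for the time per element to build a tree of level `m`. -/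
def buildTime (K lam m : ℕ) : ℕ := (lam + 1) * (K * (lam + 1) + secTime K lam m)

/-- Invariants of the secondary trees of a node of level `m`. -/
def JTree.SecInv (D : ℕ) (L R : Finset (List ℝ)) (s t : JTree) : ℕ → Ctx → Prop
  | 0, _ => s = nil ∧ t = nil
  | m + 1, c => s.Inv D m c.plus ∧ t.Inv D m c.minus ∧ s.set = secSet true L R ∧
      t.set = secSet false L R

theorem JTree.Inv.mk {D W u : ℕ} {q : List ℝ} {l r s t : JTree} {m : ℕ} {c : Ctx}
    (h : NodeInv D W u q l r c) (hl : l.Inv D m c) (hr : r.Inv D m c)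
    (hs : SecInv D l.set r.set s t m c) : (node W u q l r s t).Inv D m c := by
  cases m <;> exact ⟨h, hl, hr, hs⟩

theorem JTree.Inv.sec {D W u : ℕ} {q : List ℝ} {l r s t : JTree} {m : ℕ} {c : Ctx}
    (h : (node W u q l r s t).Inv D m c) : SecInv D l.set r.set s t m c := by
  cases m <;> exact h.2.2.2

/-- Specification of the function `build` on level `m`, for lists with at most `2 ^ lam`
elements. -/
def BuildSpec (D lam m : ℕ) : Prop :=
  ∀ c : Ctx, c.HasLevel D m → ∀ L : List (List ℝ), (∀ e ∈ L, e.length = D) → L.Nodup →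
    ∀ p ≤ lam, L.length ≤ 2 ^ p →
    Calls SimJoin.body .build (encI c L) fun w k => ∃ T : JTree, w = T.enc m c ∧ T.Inv D m c ∧
      T.set = L.toFinset ∧ T.wt = L.length ∧ (∀ G, T.phi G m = 0) ∧
      k ≤ (p + 1) * (10 * unit D * (lam + 1) + secTime (10 * unit D) lam m) * L.length + unit D

theorem unit_ge (D : ℕ) : 1000 ≤ unit D := by unfold unit; omega

theorem calls_secs {D : ℕ} (hD : 1 ≤ D) {lam m : ℕ} (h : ∀ m', m = m' + 1 → BuildSpec D lam m')
    {c : Ctx} (hc : c.HasLevel D m) (L R : List (List ℝ)) (hL : ∀ e ∈ L, e.length = D)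
    (hR : ∀ e ∈ R, e.length = D) (hn : (L ++ R).Nodup) (hR0 : R ≠ [])
    (hlam : (L ++ R).length ≤ 2 ^ lam) :
    Calls SimJoin.body .secs (.cons (encI c L) (encI c R)) fun w k => ∃ s t : JTree,
      w = .cons (s.enc (m - 1) c.plus) (t.enc (m - 1) c.minus) ∧
      SecInv D L.toFinset R.toFinset s t m c ∧
      (∀ G, s.phi G (m - 1) = 0) ∧ (∀ G, t.phi G (m - 1) = 0) ∧
      k ≤ secTime (10 * unit D) lam m * (L ++ R).length + 100 * (L ++ R).length + 2 * unit D
        + 300 := by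
  obtain ⟨q, R', rfl⟩ := List.exists_cons_of_ne_nil hR0
  have hq := hc q (hR q (by simp))
  apply calls_of_wp
  simp only [SimJoin.body, wp, onVar, encI_cons, onCons_cons]
  have hqi : item c q = .cons (encL q) (.cons (.real (c q).1) (encL (c q).2)) := rfl
  cases m with
  | zero =>
    rw [List.length_eq_zero_iff] at hq
    simp only [hqi, hq, encL_nil, onNil_nil, onCons_cons]
    exact ⟨nil, nil, rfl, ⟨rfl, rfl⟩, fun _ => rfl, fun _ => rfl, by omega⟩
  | succ m =>
    obtain ⟨x, xs, hx⟩ := List.exists_cons_of_length_eq_add_one hq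
    have hne : ∀ e : List ℝ, e.length = D → e ≠ [] := by
      rintro e he rfl
      simp at he; omega
    have hne' : ∀ e : List ℝ, e.length = D → (c e).2 ≠ [] := by
      intro e he h0
      have := hc e he
      rw [h0] at this
      simp at this
    have d1 := calls_dist false c L [] [] (fun e he => hne e (hL e he))
      (fun e he => hne' e (hL e he))
    rw [hqi]
    simp only [hx, encL_cons, onNil_cons, onCons_cons]
    refine d1.mono ?_
    rintro _ k₁ ⟨P₁, M₁, rfl, hP₁, hM₁, hk₁⟩
    have d2 := calls_dist true c (q :: R') P₁ M₁ (fun e he => hne e (hR e he))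
      (fun e he => hne' e (hR e he))
    rw [encI_cons, hqi] at d2
    simp only [hx, encL_cons] at d2
    refine d2.mono ?_
    rintro _ k₂ ⟨P, M, rfl, hP, hM, hk₂⟩
    rw [← hx] at *
    simp only [onCons_cons]
    set R := q :: R' with hRdef
    have hPm : ∀ e, e ∈ P ↔ e ∈ R ∧ toP true e = true ∨ e ∈ L ∧ toP false e = true := by
      intro e
      rw [hP.mem_iff, List.mem_append, hP₁.mem_iff]
      simp
    have hMm : ∀ e, e ∈ M ↔ e ∈ R ∧ toP true e = false ∨ e ∈ L ∧ toP false e = false := by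
      intro e
      rw [hM.mem_iff, List.mem_append, hM₁.mem_iff]
      simp
    have hPM : P.length + M.length = (L ++ R).length := by
      rw [hP.length_eq, hM.length_eq, List.length_append, List.length_append, hP₁.length_eq,
        hM₁.length_eq, List.append_nil, List.append_nil, List.length_append]
      have e1 := List.length_eq_length_filter_add (l := L) (toP false)
      have e2 := List.length_eq_length_filter_add (l := R) (toP true)
      omega
    have hnL := (List.nodup_append'.1 hn).1
    have hnR := (List.nodup_append'.1 hn).2.1
    have hdj := (List.nodup_append'.1 hn).2.2
    have hPn : P.Nodup := by
      rw [hP.nodup_iff, List.nodup_append', hP₁.nodup_iff, List.append_nil]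
      refine ⟨hnR.filter _, hnL.filter _, fun e he he' => ?_⟩
      rw [hP₁.mem_iff, List.append_nil] at he'
      exact hdj (List.mem_of_mem_filter he') (List.mem_of_mem_filter he)
    have hMn : M.Nodup := by
      rw [hM.nodup_iff, List.nodup_append', hM₁.nodup_iff, List.append_nil]
      refine ⟨hnR.filter _, hnL.filter _, fun e he he' => ?_⟩
      rw [hM₁.mem_iff, List.append_nil] at he'
      exact hdj (List.mem_of_mem_filter he') (List.mem_of_mem_filter he)
    have hb := h m rfl
    refine (hb c.plus hc.plus P ?_ hPn lam le_rfl (by omega)).mono ?_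
    · intro e he
      rcases (hPm e).1 he with he | he
      · exact hR e he.1
      · exact hL e he.1
    rintro _ k₃ ⟨s, rfl, hs, hsP, -, hs0, hk₃⟩
    refine (hb c.minus hc.minus M ?_ hMn lam le_rfl (by omega)).mono ?_
    · intro e he
      rcases (hMm e).1 he with he | he
      · exact hR e he.1
      · exact hL e he.1
    rintro _ k₄ ⟨t, rfl, ht, htM, -, ht0, hk₄⟩
    refine ⟨s, t, rfl, ⟨hs, ht, ?_, ?_⟩, hs0, ht0, ?_⟩
    · ext e
      rw [hsP, List.mem_toFinset, hPm]
      simp only [secSet, Finset.mem_union, Finset.mem_filter, List.mem_toFinset]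
      tauto
    · ext e
      rw [htM, List.mem_toFinset, hMm]
      simp only [secSet, Finset.mem_union, Finset.mem_filter, List.mem_toFinset]
      tauto
    -- Every element goes to exactly one of `P` and `M`, so the cost per element of the lower level
    -- is charged once.
    · have e1 : secTime (10 * unit D) lam (m + 1) * (L ++ R).length =
          (lam + 1) * (10 * unit D * (lam + 1) + secTime (10 * unit D) lam m) * P.length +
          (lam + 1) * (10 * unit D * (lam + 1) + secTime (10 * unit D) lam m) * M.length := by
        rw [← hPM, secTime, mul_add]
      rw [e1]
      have e2 : (L ++ R).length = L.length + R.length := List.length_append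
      omega

theorem calls_len_items (c : Ctx) (L : List (List ℝ)) :
    Calls SimJoin.body .len (encI c L) fun w t =>
      w = .real L.length ∧ t ≤ 10 * (L.length + 1) := by
  simpa [encI] using calls_len (L.map (item c))

/-- The induction on `p` follows the halving of the primary tree. Sorting and the secondary trees
are charged with the fixed `lam`, so the cost per element is the same on each of the at most `p + 1`
layers. -/
theorem buildSpec_of_sec {D : ℕ} (hD : 1 ≤ D) {lam m : ℕ}
    (h : ∀ m', m = m' + 1 → BuildSpec D lam m') : BuildSpec D lam m := by
  have hU := unit_ge D
  intro c hc L hL hn p hp hLp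
  have hne : ∀ e : List ℝ, e.length = D → e ≠ [] := by
    rintro e he rfl
    simp at he; omega
  have small : ∀ L : List (List ℝ), (∀ e ∈ L, e.length = D) → L.length ≤ 1 → ∀ p,
      Calls SimJoin.body .build (encI c L) fun w k => ∃ T : JTree, w = T.enc m c ∧ T.Inv D m c ∧
        T.set = L.toFinset ∧ T.wt = L.length ∧ (∀ G, T.phi G m = 0) ∧
        k ≤ (p + 1) * (10 * unit D * (lam + 1) + secTime (10 * unit D) lam m) * L.length
          + unit D := by
    intro L hL hL1 p
    apply calls_of_wp
    match L, hL, hL1 with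
    | [], _, _ =>
      simp only [SimJoin.body, wp, onVar, encI_nil, onNil_nil]
      exact ⟨nil, rfl, trivial, rfl, rfl, fun _ => rfl, by omega⟩
    | [x], hL, _ =>
      simp only [SimJoin.body, wp, onVar, encI_nil, encI_cons, onCons_cons, onNil_nil, onNil_cons]
      refine (calls_leaf m c (hne x (hL x (by simp)))).mono ?_
      rintro _ k ⟨rfl, hk⟩
      exact ⟨leaf x, rfl, hL x (by simp), by simp [JTree.set], rfl, fun _ => rfl, by omega⟩
    | x :: y :: L, _, hL1 => simp at hL1
  induction p generalizing L with
  | zero => exact small L hL (by simpa using hLp) 0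
  | succ p ih =>
    by_cases hL1 : L.length ≤ 1
    · exact small L hL hL1 (p + 1)
    obtain ⟨x, y, L₀, hL₀⟩ : ∃ x y L₀, L = x :: y :: L₀ := by
      match L, hL1 with
      | [], h => simp at h
      | [x], h => simp at h
      | x :: y :: L₀, _ => exact ⟨x, y, L₀, rfl⟩
    have hlen2 : 2 ≤ L.length := by omega
    have hlam : L.length ≤ 2 ^ lam := hLp.trans (Nat.pow_le_pow_right (by norm_num) hp)
    apply calls_of_wp
    have hsort := calls_sort (D := D) c L hL lam hlam
    have hlenE := calls_len_items c L
    have hcons : ∃ a b d, encI c L = .cons a (.cons b d) := by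
      rw [hL₀]; exact ⟨_, _, _, rfl⟩
    obtain ⟨a, b, d, habd⟩ := hcons
    simp only [SimJoin.body, wp, onVar]
    rw [habd] at hsort hlenE ⊢
    simp only [onCons_cons, onNil_cons]
    refine hsort.mono ?_
    rintro _ k₁ ⟨L', rfl, hperm, hsorted, hk₁⟩
    have hlen' : L'.length = L.length := hperm.length_eq
    refine (calls_half_items c L').mono ?_
    rintro _ k₂ ⟨rfl, hk₂⟩
    set L₁ := L'.take (L'.length / 2) with hL₁
    set L₂ := L'.drop (L'.length / 2) with hL₂
    have happ : L₁ ++ L₂ = L' := List.take_append_drop _ _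
    have l1 : L₁.length = L.length / 2 := by
      rw [hL₁, List.length_take, hlen']; omega
    have l2 : L₂.length = L.length - L.length / 2 := by
      rw [hL₂, List.length_drop, hlen']
    have hD' : ∀ e ∈ L', e.length = D := fun e he => hL e (hperm.mem_iff.1 he)
    have hD₁ : ∀ e ∈ L₁, e.length = D := fun e he => hD' e (List.mem_of_mem_take he)
    have hD₂ : ∀ e ∈ L₂, e.length = D := fun e he => hD' e (List.mem_of_mem_drop he)
    have hn' : (L₁ ++ L₂).Nodup := by rw [happ]; exact hperm.nodup_iff.2 hn
    have hL₂0 : L₂ ≠ [] := by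
      intro h0; rw [h0] at l2; simp at l2; omega
    refine (calls_secs hD h hc L₁ L₂ hD₁ hD₂ hn' hL₂0 (by rw [happ, hlen']; exact hlam)).mono ?_
    rintro _ k₃ ⟨s, t, rfl, hst, hs0, ht0, hk₃⟩
    obtain ⟨q, R, hR⟩ := List.exists_cons_of_ne_nil hL₂0
    have hnd := List.nodup_append'.1 hn'
    rw [pow_succ] at hLp
    have ih₁ := ih L₁ hD₁ hnd.1 (by omega) (by omega)
    have ih₂ := ih L₂ hD₂ hnd.2.1 (by omega) (by omega)
    have hqD : q.length = D := hD₂ q (by simp [hR])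
    rw [hR] at ih₂ ⊢
    simp only [onCons_cons, encI_cons]
    refine hlenE.mono ?_
    rintro _ k₄ ⟨rfl, hk₄⟩
    refine ih₁.mono ?_
    rintro _ k₅ ⟨l, rfl, hl, hlset, hlwt, hl0, hk₅⟩
    refine ih₂.mono ?_
    rintro _ k₆ ⟨r, rfl, hr, hrset, hrwt, hr0, hk₆⟩
    rw [← hR] at hrset hrwt hk₆
    have hmk := calls_mk hc hqD L.length 0 l r s t
    -- A new node has `u = 0`, so its fuel is the computed length.
    have hz : ((L.length : ℝ) - 4 * ((0 : ℕ) : ℝ)) = (L.length : ℝ) := by simp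
    rw [hz] at hmk
    refine hmk.mono ?_
    rintro _ k₇ ⟨rfl, hk₇⟩
    have hsorted' := hsorted
    rw [← happ, List.pairwise_append] at hsorted'
    have hset : l.set ∪ r.set = L.toFinset := by
      rw [hlset, hrset, ← List.toFinset_append, happ]
      exact List.toFinset_eq_of_perm _ _ hperm
    refine ⟨_, rfl, JTree.Inv.mk ⟨hqD, hlen2, by omega, ?_, ?_, ?_, ?_, ?_, ?_, ?_, ?_, ?_⟩ hl hr ?_,
      hset, rfl,
      ?_, ?_⟩
    · rw [hlset, hrset, List.toFinset_card_of_nodup hnd.1, List.toFinset_card_of_nodup hnd.2.1]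
      omega
    · omega
    · omega
    · rw [hlset, List.toFinset_card_of_nodup hnd.1]; omega
    · rw [hrset, List.toFinset_card_of_nodup hnd.2.1]; omega
    · rw [hlset, List.toFinset_card_of_nodup hnd.1]; omega
    · rw [hrset, List.toFinset_card_of_nodup hnd.2.1]; omega
    · intro e he
      rw [hlset, List.mem_toFinset] at he
      have hq2 : q ∈ L₂ := by simp [hR]
      refine lt_of_le_of_ne (hsorted'.2.2 e he q hq2) fun h => ?_
      -- Equal order would make the two elements equal, but the halves of a duplicate-free list are
      -- disjoint.
      exact hnd.2.2 he (ord_injective c h ▸ hq2)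
    · intro e he
      rw [hrset, List.mem_toFinset, hR] at he
      rcases List.mem_cons.1 he with rfl | he
      · exact le_rfl
      · have := hsorted'.2.1
        rw [hR] at this
        exact List.rel_of_pairwise_cons this he
    · rw [hlset, hrset]; exact hst
    · intro G
      simp [phi, hl0, hr0, hs0, ht0]
    · rw [happ, hlen'] at hk₃
      rw [hlen'] at hk₂
      have e1 : L₁.length + L₂.length = L.length := by omega
      set X := 10 * unit D * (lam + 1) + secTime (10 * unit D) lam m with hX
      have e2 : (p + 1) * X * L₁.length + (p + 1) * X * L₂.length = (p + 1) * X * L.length := by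
        rw [← mul_add, e1]
      have e3 : (p + 1 + 1) * X * L.length = (p + 1) * X * L.length +
          10 * (unit D * lam * L.length) + 10 * (unit D * L.length) +
          secTime (10 * unit D) lam m * L.length := by
        rw [hX]; ring
      have e4 : unit D * 2 ≤ unit D * L.length := Nat.mul_le_mul_left _ hlen2
      have e5 : 1000 * L.length ≤ unit D * L.length := Nat.mul_le_mul_right _ hU
      rw [e3]
      omega

theorem buildSpec {D : ℕ} (hD : 1 ≤ D) (lam m : ℕ) : BuildSpec D lam m := by
  induction m with
  | zero => exact buildSpec_of_sec hD fun m' h => by simp at h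
  | succ m ih => exact buildSpec_of_sec hD fun m' h => by obtain rfl := Nat.succ.inj h; exact ih

end SimJoin

namespace SimJoin

open JTree

/-! ### Updates of trees -/

/-- Insertion (`true`) or deletion (`false`) of an element. -/
noncomputable def app (op : Bool) (x : List ℝ) (S : Finset (List ℝ)) : Finset (List ℝ) :=
  if op then insert x S else S.erase x

theorem mem_app {op : Bool} {x e : List ℝ} {S : Finset (List ℝ)} :
    e ∈ app op x S ↔ if e = x then op = true else e ∈ S := by
  cases op <;> by_cases h : e = x <;> simp [app, h]

theorem card_app_le (op : Bool) (x : List ℝ) (S : Finset (List ℝ)) :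
    (app op x S).card ≤ S.card + 1 := by
  cases op
  · exact (Finset.card_erase_le).trans (Nat.le_succ _)
  · exact Finset.card_insert_le _ _

theorem le_card_app (op : Bool) (x : List ℝ) (S : Finset (List ℝ)) :
    S.card ≤ (app op x S).card + 1 := by
  cases op
  · have := Finset.pred_card_le_card_erase (s := S) (a := x)
    simp only [app, Bool.false_eq_true, if_false]
    omega
  · exact (Finset.card_le_card (Finset.subset_insert _ _)).trans (Nat.le_succ _)

/-- The sides `L` and `R` send `x` to opposite secondary trees, by the exclusive or in `toP`. Hence
an update of `x` on one side cannot interfere with the contribution of the other side to the same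
secondary tree. -/
theorem secSet_app_left (b op : Bool) (x : List ℝ) (L R : Finset (List ℝ)) :
    secSet b (app op x L) R =
      if toP false x = b then app op x (secSet b L R) else secSet b L R := by
  ext e
  by_cases hb : toP false x = b
  · rw [if_pos hb, mem_app]
    simp only [secSet, Finset.mem_union, Finset.mem_filter, mem_app]
    by_cases he : e = x
    · subst he
      have : ¬ toP true e = b := by rw [← hb]; simp [toP]
      simp [hb, this]
    · simp [he]
  · rw [if_neg hb]
    simp only [secSet, Finset.mem_union, Finset.mem_filter, mem_app]
    by_cases he : e = x
    · subst he
      simp [hb]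
    · simp [he]

theorem secSet_app_right (b op : Bool) (x : List ℝ) (L R : Finset (List ℝ)) :
    secSet b L (app op x R) =
      if toP true x = b then app op x (secSet b L R) else secSet b L R := by
  ext e
  by_cases hb : toP true x = b
  · rw [if_pos hb, mem_app]
    simp only [secSet, Finset.mem_union, Finset.mem_filter, mem_app]
    by_cases he : e = x
    · subst he
      have : ¬ toP false e = b := by rw [← hb]; simp [toP]
      simp [hb, this]
    · simp [he]
  · rw [if_neg hb]
    simp only [secSet, Finset.mem_union, Finset.mem_filter, mem_app]
    by_cases he : e = x
    · subst he
      simp [hb]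
    · simp [he]

theorem card_secSet_le (b : Bool) (L R : Finset (List ℝ)) :
    (secSet b L R).card ≤ L.card + R.card :=
  (Finset.card_union_le _ _).trans
    (add_le_add (Finset.card_filter_le _ _) (Finset.card_filter_le _ _))

/-! ### Weights, flattening and rebuilding -/

theorem JTree.NodeInv.card_node {D W u : ℕ} {q : List ℝ} {l r : JTree} {c : Ctx}
    (h : NodeInv D W u q l r c) (s t : JTree) :
    (node W u q l r s t).set.card = l.set.card + r.set.card :=
  Finset.card_union_of_disjoint h.disjoint

theorem JTree.Inv.wt_le {D : ℕ} {T : JTree} {m : ℕ} {c : Ctx} (h : T.Inv D m c) :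
    3 * T.wt ≤ 4 * T.set.card := by
  cases T with
  | nil => simp [wt]
  | leaf e => simp [wt, JTree.set]
  | node W u q l r s t =>
    have hn := h.node_inv
    rw [hn.card_node]
    have h1 := hn.le_card
    have h2 := hn.four_mul_le
    simp only [wt]
    omega

/-- The invariants force both subtrees of an inner node to be nonempty, so there are fewer inner
nodes than leaves. The `50` saved in a nonempty tree pays for the node above it; the second
alternative is only for the empty tree. -/
theorem calls_flat {D : ℕ} {T : JTree} {m : ℕ} {c : Ctx} (h : T.Inv D m c) (R : List (List ℝ)) :
    Calls SimJoin.body .flat (.cons (T.enc m c) (encI c R)) fun w k => ∃ L, w = encI c (L ++ R) ∧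
      L.Nodup ∧ L.toFinset = T.set ∧
      (k + 50 ≤ 100 * T.set.card ∨ T.set.card = 0 ∧ k ≤ 20) := by
  induction T generalizing R with
  | nil =>
    apply calls_of_wp
    simp only [SimJoin.body, wp, onVar, enc_nil, onCons_cons, onNil_nil]
    exact ⟨[], rfl, List.nodup_nil, rfl, Or.inr ⟨rfl, by omega⟩⟩
  | leaf e =>
    apply calls_of_wp
    simp only [SimJoin.body, wp, onVar, enc_leaf, onCons_cons, onNil_nil, onNil_cons]
    exact ⟨[e], rfl, List.nodup_singleton _, rfl, Or.inl (by simp [JTree.set])⟩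
  | node W u q l r s t il ir =>
    apply calls_of_wp
    have hn := h.node_inv
    simp only [SimJoin.body, wp, onVar, enc_node, nodeBody, onCons_cons, onNil_cons]
    refine (ir h.right R).mono ?_
    rintro _ k₁ ⟨L₂, rfl, n₂, s₂, hk₁⟩
    refine (il h.left (L₂ ++ R)).mono ?_
    rintro _ k₂ ⟨L₁, rfl, n₁, s₁, hk₂⟩
    refine ⟨L₁ ++ L₂, by rw [List.append_assoc], ?_, ?_, Or.inl ?_⟩
    · rw [List.nodup_append']
      refine ⟨n₁, n₂, fun e h₁ h₂ => ?_⟩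
      rw [← List.mem_toFinset] at h₁ h₂
      rw [s₁] at h₁
      rw [s₂] at h₂
      exact Finset.disjoint_left.1 hn.disjoint h₁ h₂
    · rw [List.toFinset_append, s₁, s₂]; rfl
    · rw [hn.card_node]
      have h1 := hn.half_le_left
      have h2 := hn.half_le_right
      have h3 := hn.four_mul_le
      have h4 := hn.two_le
      omega

/-- Prepaid time for the next building of a tree of level `m`, for each update. -/
def payTime (D lam m : ℕ) : ℕ := 7 * (buildTime (10 * unit D) lam m + 3 * unit D)

theorem calls_rebuild {D : ℕ} (hD : 1 ≤ D) {lam m : ℕ} {c : Ctx} (hc : c.HasLevel D m) {T : JTree}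
    (h : T.Inv D m c) (op : Bool) {x : List ℝ} (hx : x.length = D)
    (hlam : T.set.card + 1 ≤ 2 ^ lam) :
    Calls SimJoin.body .rebuild (.cons (encB op) (.cons (item c x) (T.enc m c))) fun w k =>
      ∃ T' : JTree, w = T'.enc m c ∧ T'.Inv D m c ∧ T'.set = app op x T.set ∧
      T'.wt = T'.set.card ∧ (∀ G, T'.phi G m = 0) ∧
      k + 50 ≤ (buildTime (10 * unit D) lam m + 3 * unit D) * (T.set.card + 1) := by
  apply calls_of_wp
  simp only [SimJoin.body, wp, onVar, onCons_cons]
  refine (calls_flat h []).mono ?_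
  rintro _ k₁ ⟨L, rfl, hLn, hLs, hk₁⟩
  rw [List.append_nil]
  have hcard : L.length = T.set.card := by rw [← hLs, List.toFinset_card_of_nodup hLn]
  have hLD : ∀ e ∈ L, e.length = D := fun e he =>
    h.length (by rw [← hLs]; exact List.mem_toFinset.2 he)
  refine (calls_del c hx L hLD).mono ?_
  rintro _ k₂ ⟨rfl, hk₂⟩
  set L' := L.filter fun e => decide (e ≠ x) with hL'
  have hL'len : L'.length ≤ L.length := List.length_filter_le _ _
  have hL'n : L'.Nodup := hLn.filter _
  have hL'x : x ∉ L' := by simp [hL']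
  have hU := unit_ge D
  -- The common end of insertion and deletion: `M` is the list to build from and `j` the time spent
  -- before.
  have fin : ∀ (M : List (List ℝ)) (j : ℕ), j ≤ k₁ + k₂ + 100 → M.Nodup → M.toFinset = app op x T.set →
      (∀ e ∈ M, e.length = D) → M.length ≤ L.length + 1 →
      Calls SimJoin.body .build (encI c M) fun w s => ∃ T' : JTree, w = T'.enc m c ∧
        T'.Inv D m c ∧ T'.set = app op x T.set ∧ T'.wt = T'.set.card ∧ (∀ G, T'.phi G m = 0) ∧
        j + s + 150 ≤ (buildTime (10 * unit D) lam m + 3 * unit D) * (T.set.card + 1) := by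
    intro M j hj hMn hMs hMD hMl
    refine (buildSpec hD lam m c hc M hMD hMn lam le_rfl (by omega)).mono ?_
    rintro _ k₃ ⟨T', rfl, hT', hset, hwt, hphi, hk₃⟩
    refine ⟨T', rfl, hT', hset.trans hMs, ?_, hphi, ?_⟩
    · rw [hwt, hset, List.toFinset_card_of_nodup hMn]
    · rw [← hcard]
      have e1 : (lam + 1) * (10 * unit D * (lam + 1) + secTime (10 * unit D) lam m) * M.length ≤
          buildTime (10 * unit D) lam m * (L.length + 1) := by
        rw [buildTime]; exact Nat.mul_le_mul_left _ hMl
      have e2 : (2 * leTime D + 60) * (L.length + 1) ≤ unit D * (L.length + 1) :=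
        Nat.mul_le_mul_right _ (by unfold unit; omega)
      have e3 : 1000 * (L.length + 1) ≤ unit D * (L.length + 1) := Nat.mul_le_mul_right _ hU
      have e4 : unit D ≤ unit D * (L.length + 1) := Nat.le_mul_of_pos_right _ (by omega)
      rw [add_mul, mul_assoc 3]
      omega
  cases op with
  | false =>
    rw [encB_false, onNil_nil]
    refine (fin L' (k₁ + k₂ + 50) (by omega) hL'n ?_ (fun e he => hLD e (List.mem_of_mem_filter he))
      (by omega)).mono ?_
    · ext e
      rw [mem_app, List.mem_toFinset, hL', List.mem_filter, ← hLs, List.mem_toFinset]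
      by_cases he : e = x <;> simp [he]
    · rintro _ k ⟨T', rfl, h1, h2, h3, h4, h5⟩
      exact ⟨T', rfl, h1, h2, h3, h4, by omega⟩
  | true =>
    rw [encB_true, onNil_cons]
    have := fin (x :: L') (k₁ + k₂ + 50) (by omega) (List.nodup_cons.2 ⟨hL'x, hL'n⟩) (by
      ext e
      rw [mem_app, List.mem_toFinset, List.mem_cons, hL', List.mem_filter, ← hLs,
        List.mem_toFinset]
      by_cases he : e = x <;> simp [he]) (by
      intro e he
      rcases List.mem_cons.1 he with rfl | he
      · exact hx
      · exact hLD e (List.mem_of_mem_filter he)) (by simp only [List.length_cons]; omega)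
    rw [encI_cons] at this
    refine this.mono ?_
    rintro _ k ⟨T', rfl, h1, h2, h3, h4, h5⟩
    exact ⟨T', rfl, h1, h2, h3, h4, by omega⟩

/-- A bound for the height of a tree that was built with `w` elements. -/
def rank (w : ℕ) : ℕ := Nat.log 2 (w ^ 4)

/-- Weights drop at least by the factor `5 / 6`, up to rounding for small `W`, and `(5 / 6) ^ 4 < 1
/ 2`. This is the reason for the fourth power in `rank`. -/
theorem rank_lt {w W u : ℕ} (hW : 2 ≤ W) (hu : 4 * u ≤ W) (hw : w ≤ (W + 1) / 2 + u) :
    rank w + 1 ≤ rank W := by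
  unfold rank
  have h16 : 2 ^ 4 ≤ W ^ 4 := Nat.pow_le_pow_left hW 4
  rcases Nat.eq_zero_or_pos w with rfl | hw0
  · have : 1 ≤ Nat.log 2 (W ^ 4) := Nat.log_pos (by norm_num) (by omega)
    simpa using this
  · have key : 2 * w ^ 4 ≤ W ^ 4 := by
      by_cases h6 : W < 6
      · interval_cases W <;> (have : w ≤ 4 := by omega) <;> interval_cases w <;> omega
      · have h1 : 4 * w ≤ 3 * W + 2 := by omega
        have h2 : 12 * w ≤ 10 * W := by omega
        have h3 : (12 * w) ^ 4 ≤ (10 * W) ^ 4 := Nat.pow_le_pow_left h2 4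
        rw [mul_pow, mul_pow] at h3
        omega
    rw [← Nat.log_mul_base (by norm_num) (by positivity)]
    exact Nat.log_mono_right (by rw [mul_comm]; exact key)

theorem rank_le_of_wt_le {w n lam : ℕ} (h : 3 * w ≤ 4 * n) (hn : n ≤ 2 ^ lam) :
    rank w ≤ 4 * lam + 4 := by
  have h1 : w ≤ 2 ^ (lam + 1) := by rw [pow_succ]; omega
  have h2 : w ^ 4 ≤ 2 ^ (4 * lam + 4) := by
    calc w ^ 4 ≤ (2 ^ (lam + 1)) ^ 4 := Nat.pow_le_pow_left h1 4
      _ = 2 ^ (4 * lam + 4) := by rw [← pow_mul]; congr 1; ring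
  calc rank w ≤ Nat.log 2 (2 ^ (4 * lam + 4)) := Nat.log_mono_right h2
    _ = _ := Nat.log_pow (by norm_num) _

/-- Bound for the amortized time to update the secondary trees of a node of level `m`. -/
def secUpdTime (D lam : ℕ) : ℕ → ℕ
  | 0 => 0
  | m + 1 => (4 * lam + 5) * (unit D + payTime D lam m + secUpdTime D lam m)

/-- Specification of the function `upd` for the tree `T`. -/
def UpdSpec (D lam : ℕ) (T : JTree) : Prop :=
  ∀ m : ℕ, ∀ c : Ctx, c.HasLevel D m → T.Inv D m c → ∀ op : Bool, ∀ x : List ℝ, x.length = D →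
    T.set.card + 1 ≤ 2 ^ lam →
    Calls SimJoin.body .upd (.cons (encB op) (.cons (item c x) (T.enc m c))) fun w k =>
      ∃ T' : JTree, w = T'.enc m c ∧ T'.Inv D m c ∧ T'.set = app op x T.set ∧
      (T'.wt = T.wt ∨ T'.wt = T'.set.card ∧ ∀ G, T'.phi G m = 0) ∧
      k + T'.phi (payTime D lam) m ≤ T.phi (payTime D lam) m +
        (rank T.wt + 1) * (unit D + payTime D lam m + secUpdTime D lam m)

/-- Exactly one secondary tree is concerned. Its specification is used one level lower and in a new
context, which is why `UpdSpec` quantifies over both. -/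
theorem calls_updSec {D : ℕ} (hD : 1 ≤ D) {lam m : ℕ} {c : Ctx} (hc : c.HasLevel D m) {q : List ℝ}
    (hq : q.length = D) (f : ℝ) (l r : JTree) {s t : JTree} (hs : UpdSpec D lam s)
    (ht : UpdSpec D lam t) (hst : SecInv D l.set r.set s t m c) (g op : Bool) {x : List ℝ}
    (hx : x.length = D) (hlam : l.set.card + r.set.card + 1 ≤ 2 ^ lam) :
    Calls SimJoin.body .updSec
      (.cons (encB g) (.cons (encB op) (.cons (item c x) (nodeBody f q l r s t m c)))) fun w k =>
      ∃ s' t' : JTree, w = .cons (s'.enc (m - 1) c.plus) (t'.enc (m - 1) c.minus) ∧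
        SecInv D (if g then l.set else app op x l.set) (if g then app op x r.set else r.set)
          s' t' m c ∧
        k + s'.phi (payTime D lam) (m - 1) + t'.phi (payTime D lam) (m - 1) ≤
          s.phi (payTime D lam) (m - 1) + t.phi (payTime D lam) (m - 1) +
          secUpdTime D lam m + 200 := by
  apply calls_of_wp
  have hlq := hc q hq
  have hlx := hc x hx
  have hx0 : x ≠ [] := by
    rintro rfl
    simp at hx; omega
  have hqi : item c q = .cons (encL q) (.cons (.real (c q).1) (encL (c q).2)) := rfl
  simp only [SimJoin.body, wp, onVar, nodeBody, onCons_cons, hqi]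
  cases m with
  | zero =>
    rw [List.length_eq_zero_iff] at hlq
    simp only [hlq, encL_nil, onNil_nil]
    exact ⟨s, t, rfl, hst, by omega⟩
  | succ m =>
    obtain ⟨y, ys, hy⟩ := List.exists_cons_of_length_eq_add_one hlq
    obtain ⟨z, zs, hz⟩ := List.exists_cons_of_length_eq_add_one hlx
    have htoP := calls_toP g c hx0
    have hxi : item c x = .cons (encL x) (.cons (.real (c x).1) (.cons (.real z) (encL zs))) := by
      simp [item, hz]
    have hxp : item c.plus x = .cons (encL x) (.cons (.real ((c x).1 - z)) (encL zs)) := by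
      simp [item, Ctx.plus, hz]
    have hxm : item c.minus x = .cons (encL x) (.cons (.real ((c x).1 + z)) (encL zs)) := by
      simp [item, Ctx.minus, hz]
    obtain ⟨hsI, htI, hsS, htS⟩ := hst
    have cs := card_secSet_le true l.set r.set
    have ct := card_secSet_le false l.set r.set
    rw [← hsS] at cs
    rw [← htS] at ct
    have us := hs m c.plus hc.plus hsI op x hx (by omega)
    have ut := ht m c.minus hc.minus htI op x hx (by omega)
    rw [hxp] at us
    rw [hxm] at ut
    simp only [hy, encL_cons, onNil_cons]
    refine htoP.mono ?_
    rintro _ k₁ ⟨rfl, hk₁⟩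
    rw [onNil_encB, hxi]
    simp only [onCons_cons, onReal_real, Nat.add_sub_cancel]
    have hset : ∀ b, secSet b (if g then l.set else app op x l.set)
        (if g then app op x r.set else r.set) =
        if toP g x = b then app op x (secSet b l.set r.set) else secSet b l.set r.set := by
      intro b
      cases g
      · exact secSet_app_left _ _ _ _ _
      · exact secSet_app_right _ _ _ _ _
    have hrank : ∀ w n, 3 * w ≤ 4 * n → n ≤ l.set.card + r.set.card →
        (rank w + 1) * (unit D + payTime D lam m + secUpdTime D lam m) ≤
          secUpdTime D lam (m + 1) := by
      intro w n h1 h2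
      rw [secUpdTime]
      have := rank_le_of_wt_le (lam := lam) h1 (by omega)
      exact Nat.mul_le_mul_right _ (by omega)
    by_cases hg : toP g x = true
    · rw [if_pos hg]
      refine us.mono ?_
      rintro _ k₂ ⟨s', rfl, hs', hss, -, hk₂⟩
      refine ⟨s', t, rfl, ⟨hs', htI, ?_, ?_⟩, ?_⟩
      · rw [hset, if_pos hg, hss, hsS]
      · rw [hset, if_neg (by simp [hg]), htS]
      · have := hrank _ _ hsI.wt_le cs
        omega
    · rw [if_neg hg]
      refine ut.mono ?_
      rintro _ k₂ ⟨t', rfl, ht', hts, -, hk₂⟩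
      refine ⟨s, t', rfl, ⟨hsI, ht', ?_, ?_⟩, ?_⟩
      · rw [hset, if_neg hg, hsS]
      · rw [hset, if_pos (by simpa using hg), hts, htS]
      · have := hrank _ _ htI.wt_le ct
        omega

/-- Structural induction covers the secondary trees too, as they are components of the node. Every
node on the search path costs `unit D` for its own work, `payTime` for the increase of `u`, and
`secUpdTime` for one secondary tree. -/
theorem updSpec {D : ℕ} (hD : 1 ≤ D) (lam : ℕ) (T : JTree) : UpdSpec D lam T := by
  have hU := unit_ge D
  -- The case of rebuilding. With `B` the cost per element, the time is at most `6 * B * (u + 1)`.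
  -- As `payTime` is `7 * B`, the released potential pays for `u` shares and the current update for
  -- the last one.
  have small : ∀ (T : JTree) (m : ℕ) (c : Ctx), c.HasLevel D m → T.Inv D m c → ∀ (op : Bool)
      (x : List ℝ), x.length = D → T.set.card + 1 ≤ 2 ^ lam →
      (∃ u, T.set.card + 1 ≤ 6 * (u + 1) ∧ u * payTime D lam m ≤ T.phi (payTime D lam) m) → ∀ j ≤ 50,
      Calls SimJoin.body .rebuild (.cons (encB op) (.cons (item c x) (T.enc m c))) fun w k =>
      ∃ T' : JTree, w = T'.enc m c ∧ T'.Inv D m c ∧ T'.set = app op x T.set ∧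
      (T'.wt = T.wt ∨ T'.wt = T'.set.card ∧ ∀ G, T'.phi G m = 0) ∧
      j + k + T'.phi (payTime D lam) m ≤ T.phi (payTime D lam) m +
        (rank T.wt + 1) * (unit D + payTime D lam m + secUpdTime D lam m) := by
    intro T m c hc hT op x hx hlam ⟨u, hu, hphi⟩ j hj
    refine (calls_rebuild hD hc hT op hx hlam).mono ?_
    rintro _ k ⟨T', rfl, h1, h2, h3, h4, h5⟩
    refine ⟨T', rfl, h1, h2, Or.inr ⟨h3, h4⟩, ?_⟩
    rw [h4]
    set B := buildTime (10 * unit D) lam m + 3 * unit D with hB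
    have e1 : B * (T.set.card + 1) ≤ B * (6 * (u + 1)) := Nat.mul_le_mul_left _ hu
    have e2 : B * (6 * (u + 1)) ≤ u * payTime D lam m + payTime D lam m := by
      rw [payTime, ← hB]; nlinarith [Nat.zero_le (B * u)]
    have e3 : payTime D lam m ≤
        (rank T.wt + 1) * (unit D + payTime D lam m + secUpdTime D lam m) := by
      nlinarith [Nat.zero_le (rank T.wt * (unit D + payTime D lam m + secUpdTime D lam m))]
    omega
  induction T with
  | nil =>
    intro m c hc hT op x hx hlam
    apply calls_of_wp
    have := small nil m c hc hT op x hx hlam ⟨0, by simp [JTree.set], by simp⟩ 30 (by omega)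
    simp only [enc_nil] at this
    simp only [SimJoin.body, wp, onVar, enc_nil, onCons_cons, onNil_nil]
    refine this.mono ?_
    rintro _ k ⟨T', h1, h2, h3, h4, h5⟩
    exact ⟨T', h1, h2, h3, h4, by omega⟩
  | leaf e =>
    intro m c hc hT op x hx hlam
    apply calls_of_wp
    have := small (leaf e) m c hc hT op x hx hlam ⟨0, by simp [JTree.set], by simp⟩ 50 (by omega)
    simp only [enc_leaf] at this
    simp only [SimJoin.body, wp, onVar, enc_leaf, onCons_cons, onNil_nil, onNil_cons]
    refine this.mono ?_
    rintro _ k ⟨T', h1, h2, h3, h4, h5⟩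
    exact ⟨T', h1, h2, h3, h4, by omega⟩
  | node W u q l r s t il ir is it =>
    intro m c hc hT op x hx hlam
    have hn := hT.node_inv
    apply calls_of_wp
    have hq := hn.length_router
    have hcard := hn.card_node s t
    simp only [SimJoin.body, wp, onVar, enc_node, onCons_cons]
    rw [hcard] at hlam
    have hbody : nodeBody ((W : ℝ) - 4 * (u : ℝ)) q l r s t m c =
      .cons (.cons (item c q) (.real ((W : ℝ) - 4 * (u : ℝ))))
        (.cons (.cons (l.enc m c) (r.enc m c))
          (.cons (s.enc (m - 1) c.plus) (t.enc (m - 1) c.minus))) := rfl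
    have hup := fun g => calls_updSec hD hc hq ((W : ℝ) - 4 * (u : ℝ)) l r is it hT.sec g op hx
      (by omega)
    have hsm := small _ m c hc hT op x hx (by rw [hcard]; exact hlam)
    rw [enc_node] at hsm
    rw [hbody] at hup hsm ⊢
    simp only [onCons_cons, onNil_cons, onReal_real]
    have hlt4 := hn.four_mul_le
    constructor
    · intro hf
      have hf' : (4 : ℝ) * ((u : ℝ) + 1) ≤ W := by push_cast at hf; linarith
      have hu : 4 * (u + 1) ≤ W := by exact_mod_cast hf'
      have hf2 : (W : ℝ) - 4 * (u : ℝ) - ((4 : ℚ) : ℝ) = (W : ℝ) - 4 * ((u + 1 : ℕ) : ℝ) := by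
        push_cast; ring
      rw [hf2]
      refine (calls_le c hq x).mono ?_
      rintro _ k₁ ⟨rfl, hk₁⟩
      have hk₁U : k₁ + 800 ≤ unit D := by unfold unit; omega
      have h1 := hn.le_card
      have h2 := hn.card_left
      have h3 := hn.card_right
      have h4 := hn.wt_left
      have h5 := hn.wt_right
      have h6 := hn.half_le_left
      have h7 := hn.half_le_right
      have h8 := hn.two_le
      set E := unit D + payTime D lam m + secUpdTime D lam m with hE
      have hwt : (node W u q l r s t).wt = W := rfl
      by_cases hg : ord c q ≤ ord c x
      · have hg' : decide (ord c q ≤ ord c x) = true := by simpa using hg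
        rw [hg', encB_true, onNil_cons]
        have hup := hup true
        rw [encB_true, if_pos rfl, if_pos rfl] at hup
        refine (ir m c hc hT.right op x hx (by omega)).mono ?_
        rintro _ k₂ ⟨r', rfl, hrI, hrS, hrW, hk₂⟩
        refine hup.mono ?_
        rintro _ k₃ ⟨s', t', rfl, hst, hk₃⟩
        have hmk := calls_mk hc hq W (u + 1) l r' s' t'
        refine hmk.mono ?_
        rintro _ k₄ ⟨rfl, hk₄⟩
        have c1 := card_app_le op x r.set
        have c2 := le_card_app op x r.set
        rw [← hrS] at c1 c2
        -- The subtree either kept its weight or was rebuilt, and then its weight is its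
        -- cardinality.
        have w1 : r'.wt ≤ (W + 1) / 2 + (u + 1) := by
          rcases hrW with h | ⟨h, -⟩ <;> omega
        refine ⟨_, rfl, JTree.Inv.mk ⟨hq, h8, hu, by omega, by omega, w1, by omega, by omega,
          by omega, by omega, hn.left_lt, ?_⟩ hT.left hrI (by rw [hrS]; exact hst), ?_, Or.inl rfl, ?_⟩
        · intro e he
          rw [hrS, mem_app] at he
          by_cases hex : e = x
          · rw [hex]; exact hg
          · rw [if_neg hex] at he
            exact hn.le_right e he
        · ext e
          simp only [JTree.set, Finset.mem_union, hrS, mem_app]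
          by_cases hex : e = x
          · have : x ∉ l.set := fun hx => (hn.left_lt x hx).not_ge hg
            simp [hex, this]
          · simp [hex]
        · have hr := rank_lt h8 hlt4 h5
          -- The drop of the rank frees one share `E` for the present node.
          have e1 : (rank r.wt + 1) * E + E ≤ (rank W + 1) * E := by
            rw [← Nat.succ_mul]; exact Nat.mul_le_mul_right _ (by omega)
          rw [← hE] at hk₂
          simp only [phi, hwt]
          rw [Nat.succ_mul u]
          omega
      · have hg' : decide (ord c q ≤ ord c x) = false := by simpa using hg
        rw [hg', encB_false, onNil_nil]
        have hup := hup false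
        rw [encB_false, if_neg (by simp), if_neg (by simp)] at hup
        refine (il m c hc hT.left op x hx (by omega)).mono ?_
        rintro _ k₂ ⟨l', rfl, hlI, hlS, hlW, hk₂⟩
        refine hup.mono ?_
        rintro _ k₃ ⟨s', t', rfl, hst, hk₃⟩
        have hmk := calls_mk hc hq W (u + 1) l' r s' t'
        refine hmk.mono ?_
        rintro _ k₄ ⟨rfl, hk₄⟩
        have c1 := card_app_le op x l.set
        have c2 := le_card_app op x l.set
        rw [← hlS] at c1 c2
        have w1 : l'.wt ≤ (W + 1) / 2 + (u + 1) := by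
          rcases hlW with h | ⟨h, -⟩ <;> omega
        refine ⟨_, rfl, JTree.Inv.mk ⟨hq, h8, hu, by omega, w1, by omega, by omega, by omega,
          by omega, by omega, ?_, hn.le_right⟩ hlI hT.right (by rw [hlS]; exact hst), ?_, Or.inl rfl, ?_⟩
        · intro e he
          rw [hlS, mem_app] at he
          by_cases hex : e = x
          · rw [hex]; exact not_le.1 hg
          · rw [if_neg hex] at he
            exact hn.left_lt e he
        · ext e
          simp only [JTree.set, Finset.mem_union, hlS, mem_app]
          by_cases hex : e = x
          · have : x ∉ r.set := fun hx => hg (hn.le_right x hx)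
            simp [hex, this]
          · simp [hex]
        · have hr := rank_lt h8 hlt4 h4
          have e1 : (rank l.wt + 1) * E + E ≤ (rank W + 1) * E := by
            rw [← Nat.succ_mul]; exact Nat.mul_le_mul_right _ (by omega)
          rw [← hE] at hk₂
          simp only [phi, hwt]
          rw [Nat.succ_mul u]
          omega
    · intro hf
      have hf' : (W : ℝ) < 4 * ((u : ℝ) + 1) := by push_cast at hf; linarith
      have hu : W < 4 * (u + 1) := by exact_mod_cast hf'
      have h2 := hn.card_left
      have h3 := hn.card_right
      -- Here `W ≤ 4 * u + 3`, so the cardinality is at most `W + 1 + 2 * u ≤ 6 * u + 4`.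
      refine (hsm ⟨u, by rw [hcard]; omega, ?_⟩ 50 le_rfl).mono ?_
      · simp only [phi]; omega
      rintro _ k ⟨T', h1, h2, h3, h4, h5⟩
      exact ⟨T', h1, h2, h3, h4, by omega⟩

end SimJoin

namespace SimJoin

open JTree

/-! ### Height and size -/

namespace JTree

def height : JTree → ℕ
  | nil => 0
  | leaf _ => 1
  | node _ _ _ l r s t => max (max l.height r.height) (max s.height t.height) + 1

theorem Inv.sec_succ {D W u : ℕ} {q : List ℝ} {l r s t : JTree} {m : ℕ} {c : Ctx}
    (h : (node W u q l r s t).Inv D (m + 1) c) :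
    s.Inv D m c.plus ∧ t.Inv D m c.minus ∧ s.set = secSet true l.set r.set ∧
      t.set = secSet false l.set r.set :=
  h.sec

/-- A descent lowers the rank inside a tree. Passing to a secondary tree resets the rank, to at most
`4 * lam + 4`, but lowers the level. -/
theorem height_le {D lam : ℕ} {T : JTree} {m : ℕ} {c : Ctx} (h : T.Inv D m c)
    (hlam : T.set.card ≤ 2 ^ lam) : T.height ≤ rank T.wt + 2 + m * (4 * lam + 6) := by
  induction T generalizing m c with
  | nil => simp [height]
  | leaf e => simp [height]; omega
  | node W u q l r s t il ir is it =>
    have hn := h.node_inv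
    rw [hn.card_node] at hlam
    have h1 := il h.left (by omega)
    have h2 := ir h.right (by omega)
    have h3 := rank_lt hn.two_le hn.four_mul_le hn.wt_left
    have h4 := rank_lt hn.two_le hn.four_mul_le hn.wt_right
    have h56 : s.height ≤ m * (4 * lam + 6) ∧ t.height ≤ m * (4 * lam + 6) := by
      cases m with
      | zero =>
        obtain ⟨rfl, rfl⟩ : s = nil ∧ t = nil := h.sec
        simp [height]
      | succ m =>
        obtain ⟨hs, ht, hsS, htS⟩ := h.sec_succ
        have cs := card_secSet_le true l.set r.set
        have ct := card_secSet_le false l.set r.set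
        rw [← hsS] at cs
        rw [← htS] at ct
        have h5 := is hs (by omega)
        have h6 := it ht (by omega)
        have h7 := rank_le_of_wt_le (lam := lam) hs.wt_le (by omega)
        have h8 := rank_le_of_wt_le (lam := lam) ht.wt_le (by omega)
        rw [Nat.succ_mul]
        omega
    simp only [height, wt]
    omega

end JTree

/-- Unit of the bounds for the size. -/
def sizeUnit (D : ℕ) : ℕ := 20 * (D + 5)

/-- Bound for the size per element of the secondary trees of a tree of level `m`. -/
def secSize (D lam : ℕ) : ℕ → ℕ
  | 0 => 0
  | m + 1 => (4 * lam + 5) * (5 * sizeUnit D + 2 * secSize D lam m)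

theorem size_encL (l : List ℝ) : (encL l).size = 2 * l.length + 1 := by
  induction l with
  | nil => rfl
  | cons x l ih =>
    rw [encL_cons, Val.size, ih, Val.size, List.length_cons]
    omega

theorem size_encB_le (b : Bool) : (encB b).size ≤ 3 := by
  cases b <;> simp [Val.size]

theorem size_flags_le (T : JTree) (m : ℕ) : (T.flags m).size ≤ 11 := by
  have h1 := size_encB_le T.hasA
  have h2 := size_encB_le T.hasB
  have h3 := size_encB_le (T.hasJ m)
  simp only [flags, Val.size]
  omega

/-- The separate summand `sizeUnit D` covers empty trees. A node pays five units, for its own words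
and for this summand of its four components, and `secSize` twice because each secondary tree is
bounded by all elements of the node. -/
theorem size_enc_le {D lam : ℕ} {T : JTree} {m : ℕ} {c : Ctx} (hm : m ≤ D) (hc : c.HasLevel D m)
    (h : T.Inv D m c) (hlam : T.set.card ≤ 2 ^ lam) :
    (T.enc m c).size ≤ sizeUnit D +
      T.set.card * ((rank T.wt + 1) * (5 * sizeUnit D + 2 * secSize D lam m)) := by
  have hitem : ∀ e : List ℝ, ∀ m c, e.length = D → m ≤ D → Ctx.HasLevel D c m →
      (item c e).size ≤ 4 * D + 6 := by
    intro e m c he hm hc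
    simp only [item, Val.size, size_encL, he, hc e he]
    omega
  induction T generalizing m c with
  | nil =>
    simp only [enc_nil, Val.size, sizeUnit]
    omega
  | leaf e =>
    have h1 := hitem e m c h hm hc
    have h2 := size_flags_le (leaf e) m
    simp only [enc_leaf, Val.size]
    unfold sizeUnit
    omega
  | node W u q l r s t il ir is it =>
    have hn := h.node_inv
    have hcard := hn.card_node s t
    rw [hcard] at hlam ⊢
    have h1 := il hm hc h.left (by omega)
    have h2 := ir hm hc h.right (by omega)
    have h3 := rank_lt hn.two_le hn.four_mul_le hn.wt_left
    have h4 := rank_lt hn.two_le hn.four_mul_le hn.wt_right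
    have hq := hitem q m c hn.length_router hm hc
    have hf := size_flags_le (node W u q l r s t) m
    have hst : (s.enc (m - 1) c.plus).size ≤
        sizeUnit D + (l.set.card + r.set.card) * secSize D lam m ∧
        (t.enc (m - 1) c.minus).size ≤
        sizeUnit D + (l.set.card + r.set.card) * secSize D lam m := by
      cases m with
      | zero =>
        obtain ⟨rfl, rfl⟩ : s = nil ∧ t = nil := h.sec
        simp only [enc_nil, Val.size, sizeUnit]
        omega
      | succ m =>
        obtain ⟨hs, ht, hsS, htS⟩ := h.sec_succ
        have cs := card_secSet_le true l.set r.set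
        have ct := card_secSet_le false l.set r.set
        rw [← hsS] at cs
        rw [← htS] at ct
        have h5 := is (by omega) hc.plus hs (by omega)
        have h6 := it (by omega) hc.minus ht (by omega)
        have h7 := rank_le_of_wt_le (lam := lam) hs.wt_le (by omega)
        have h8 := rank_le_of_wt_le (lam := lam) ht.wt_le (by omega)
        constructor
        · refine h5.trans (Nat.add_le_add_left ?_ _)
          rw [secSize]
          exact Nat.mul_le_mul cs (Nat.mul_le_mul_right _ (by omega))
        · refine h6.trans (Nat.add_le_add_left ?_ _)
          rw [secSize]
          exact Nat.mul_le_mul ct (Nat.mul_le_mul_right _ (by omega))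
    have hpos : 1 ≤ l.set.card + r.set.card := by
      have e1 := hn.le_card
      have e2 := hn.two_le
      have e3 := hn.four_mul_le
      omega
    set X := 5 * sizeUnit D + 2 * secSize D lam m with hX
    have e1 : l.set.card * ((rank l.wt + 1) * X) ≤ l.set.card * (rank W * X) := by gcongr
    have e2 : r.set.card * ((rank r.wt + 1) * X) ≤ r.set.card * (rank W * X) := by gcongr
    have e3 : (l.set.card + r.set.card) * ((rank W + 1) * X) =
        l.set.card * (rank W * X) + r.set.card * (rank W * X) +
          5 * ((l.set.card + r.set.card) * sizeUnit D) +
          2 * ((l.set.card + r.set.card) * secSize D lam m) := by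
      rw [hX]; ring
    have e4 : sizeUnit D ≤ (l.set.card + r.set.card) * sizeUnit D :=
      Nat.le_mul_of_pos_left _ hpos
    have e5 : 20 * D + 100 ≤ sizeUnit D := by unfold sizeUnit; omega
    rw [enc_node]
    simp only [nodeBody, Val.size, wt]
    rw [e3]
    omega

/-! ### The join -/

/-- The join condition of level `m` in the context `c`. -/
def Join : ℕ → Ctx → List ℝ → List ℝ → Prop
  | 0, c, a, b => (c a).1 ≤ (c b).1
  | m + 1, c, a, b =>
    if (c a).2.headD 0 ≤ (c b).2.headD 0 then Join m c.plus a b else Join m c.minus a b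

/-- Among equal keys the flag decides, so the strict order of the tree is exactly the weak
inequality of the join condition. -/
theorem ord_lt_ord_iff {c : Ctx} {a b : List ℝ} (ha0 : a ≠ []) (hb0 : b ≠ []) (ha : isA a = true)
    (hb : isA b = false) : ord c a < ord c b ↔ keyOf c a ≤ keyOf c b := by
  obtain ⟨x, xs, rfl⟩ := List.exists_cons_of_ne_nil ha0
  obtain ⟨y, ys, rfl⟩ := List.exists_cons_of_ne_nil hb0
  have hx : x ≤ 0 := by simpa [isA] using ha
  have hy : 0 < y := by simpa [isA] using hb
  have hxy : x :: xs < y :: ys := List.cons_lt_cons_iff.2 (Or.inl (hx.trans_lt hy))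
  rw [ord, ord, List.cons_lt_cons_iff, le_iff_lt_or_eq]
  simp [hxy]

namespace JTree

noncomputable def listA : JTree → List (List ℝ)
  | nil => []
  | leaf e => if isA e then [e] else []
  | node _ _ _ l r _ _ => l.listA ++ r.listA

noncomputable def listB : JTree → List (List ℝ)
  | nil => []
  | leaf e => if isA e then [] else [e]
  | node _ _ _ l r _ _ => l.listB ++ r.listB

/-- The pairs of the join, in the order in which they are reported. -/
noncomputable def pairs : JTree → ℕ → List (List ℝ × List ℝ)
  | nil, _ => []
  | leaf _, _ => []
  | node _ _ _ l r _ _, 0 => l.pairs 0 ++ (r.pairs 0 ++ l.listA ×ˢ r.listB)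
  | node _ _ _ l r s t, m + 1 =>
    l.pairs (m + 1) ++ (r.pairs (m + 1) ++ (s.pairs m ++ t.pairs m))

/-! ### Correctness of the flags and of the reported pairs -/

theorem hasA_iff (T : JTree) : T.hasA = true ↔ T.listA ≠ [] := by
  induction T with
  | nil => simp [hasA, listA]
  | leaf e => cases h : isA e <;> simp [hasA, listA, h]
  | node W u q l r s t il ir =>
    simp only [hasA, listA, Bool.or_eq_true, il, ir, ne_eq, List.append_eq_nil_iff]
    tauto

theorem hasB_iff (T : JTree) : T.hasB = true ↔ T.listB ≠ [] := by
  induction T with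
  | nil => simp [hasB, listB]
  | leaf e => cases h : isA e <;> simp [hasB, listB, h]
  | node W u q l r s t il ir =>
    simp only [hasB, listB, Bool.or_eq_true, il, ir, ne_eq, List.append_eq_nil_iff]
    tauto

theorem mem_product {α β : Type*} {l : List α} {r : List β} {a : α} {b : β} :
    (a, b) ∈ l ×ˢ r ↔ a ∈ l ∧ b ∈ r :=
  List.pair_mem_product

theorem product_ne_nil {α β : Type*} (l : List α) (r : List β) :
    l ×ˢ r ≠ [] ↔ l ≠ [] ∧ r ≠ [] := by
  cases l <;> cases r <;> simp [SProd.sprod, List.product]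

theorem hasJ_iff (T : JTree) (m : ℕ) : T.hasJ m = true ↔ T.pairs m ≠ [] := by
  induction T generalizing m with
  | nil => simp [hasJ, pairs]
  | leaf e => simp [hasJ, pairs]
  | node W u q l r s t il ir is it =>
    cases m with
    | zero =>
      have := product_ne_nil l.listA r.listB
      rw [← hasA_iff, ← hasB_iff] at this
      simp only [hasJ, pairs, Bool.or_eq_true, Bool.and_eq_true, il, ir, ← this, ne_eq,
        List.append_eq_nil_iff]
      grind
    | succ m =>
      simp only [hasJ, pairs, Bool.or_eq_true, il, ir, is, it, ne_eq,
        List.append_eq_nil_iff]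
      grind

theorem mem_listA {T : JTree} {e : List ℝ} : e ∈ T.listA ↔ e ∈ T.set ∧ isA e = true := by
  induction T with
  | nil => simp [listA, JTree.set]
  | leaf a =>
    by_cases h : isA a = true
    · simp only [listA, h, if_true, List.mem_singleton, JTree.set, Finset.mem_singleton]
      constructor
      · rintro rfl; exact ⟨rfl, h⟩
      · exact fun h => h.1
    · simp only [listA, h, JTree.set, Finset.mem_singleton]
      constructor
      · intro h; simp at h
      · rintro ⟨rfl, h'⟩; exact absurd h' h
  | node W u q l r s t il ir =>
    simp only [listA, JTree.set, List.mem_append, Finset.mem_union, il, ir]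
    tauto

theorem mem_listB {T : JTree} {e : List ℝ} : e ∈ T.listB ↔ e ∈ T.set ∧ isA e = false := by
  induction T with
  | nil => simp [listB, JTree.set]
  | leaf a =>
    by_cases h : isA a = true
    · simp only [listB, h, if_true, JTree.set, Finset.mem_singleton]
      constructor
      · intro h; simp at h
      · rintro ⟨rfl, h'⟩; simp [h] at h'
    · simp only [listB, h, JTree.set, Finset.mem_singleton]
      constructor
      · intro h'
        obtain rfl : e = a := by simpa using h'
        exact ⟨rfl, by simpa using h⟩
      · rintro ⟨rfl, h'⟩; simp
  | node W u q l r s t il ir =>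
    simp only [listB, JTree.set, List.mem_append, Finset.mem_union, il, ir]
    tauto

theorem mem_secSet {b : Bool} {L R : Finset (List ℝ)} {e : List ℝ} :
    e ∈ secSet b L R ↔ e ∈ L ∧ isA e = b ∨ e ∈ R ∧ isA e = !b := by
  cases b <;> cases h : isA e <;> simp [secSet, toP, h]

/-- A pair inside one subtree is covered by induction. For a separated pair the sides decide the
comparison of the keys: on level `0` this is the join condition itself, on higher levels it selects
the branch of `Join` that the secondary tree computes. -/
theorem mem_pairs {D : ℕ} (hD : 1 ≤ D) {T : JTree} {m : ℕ} {c : Ctx} (hc : c.HasLevel D m)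
    (h : T.Inv D m c) {a b : List ℝ} :
    (a, b) ∈ T.pairs m ↔
      a ∈ T.set ∧ b ∈ T.set ∧ isA a = true ∧ isA b = false ∧ Join m c a b := by
  induction T generalizing m c with
  | nil => simp [pairs, JTree.set]
  | leaf e =>
    simp only [pairs, List.not_mem_nil, JTree.set, Finset.mem_singleton, false_iff]
    rintro ⟨rfl, rfl, h1, h2, -⟩
    simp [h1] at h2
  | node W u q l r s t il ir is it =>
    have hn := h.node_inv
    have hlen : ∀ e ∈ (node W u q l r s t).set, e.length = D := fun e he => h.length he
    have hne : ∀ e ∈ (node W u q l r s t).set, e ≠ [] := by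
      rintro e he rfl
      have := hlen _ he
      simp at this; omega
    have hll : ∀ e ∈ l.set, e ∈ (node W u q l r s t).set := fun e he => Finset.mem_union_left _ he
    have hrr : ∀ e ∈ r.set, e ∈ (node W u q l r s t).set := fun e he => Finset.mem_union_right _ he
    have k1 : a ∈ l.set → b ∈ r.set → isA a = true → isA b = false → keyOf c a ≤ keyOf c b :=
      fun ha hb hA hB => (ord_lt_ord_iff (hne a (hll a ha)) (hne b (hrr b hb)) hA hB).1
        ((hn.left_lt a ha).trans_le (hn.le_right b hb))
    have k2 : a ∈ r.set → b ∈ l.set → isA a = true → isA b = false → ¬ keyOf c a ≤ keyOf c b :=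
      fun ha hb hA hB hk => ((hn.left_lt b hb).trans_le (hn.le_right a ha)).not_gt
        ((ord_lt_ord_iff (hne a (hrr a ha)) (hne b (hll b hb)) hA hB).2 hk)
    cases m with
    | zero =>
      have hkey : ∀ e ∈ (node W u q l r s t).set, keyOf c e = (c e).1 := by
        intro e he
        have := hc e (hlen e he)
        rw [List.length_eq_zero_iff] at this
        simp [keyOf, this]
      have j1 : a ∈ l.set → b ∈ r.set → isA a = true → isA b = false → Join 0 c a b := by
        intro ha hb hA hB
        have := k1 ha hb hA hB
        rwa [hkey a (hll a ha), hkey b (hrr b hb)] at this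
      have j2 : a ∈ r.set → b ∈ l.set → isA a = true → isA b = false → ¬ Join 0 c a b := by
        intro ha hb hA hB
        have := k2 ha hb hA hB
        rwa [hkey a (hrr a ha), hkey b (hll b hb)] at this
      simp only [pairs, List.mem_append, il hc h.left, ir hc h.right, mem_product,
        mem_listA, mem_listB, JTree.set, Finset.mem_union]
      clear il ir is it hll hrr hne hlen hkey
      grind
    | succ m =>
      obtain ⟨hs, ht, hsS, htS⟩ := h.sec_succ
      have hkey : ∀ e ∈ (node W u q l r s t).set, keyOf c e = (c e).2.headD 0 := by
        intro e he
        obtain ⟨x, xs, hx⟩ := List.exists_cons_of_length_eq_add_one (hc e (hlen e he))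
        simp [keyOf, hx]
      have j1 : a ∈ l.set → b ∈ r.set → isA a = true → isA b = false →
          (Join (m + 1) c a b ↔ Join m c.plus a b) := by
        intro ha hb hA hB
        have := k1 ha hb hA hB
        rw [hkey a (hll a ha), hkey b (hrr b hb)] at this
        simp only [Join, if_pos this]
      have j2 : a ∈ r.set → b ∈ l.set → isA a = true → isA b = false →
          (Join (m + 1) c a b ↔ Join m c.minus a b) := by
        intro ha hb hA hB
        have := k2 ha hb hA hB
        rw [hkey a (hrr a ha), hkey b (hll b hb)] at this
        simp only [Join, if_neg this]
      simp only [pairs, List.mem_append, il hc h.left, ir hc h.right, is hc.plus hs,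
        it hc.minus ht, hsS, htS, mem_secSet, JTree.set, Finset.mem_union]
      by_cases hA : isA a = true
      · by_cases hB : isA b = false
        · simp only [hA, hB, Bool.not_true, Bool.not_false, Bool.true_eq_false,
            Bool.false_eq_true, and_true, and_false, or_false, false_or, true_and]
          have j1 := fun x y => j1 x y hA hB
          have j2 := fun x y => j2 x y hA hB
          clear il ir is it hll hrr hne hlen hkey
          grind
        · simp [hB]
      · simp [hA]

theorem nodup_listA {D : ℕ} {T : JTree} {m : ℕ} {c : Ctx} (h : T.Inv D m c) : T.listA.Nodup := by
  induction T with
  | nil => simp [listA]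
  | leaf e => cases he : isA e <;> simp [listA, he]
  | node W u q l r s t il ir =>
    refine List.nodup_append'.2 ⟨il h.left, ir h.right, fun e h1 h2 => ?_⟩
    exact Finset.disjoint_left.1 h.node_inv.disjoint (mem_listA.1 h1).1 (mem_listA.1 h2).1

theorem nodup_listB {D : ℕ} {T : JTree} {m : ℕ} {c : Ctx} (h : T.Inv D m c) : T.listB.Nodup := by
  induction T with
  | nil => simp [listB]
  | leaf e => cases he : isA e <;> simp [listB, he]
  | node W u q l r s t il ir =>
    refine List.nodup_append'.2 ⟨il h.left, ir h.right, fun e h1 h2 => ?_⟩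
    exact Finset.disjoint_left.1 h.node_inv.disjoint (mem_listB.1 h1).1 (mem_listB.1 h2).1

/-- The parts of the list are told apart by the subtrees in which `a` and `b` lie: both left, both
right, or one of the two ways of being separated. -/
theorem nodup_pairs {D : ℕ} (hD : 1 ≤ D) {T : JTree} {m : ℕ} {c : Ctx} (hc : c.HasLevel D m)
    (h : T.Inv D m c) : (T.pairs m).Nodup := by
  induction T generalizing m c with
  | nil => simp [pairs]
  | leaf e => simp [pairs]
  | node W u q l r s t il ir is it =>
    have hdj := Finset.disjoint_left.1 h.node_inv.disjoint
    have hl := fun a b => mem_pairs hD hc h.left (a := a) (b := b)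
    have hr := fun a b => mem_pairs hD hc h.right (a := a) (b := b)
    cases m with
    | zero =>
      refine List.nodup_append'.2 ⟨il hc h.left, List.nodup_append'.2 ⟨ir hc h.right,
        (nodup_listA h.left).product (nodup_listB h.right), ?_⟩, ?_⟩
      · rintro ⟨a, b⟩ h1 h2
        rw [hr] at h1
        rw [mem_product, mem_listA, mem_listB] at h2
        exact hdj h2.1.1 h1.1
      · rintro ⟨a, b⟩ h1 h2
        rw [hl] at h1
        rw [List.mem_append, hr, mem_product, mem_listA, mem_listB] at h2
        rcases h2 with h2 | h2
        · exact hdj h1.1 h2.1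
        · exact hdj h1.2.1 h2.2.1
    | succ m =>
      obtain ⟨hs, ht, hsS, htS⟩ := h.sec_succ
      have hs' : ∀ a b, (a, b) ∈ s.pairs m → a ∈ l.set ∧ b ∈ r.set := by
        intro a b hab
        rw [mem_pairs hD hc.plus hs, hsS, mem_secSet, mem_secSet] at hab
        obtain ⟨h1, h2, h3, h4, -⟩ := hab
        simp only [h3, h4] at h1 h2
        simp at h1 h2
        exact ⟨h1, h2⟩
      have ht' : ∀ a b, (a, b) ∈ t.pairs m → a ∈ r.set ∧ b ∈ l.set := by
        intro a b hab
        rw [mem_pairs hD hc.minus ht, htS, mem_secSet, mem_secSet] at hab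
        obtain ⟨h1, h2, h3, h4, -⟩ := hab
        simp only [h3, h4] at h1 h2
        simp at h1 h2
        exact ⟨h1, h2⟩
      refine List.nodup_append'.2 ⟨il hc h.left, List.nodup_append'.2 ⟨ir hc h.right,
        List.nodup_append'.2 ⟨is hc.plus hs, it hc.minus ht, ?_⟩, ?_⟩, ?_⟩
      · rintro ⟨a, b⟩ h1 h2
        exact hdj (hs' _ _ h1).1 (ht' _ _ h2).1
      · rintro ⟨a, b⟩ h1 h2
        rw [hr] at h1
        rcases List.mem_append.1 h2 with h2 | h2
        · exact hdj (hs' _ _ h2).1 h1.1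
        · exact hdj (ht' _ _ h2).2 h1.2.1
      · rintro ⟨a, b⟩ h1 h2
        rw [hl] at h1
        rcases List.mem_append.1 h2 with h2 | h2
        · rw [hr] at h2
          exact hdj h1.1 h2.1
        rcases List.mem_append.1 h2 with h2 | h2
        · exact hdj h1.2.1 (hs' _ _ h2).2
        · exact hdj h1.1 (ht' _ _ h2).1

end JTree

end SimJoin

namespace SimJoin

open JTree

/-! ### Enumeration -/

/-- The entries of the stack of the enumeration: the join of a tree, or the product of the
`A`-elements of a tree and the `B`-elements of another one. -/
inductive Frame : Type
  | join (T : JTree) (m : ℕ) (c : Ctx)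
  | prod (l r : JTree) (m : ℕ) (c : Ctx)

namespace Frame

noncomputable def enc : Frame → Val
  | join T m c => .cons .nil (T.enc m c)
  | prod l r m c => .cons (l.enc m c) (r.enc m c)

/-- The pairs that are reported for an entry. -/
noncomputable def out : Frame → List (List ℝ × List ℝ)
  | join T m _ => T.pairs m
  | prod l r _ _ => l.listA ×ˢ r.listB

def height : Frame → ℕ
  | join T _ _ => 2 * T.height
  | prod l r _ _ => l.height + r.height

def Valid (D : ℕ) : Frame → Prop
  | join T m c => c.HasLevel D m ∧ T.Inv D m c
  | prod l r m c => l.Inv D m c ∧ r.Inv D m c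

end Frame

/-- The stored form of the stack on top of `rest`. -/
noncomputable def encStack (st : List Frame) (rest : Val) : Val :=
  (st.map Frame.enc).foldr Val.cons rest

open Classical in
/-- The entries that are not empty. -/
noncomputable def nonempties (st : List Frame) : List Frame := st.filter fun f => f.out ≠ []

theorem flatMap_nonempties (st : List Frame) :
    (nonempties st).flatMap Frame.out = st.flatMap Frame.out := by
  induction st with
  | nil => rfl
  | cons f st ih =>
    unfold nonempties at ih ⊢
    by_cases h : f.out = []
    · rw [List.filter_cons_of_neg (by simp [h]), ih, List.flatMap_cons, h, List.nil_append]
    · rw [List.filter_cons_of_pos (by simp [h]), List.flatMap_cons, ih, List.flatMap_cons]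

theorem encStack_nonempties_cons (f : Frame) (st : List Frame) (rest : Val) :
    encStack (nonempties (f :: st)) rest =
      encStack (nonempties [f]) (encStack (nonempties st) rest) := by
  unfold nonempties
  by_cases h : f.out = []
  · rw [List.filter_cons_of_neg (by simp [h]), List.filter_cons_of_neg (by simp [h])]
    rfl
  · rw [List.filter_cons_of_pos (by simp [h]), List.filter_cons_of_pos (by simp [h])]
    rfl

theorem calls_pushP (T : JTree) (m : ℕ) (c : Ctx) (rest : Val) :
    Calls SimJoin.body .pushP (.cons (T.enc m c) rest) fun w k =>
      w = encStack (nonempties [.join T m c]) rest ∧ k ≤ 20 := by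
  apply calls_of_wp
  simp only [SimJoin.body, wp, onVar, JTree.enc, flags, onCons_cons, onNil_encB]
  unfold nonempties
  split_ifs with h
  · rw [hasJ_iff] at h
    rw [List.filter_cons_of_pos (by simp [Frame.out, h])]
    exact ⟨rfl, by omega⟩
  · rw [hasJ_iff] at h
    rw [List.filter_cons_of_neg (by simp [Frame.out, h])]
    exact ⟨rfl, by omega⟩

theorem calls_pushX (l r : JTree) (m : ℕ) (c : Ctx) (rest : Val) :
    Calls SimJoin.body .pushX (.cons (.cons (l.enc m c) (r.enc m c)) rest) fun w k =>
      w = encStack (nonempties [.prod l r m c]) rest ∧ k ≤ 20 := by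
  apply calls_of_wp
  simp only [SimJoin.body, wp, onVar, JTree.enc, flags, onCons_cons, onNil_encB]
  have hp := product_ne_nil l.listA r.listB
  rw [← hasA_iff, ← hasB_iff] at hp
  unfold nonempties
  split_ifs with h h'
  · rw [List.filter_cons_of_pos (by
      simp only [decide_eq_true_eq]; exact hp.2 ⟨h, h'⟩)]
    exact ⟨rfl, by omega⟩
  · rw [List.filter_cons_of_neg (by
      simp only [decide_eq_true_eq]; exact fun h0 => h' (hp.1 h0).2)]
    exact ⟨rfl, by omega⟩
  · rw [List.filter_cons_of_neg (by
      simp only [decide_eq_true_eq]; exact fun h0 => h (hp.1 h0).1)]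
    exact ⟨rfl, by omega⟩

/-- With a nonempty stack, the next pair is reported in time proportional to the height. -/
theorem calls_next {D : ℕ} (hD : 1 ≤ D) (N : ℕ) (f : Frame) (hf : f.Valid D) (h0 : f.out ≠ [])
    (hN : f.height ≤ N) :
    ∃ (a b : List ℝ) (st : List Frame), f.out = (a, b) :: st.flatMap Frame.out ∧
      a.length = D ∧ b.length = D ∧
      (∀ g ∈ st, g.Valid D ∧ g.out ≠ [] ∧ g.height ≤ N) ∧
      ∀ rest : Val, Calls SimJoin.body .next (.cons f.enc rest) fun w k =>
        w = .cons (.cons (encL a.tail) (encL b.tail)) (encStack st rest) ∧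
        k ≤ 200 * N + 100 := by
  induction N generalizing f with
  | zero =>
    exfalso
    cases f with
    | join T m c =>
      cases T <;> simp_all [Frame.height, JTree.height, Frame.out, pairs]
    | prod l r m c =>
      cases l <;> simp_all [Frame.height, JTree.height, Frame.out, listA, SProd.sprod, List.product]
  | succ N ih =>
    -- One expansion: `f` is replaced by parts of smaller height with the same output. Some part is
    -- nonempty, and the induction hypothesis applies to the first such part with the other ones in
    -- `rest`.
    have step : ∀ cs : List Frame, cs.flatMap Frame.out = f.out →
        (∀ g ∈ cs, g.Valid D ∧ g.height ≤ N) →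
        (∀ (rest w : Val) (k : ℕ),
          (Calls SimJoin.body .next (encStack (nonempties cs) rest) fun w' k' => w' = w ∧ k' ≤ k) →
          Calls SimJoin.body .next (.cons f.enc rest) fun w' k' => w' = w ∧ k' ≤ k + 200) →
        ∃ (a b : List ℝ) (st : List Frame), f.out = (a, b) :: st.flatMap Frame.out ∧
          a.length = D ∧ b.length = D ∧
          (∀ g ∈ st, g.Valid D ∧ g.out ≠ [] ∧ g.height ≤ N + 1) ∧
          ∀ rest : Val, Calls SimJoin.body .next (.cons f.enc rest) fun w k =>
            w = .cons (.cons (encL a.tail) (encL b.tail)) (encStack st rest) ∧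
            k ≤ 200 * (N + 1) + 100 := by
      intro cs hcs hv hrun
      have hmem : ∀ g ∈ nonempties cs, g.Valid D ∧ g.out ≠ [] ∧ g.height ≤ N := by
        intro g hg
        unfold nonempties at hg
        rw [List.mem_filter] at hg
        exact ⟨(hv g hg.1).1, by simpa using hg.2, (hv g hg.1).2⟩
      have hne : nonempties cs ≠ [] := by
        intro h
        have := flatMap_nonempties cs
        rw [h, hcs] at this
        exact h0 this.symm
      obtain ⟨g, gs, hgs⟩ := List.exists_cons_of_ne_nil hne
      have hg := hmem g (by rw [hgs]; simp)
      obtain ⟨a, b, st, hout, ha, hb, hst, hnext⟩ := ih g hg.1 hg.2.1 hg.2.2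
      refine ⟨a, b, st ++ gs, ?_, ha, hb, ?_, ?_⟩
      · rw [← hcs, ← flatMap_nonempties, hgs, List.flatMap_cons, hout, List.flatMap_append,
          List.cons_append]
      · intro g' hg'
        rcases List.mem_append.1 hg' with hg' | hg'
        · obtain ⟨h1, h2, h3⟩ := hst g' hg'
          exact ⟨h1, h2, by omega⟩
        · obtain ⟨h1, h2, h3⟩ := hmem g' (by rw [hgs]; simp [hg'])
          exact ⟨h1, h2, by omega⟩
      · intro rest
        refine (hrun rest (.cons (.cons (encL a.tail) (encL b.tail)) (encStack (st ++ gs) rest))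
          (200 * N + 100) ?_).mono fun w k h => ⟨h.1, by omega⟩
        rw [hgs]
        refine (hnext (encStack gs rest)).mono ?_
        rintro _ k ⟨rfl, hk⟩
        refine ⟨?_, by omega⟩
        simp [encStack]
    cases f with
    | join T m c =>
      obtain ⟨hc, hT⟩ := hf
      cases T with
      | nil => exact absurd rfl h0
      | leaf e => exact absurd rfl h0
      | node W u q l r s t =>
        have hq := hc q hT.node_inv.length_router
        have hqi : item c q = .cons (encL q) (.cons (.real (c q).1) (encL (c q).2)) := rfl
        have hh : 2 * (node W u q l r s t).height ≤ N + 1 := hN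
        simp only [JTree.height] at hh
        cases m with
        | zero =>
          rw [List.length_eq_zero_iff] at hq
          refine step [.join l 0 c, .join r 0 c, .prod l r 0 c] ?_ ?_ ?_
          · simp [Frame.out, pairs]
          · intro g hg
            simp only [List.mem_cons, List.not_mem_nil, or_false] at hg
            rcases hg with rfl | rfl | rfl
            · exact ⟨⟨hc, hT.left⟩, by simp only [Frame.height]; omega⟩
            · exact ⟨⟨hc, hT.right⟩, by simp only [Frame.height]; omega⟩
            -- The height of a product is a sum of two heights; counting a join twice makes this a
            -- decrease.
            · exact ⟨⟨hT.left, hT.right⟩, by simp only [Frame.height]; omega⟩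
          · intro rest w k hw
            apply calls_of_wp
            simp only [SimJoin.body, wp, onVar, Frame.enc, enc_node, nodeBody, hqi, hq, encL_nil,
              onCons_cons, onNil_cons, onNil_nil]
            refine (calls_pushX l r 0 c rest).mono ?_
            rintro _ k₁ ⟨rfl, hk₁⟩
            refine (calls_pushP r 0 c _).mono ?_
            rintro _ k₂ ⟨rfl, hk₂⟩
            refine (calls_pushP l 0 c _).mono ?_
            rintro _ k₃ ⟨rfl, hk₃⟩
            rw [encStack_nonempties_cons (.join l 0 c), encStack_nonempties_cons (.join r 0 c)] at hw
            exact hw.mono fun w' k' h => ⟨h.1, by omega⟩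
        | succ m =>
          obtain ⟨x, xs, hx⟩ := List.exists_cons_of_length_eq_add_one hq
          obtain ⟨hs, ht, -, -⟩ := hT.sec_succ
          refine step [.join l (m + 1) c, .join r (m + 1) c, .join s m c.plus, .join t m c.minus]
            ?_ ?_ ?_
          · simp [Frame.out, pairs]
          · intro g hg
            simp only [List.mem_cons, List.not_mem_nil, or_false] at hg
            rcases hg with rfl | rfl | rfl | rfl
            · exact ⟨⟨hc, hT.left⟩, by simp only [Frame.height]; omega⟩
            · exact ⟨⟨hc, hT.right⟩, by simp only [Frame.height]; omega⟩
            · exact ⟨⟨hc.plus, hs⟩, by simp only [Frame.height]; omega⟩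
            · exact ⟨⟨hc.minus, ht⟩, by simp only [Frame.height]; omega⟩
          · intro rest w k hw
            apply calls_of_wp
            simp only [SimJoin.body, wp, onVar, Frame.enc, enc_node, nodeBody, hqi, hx, encL_cons,
              onCons_cons, onNil_cons, onNil_nil, Nat.add_sub_cancel]
            refine (calls_pushP t m c.minus rest).mono ?_
            rintro _ k₁ ⟨rfl, hk₁⟩
            refine (calls_pushP s m c.plus _).mono ?_
            rintro _ k₂ ⟨rfl, hk₂⟩
            refine (calls_pushP r (m + 1) c _).mono ?_
            rintro _ k₃ ⟨rfl, hk₃⟩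
            refine (calls_pushP l (m + 1) c _).mono ?_
            rintro _ k₄ ⟨rfl, hk₄⟩
            rw [encStack_nonempties_cons (.join l (m + 1) c),
              encStack_nonempties_cons (.join r (m + 1) c),
              encStack_nonempties_cons (.join s m c.plus)] at hw
            exact hw.mono fun w' k' h => ⟨h.1, by omega⟩
    | prod l r m c =>
      obtain ⟨hl, hr⟩ := hf
      have hlen : ∀ e : List ℝ, e.length = D → ∃ x xs, e = x :: xs := fun e he =>
        List.exists_cons_of_ne_nil (by rintro rfl; simp at he; omega)
      have hh : l.height + r.height ≤ N + 1 := hN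
      cases l with
      | nil => exact absurd rfl h0
      | leaf a =>
        cases r with
        | nil => exact absurd rfl (((product_ne_nil _ _).1 h0).2)
        | leaf b =>
          have ha := (product_ne_nil _ _).1 h0
          have hA : isA a = true := by
            by_contra h
            exact ha.1 (by simp [listA, h])
          have hB : isA b = false := by
            by_contra h
            exact ha.2 (by simp [listB, h])
          refine ⟨a, b, [], ?_, hl, hr, by simp, ?_⟩
          · simp [Frame.out, listA, listB, hA, hB, SProd.sprod, List.product]
          · intro rest
            obtain ⟨x, xs, hx⟩ := hlen a hl
            obtain ⟨y, ys, hy⟩ := hlen b hr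
            apply calls_of_wp
            simp only [SimJoin.body, wp, onVar, Frame.enc, enc_leaf, flags, item, hx, hy,
              encL_cons, onCons_cons, onNil_cons, onNil_nil]
            exact ⟨rfl, by omega⟩
        | node W u q r₁ r₂ s t =>
          simp only [JTree.height] at hh
          refine step [.prod (leaf a) r₁ m c, .prod (leaf a) r₂ m c] ?_ ?_ ?_
          · cases ha : isA a <;> simp [Frame.out, listA, listB, ha, SProd.sprod, List.product]
          · intro g hg
            simp only [List.mem_cons, List.not_mem_nil, or_false] at hg
            rcases hg with rfl | rfl
            · exact ⟨⟨hl, hr.left⟩, by simp only [Frame.height, JTree.height]; omega⟩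
            · exact ⟨⟨hl, hr.right⟩, by simp only [Frame.height, JTree.height]; omega⟩
          · intro rest w k hw
            have p₁ := calls_pushX (leaf a) r₁ m c
            have p₂ := calls_pushX (leaf a) r₂ m c rest
            simp only [enc_leaf, flags] at p₁ p₂
            apply calls_of_wp
            simp only [SimJoin.body, wp, onVar, Frame.enc, enc_leaf, enc_node, flags, nodeBody,
              onCons_cons, onNil_cons, onNil_nil]
            refine p₂.mono ?_
            rintro _ k₁ ⟨rfl, hk₁⟩
            refine (p₁ _).mono ?_
            rintro _ k₂ ⟨rfl, hk₂⟩
            rw [encStack_nonempties_cons (.prod (leaf a) r₁ m c)] at hw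
            exact hw.mono fun w' k' h => ⟨h.1, by omega⟩
      | node W u q l₁ l₂ s t =>
        simp only [JTree.height] at hh
        refine step [.prod l₁ r m c, .prod l₂ r m c] ?_ ?_ ?_
        · simp [Frame.out, listA, SProd.sprod, List.product]
        · intro g hg
          simp only [List.mem_cons, List.not_mem_nil, or_false] at hg
          rcases hg with rfl | rfl
          · exact ⟨⟨hl.left, hr⟩, by simp only [Frame.height]; omega⟩
          · exact ⟨⟨hl.right, hr⟩, by simp only [Frame.height]; omega⟩
        · intro rest w k hw
          have p₁ := calls_pushX l₁ r m c
          have p₂ := calls_pushX l₂ r m c rest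
          apply calls_of_wp
          simp only [SimJoin.body, wp, onVar, Frame.enc, enc_node, flags, nodeBody,
            onCons_cons, onNil_cons]
          refine p₂.mono ?_
          rintro _ k₁ ⟨rfl, hk₁⟩
          refine (p₁ _).mono ?_
          rintro _ k₂ ⟨rfl, hk₂⟩
          rw [encStack_nonempties_cons (.prod l₁ r m c)] at hw
          exact hw.mono fun w' k' h => ⟨h.1, by omega⟩

/-- The point that belongs to an element. -/
noncomputable def toPt (d : ℕ) (e : List ℝ) : Pt d := WithLp.toLp 1 fun i => e.tail.getD i 0

theorem encPt_toPt {d : ℕ} {e : List ℝ} (he : e.length = d + 1) :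
    encPt (toPt d e) = encL e.tail := by
  unfold encPt encL
  congr 1
  apply List.ext_getElem
  · simp [he]
  · intro i h1 h2
    have h3 : i + 1 < e.length := by
      have : i < e.tail.length := by simpa using h2
      simp at this; omega
    simp [toPt, h3]

/-- A general entry point `f` that reaches `next` with overhead `j` covers both the first call and
the later ones. -/
theorem enumerates_next {d δ N : ℕ} (L : List (List ℝ × List ℝ))
    (st : List Frame) (hst : ∀ g ∈ st, g.Valid (d + 1) ∧ g.out ≠ [] ∧ g.height ≤ N)
    (hL : st.flatMap Frame.out = L) (f : Fn) (s : Val) (j : ℕ)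
    (hf : ∀ w k, Calls SimJoin.body .next (encStack st .nil) (fun w' k' => w' = w ∧ k' ≤ k) →
      Calls SimJoin.body f s (fun w' k' => w' = w ∧ k' ≤ k + j)) (hj : 200 * N + 100 + j ≤ δ) :
    code.Enumerates δ f s (L.map fun p => (toPt d p.1, toPt d p.2)) := by
  induction L generalizing st f s j with
  | nil =>
    have : st = [] := by
      cases st with
      | nil => rfl
      | cons g st =>
        have h1 := (hst g (by simp)).2.1
        rw [List.flatMap_cons, List.append_eq_nil_iff] at hL
        exact absurd hL.1 h1
    subst this
    obtain ⟨w, k, h, rfl, hk⟩ := hf .nil 10 (by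
      apply calls_of_wp
      simp [SimJoin.body, wp, onVar, encStack])
    exact .done h (by omega)
  | cons p L ih =>
    cases st with
    | nil => simp at hL
    | cons g st =>
      obtain ⟨h1, h2, h3⟩ := hst g (by simp)
      obtain ⟨a, b, st', hout, ha, hb, hst', hnext⟩ := calls_next (Nat.succ_pos d) N g h1 h2 h3
      obtain ⟨w, k, h, rfl, hk⟩ := hf _ _ (hnext (encStack st .nil))
      rw [List.flatMap_cons, hout, List.cons_append] at hL
      obtain ⟨rfl, hL₂⟩ := List.cons.inj hL
      rw [← encPt_toPt ha, ← encPt_toPt hb] at h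
      refine .report h (by omega) ?_
      refine ih (st' ++ st) ?_ ?_ .next _ 0 ?_ (by omega)
      · intro g' hg'
        rcases List.mem_append.1 hg' with hg' | hg'
        · exact hst' g' hg'
        · exact hst g' (by simp [hg'])
      · rw [List.flatMap_append]; exact hL₂
      · intro w k hw
        simpa [encStack] using hw

theorem enumerates_first {d m δ : ℕ} {c : Ctx} {T : JTree} (hc : c.HasLevel (d + 1) m)
    (h : T.Inv (d + 1) m c) (r : ℝ) (hδ : 400 * T.height + 150 ≤ δ) :
    code.Enumerates δ .first (.cons (.real r) (T.enc m c))
      ((T.pairs m).map fun p => (toPt d p.1, toPt d p.2)) := by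
  refine enumerates_next (N := 2 * T.height) (T.pairs m) (nonempties [.join T m c])
    ?_ ?_ .first _ 40 ?_ (by omega)
  · intro g hg
    unfold nonempties at hg
    rw [List.mem_filter, List.mem_singleton] at hg
    obtain ⟨rfl, hg⟩ := hg
    exact ⟨⟨hc, h⟩, by simpa using hg, le_rfl⟩
  · rw [flatMap_nonempties]; simp [Frame.out]
  · intro w k hw
    apply calls_of_wp
    simp only [SimJoin.body, wp, onVar, onCons_cons]
    refine (calls_pushP T m c .nil).mono ?_
    rintro _ k₁ ⟨rfl, hk₁⟩
    exact hw.mono fun w' k' h => ⟨h.1, by omega⟩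

end SimJoin

namespace SimJoin

open JTree

/-! ### Polylogarithmic bounds -/

theorem secTime_le (K lam m : ℕ) : secTime K lam m ≤ K * m * (lam + 1) ^ (m + 1) := by
  induction m with
  | zero => simp [secTime]
  | succ m ih =>
    calc secTime K lam (m + 1)
        ≤ (lam + 1) * (K * (lam + 1) ^ (m + 1) + K * m * (lam + 1) ^ (m + 1)) := by
          rw [secTime]
          gcongr
          exact Nat.le_self_pow (by omega) _
      _ = K * (m + 1) * (lam + 1) ^ (m + 1 + 1) := by ring

theorem buildTime_le (K lam m : ℕ) : buildTime K lam m ≤ K * (m + 1) * (lam + 1) ^ (m + 2) := by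
  -- By definition `buildTime K lam m` is `secTime K lam (m + 1)`.
  have := secTime_le K lam (m + 1)
  simpa [secTime, buildTime] using this

theorem payTime_le (D lam m : ℕ) :
    payTime D lam m ≤ 91 * unit D * (m + 1) * (lam + 1) ^ (m + 2) := by
  have h1 := buildTime_le (10 * unit D) lam m
  have h2 : 1 ≤ (lam + 1) ^ (m + 2) := Nat.one_le_pow _ _ (by omega)
  have h3 : 3 * unit D ≤ 3 * unit D * ((m + 1) * (lam + 1) ^ (m + 2)) :=
    Nat.le_mul_of_pos_right _ (Nat.mul_pos (by omega) h2)
  calc payTime D lam m ≤ 7 * (10 * unit D * (m + 1) * (lam + 1) ^ (m + 2) +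
        3 * unit D * ((m + 1) * (lam + 1) ^ (m + 2))) := by
        rw [payTime]; exact Nat.mul_le_mul_left _ (add_le_add h1 h3)
    _ = _ := by ring

theorem exists_secUpdTime_le (D m : ℕ) :
    ∃ C, ∀ lam, secUpdTime D lam m ≤ C * (lam + 1) ^ (m + 2) := by
  induction m with
  | zero => exact ⟨0, fun lam => by simp [secUpdTime]⟩
  | succ m ih =>
    obtain ⟨C, hC⟩ := ih
    refine ⟨5 * (unit D + 91 * unit D * (m + 1) + C), fun lam => ?_⟩
    have h2 : 1 ≤ (lam + 1) ^ (m + 2) := Nat.one_le_pow _ _ (by omega)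
    calc secUpdTime D lam (m + 1) ≤ (5 * (lam + 1)) * (unit D * (lam + 1) ^ (m + 2) +
          91 * unit D * (m + 1) * (lam + 1) ^ (m + 2) + C * (lam + 1) ^ (m + 2)) := by
          rw [secUpdTime]
          gcongr
          · omega
          · exact Nat.le_mul_of_pos_right _ h2
          · exact payTime_le _ _ _
          · exact hC lam
      _ = _ := by ring

theorem exists_secSize_le (D m : ℕ) : ∃ C, ∀ lam, secSize D lam m ≤ C * (lam + 1) ^ m := by
  induction m with
  | zero => exact ⟨0, fun lam => by simp [secSize]⟩
  | succ m ih =>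
    obtain ⟨C, hC⟩ := ih
    refine ⟨5 * (5 * sizeUnit D + 2 * C), fun lam => ?_⟩
    have h2 : 1 ≤ (lam + 1) ^ m := Nat.one_le_pow _ _ (by omega)
    calc secSize D lam (m + 1) ≤ (5 * (lam + 1)) * (5 * (sizeUnit D * (lam + 1) ^ m) +
          2 * (C * (lam + 1) ^ m)) := by
          rw [secSize]
          gcongr
          · omega
          · exact Nat.le_mul_of_pos_right _ h2
          · exact hC lam
      _ = _ := by ring

/-- Bound for the amortized time of an update. -/
def updTime (D lam m : ℕ) : ℕ :=
  (4 * lam + 5) * (unit D + payTime D lam m + secUpdTime D lam m) + 50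

/-- All bounds are polylogarithmic. -/
theorem exists_bounds (d : ℕ) : ∃ C, ∀ lam,
    buildTime (10 * unit (d + 1)) lam d + unit (d + 1) + 300 ≤ C * (lam + 1) ^ (d + 3) ∧
    updTime (d + 1) lam d ≤ C * (lam + 1) ^ (d + 3) ∧
    sizeUnit (d + 1) + 10 + (4 * lam + 5) * (5 * sizeUnit (d + 1) + 2 * secSize (d + 1) lam d) ≤
      C * (lam + 1) ^ (d + 3) ∧
    400 * (4 * lam + 6 + d * (4 * lam + 6)) + 150 ≤ C * (lam + 1) ^ (d + 3) := by
  -- Up to a constant summand, the update time on level `d` is `secUpdTime` on level `d + 1`; the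
  -- size is treated in the same way.
  obtain ⟨C₁, h₁⟩ := exists_secUpdTime_le (d + 1) (d + 1)
  obtain ⟨C₂, h₂⟩ := exists_secSize_le (d + 1) (d + 1)
  refine ⟨10 * unit (d + 1) * (d + 1) + unit (d + 1) + 300 + (C₁ + 50) +
    (sizeUnit (d + 1) + 10 + C₂) + (2400 * (d + 1) + 150), fun lam => ?_⟩
  have hx : ∀ e, 1 ≤ (lam + 1) ^ e := fun e => Nat.one_le_pow _ _ (by omega)
  have hle : ∀ e, e ≤ d + 3 → (lam + 1) ^ e ≤ (lam + 1) ^ (d + 3) := fun e he =>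
    Nat.pow_le_pow_right (by omega) he
  set Y := (lam + 1) ^ (d + 3) with hY
  have hY1 : 1 ≤ Y := hx _
  have a1 : buildTime (10 * unit (d + 1)) lam d ≤ 10 * unit (d + 1) * (d + 1) * Y :=
    (buildTime_le _ _ _).trans (Nat.mul_le_mul_left _ (hle _ (by omega)))
  have a2 : (4 * lam + 5) * (unit (d + 1) + payTime (d + 1) lam d + secUpdTime (d + 1) lam d) ≤
      C₁ * Y := h₁ lam
  have a3 : (4 * lam + 5) * (5 * sizeUnit (d + 1) + 2 * secSize (d + 1) lam d) ≤ C₂ * Y :=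
    (h₂ lam).trans (Nat.mul_le_mul_left _ (hle _ (by omega)))
  have a4 : (4 * lam + 6 + d * (4 * lam + 6)) ≤ 6 * (d + 1) * Y := by
    calc 4 * lam + 6 + d * (4 * lam + 6) ≤ 6 * (d + 1) * (lam + 1) ^ 1 := by
          rw [pow_one]; nlinarith [Nat.zero_le (d * lam)]
      _ ≤ _ := Nat.mul_le_mul_left _ (hle _ (by omega))
  have b1 : unit (d + 1) ≤ unit (d + 1) * Y := Nat.le_mul_of_pos_right _ hY1
  have b2 : sizeUnit (d + 1) ≤ sizeUnit (d + 1) * Y := Nat.le_mul_of_pos_right _ hY1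
  have a5 : 400 * (4 * lam + 6 + d * (4 * lam + 6)) ≤ 2400 * (d + 1) * Y := by
    calc _ ≤ 400 * (6 * (d + 1) * Y) := Nat.mul_le_mul_left _ a4
      _ = _ := by ring
  unfold updTime
  have e0 : (10 * unit (d + 1) * (d + 1) + unit (d + 1) + 300 + (C₁ + 50) +
      (sizeUnit (d + 1) + 10 + C₂) + (2400 * (d + 1) + 150)) * Y =
      10 * unit (d + 1) * (d + 1) * Y + unit (d + 1) * Y + C₁ * Y + sizeUnit (d + 1) * Y + C₂ * Y +
      2400 * (d + 1) * Y + 510 * Y := by ring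
  rw [e0]
  refine ⟨?_, ?_, ?_, ?_⟩ <;> omega

/-- The exponent of a power of two that bounds the size of trees of weight `w`. -/
def lamOf (w : ℕ) : ℕ := Nat.log 2 (2 * w + 2) + 1

theorem lt_two_pow_lamOf (w : ℕ) : 2 * w + 2 ≤ 2 ^ lamOf w :=
  (Nat.lt_pow_succ_log_self (by norm_num) _).le

theorem lamOf_le {w n : ℕ} (h : 3 * w ≤ 4 * (n + 1)) : lamOf w + 1 ≤ 6 * (Nat.log 2 n + 1) := by
  unfold lamOf
  rcases Nat.eq_zero_or_pos n with rfl | hn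
  · have h1 : Nat.log 2 (2 * w + 2) ≤ Nat.log 2 4 := Nat.log_mono_right (by omega)
    have h2 : Nat.log 2 4 = 2 := Nat.log_pow (by norm_num) 2
    omega
  · have h1 : Nat.log 2 (2 * w + 2) ≤ Nat.log 2 (n * 2 * 2 * 2 * 2) :=
      Nat.log_mono_right (by omega)
    rw [Nat.log_mul_base (by norm_num) (by omega), Nat.log_mul_base (by norm_num) (by omega),
      Nat.log_mul_base (by norm_num) (by omega), Nat.log_mul_base (by norm_num) (by omega)] at h1
    omega

/-- The exponent is absorbed by `d + 3 ≤ 4 * d`, where `1 ≤ d` enters. -/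
theorem pow_lamOf_le {d w n : ℕ} (hd : 1 ≤ d) (h : 3 * w ≤ 4 * (n + 1)) (C : ℕ) :
    C * (lamOf w + 1) ^ (d + 3) ≤ C * 6 ^ (d + 3) * polylog (4 * d) n := by
  unfold polylog
  calc C * (lamOf w + 1) ^ (d + 3) ≤ C * (6 * (Nat.log 2 n + 1)) ^ (d + 3) := by
        gcongr
        exact lamOf_le h
    _ = C * 6 ^ (d + 3) * (Nat.log 2 n + 1) ^ (d + 3) := by rw [mul_pow, mul_assoc]
    _ ≤ _ := by
        gcongr
        · omega
        · omega

/-! ### Points -/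

/-- The element for a point on the side `s`. -/
noncomputable def ofPt {d : ℕ} (s : ℝ) (p : Pt d) : List ℝ := s :: List.ofFn fun i => p i

theorem length_ofPt {d : ℕ} (s : ℝ) (p : Pt d) : (ofPt s p).length = d + 1 := by simp [ofPt]

theorem toPt_ofPt {d : ℕ} (s : ℝ) (p : Pt d) : toPt d (ofPt s p) = p := by
  ext i
  simp [toPt, ofPt]

theorem ofPt_injective {d : ℕ} (s : ℝ) : Function.Injective (ofPt s : Pt d → List ℝ) :=
  Function.LeftInverse.injective (toPt_ofPt s)

theorem isA_ofPt_zero {d : ℕ} (p : Pt d) : isA (ofPt 0 p) = true := by simp [isA, ofPt]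

theorem isA_ofPt_one {d : ℕ} (p : Pt d) : isA (ofPt 1 p) = false := by simp [isA, ofPt]

theorem encL_ofFn {d : ℕ} (p : Pt d) : encL (List.ofFn fun i => p i) = encPt p := by
  simp [encL, encPt, List.map_ofFn, Function.comp_def]

/-- The context at the top: the accumulated sums are `0` for `A` and `r` for `B`. -/
noncomputable def topCtx (r : ℝ) : Ctx := fun e => (if isA e then 0 else r, e.tail)

theorem topCtx_hasLevel (r : ℝ) (d : ℕ) : (topCtx r).HasLevel (d + 1) d := fun e he => by
  simp [topCtx, he]

theorem item_ofPt {d : ℕ} (r s : ℝ) (p : Pt d) :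
    item (topCtx r) (ofPt s p) = .cons (.cons (.real s) (encPt p))
      (.cons (.real (topCtx r (ofPt s p)).1) (encPt p)) := by
  rw [← encL_ofFn]
  rfl

/-- The `ℓ₁` distance of two lists. -/
noncomputable def l1 : List ℝ → List ℝ → ℝ
  | x :: a, y :: b => |x - y| + l1 a b
  | _, _ => 0

theorem l1_ofFn {d : ℕ} (f g : Fin d → ℝ) : l1 (List.ofFn f) (List.ofFn g) = ∑ i, |f i - g i| := by
  induction d with
  | zero => simp [l1]
  | succ d ih => rw [List.ofFn_succ, List.ofFn_succ, l1, ih, Fin.sum_univ_succ]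

/-- Each step of `Join` resolves one absolute value by its sign and moves the two coordinates into
the sums. -/
theorem join_iff {D m : ℕ} {c : Ctx} (hc : c.HasLevel D m) {a b : List ℝ} (ha : a.length = D)
    (hb : b.length = D) : Join m c a b ↔ (c a).1 + l1 (c a).2 (c b).2 ≤ (c b).1 := by
  induction m generalizing c with
  | zero =>
    have h1 := hc a ha
    rw [List.length_eq_zero_iff] at h1
    simp [Join, h1, l1]
  | succ m ih =>
    obtain ⟨x, xs, hx⟩ := List.exists_cons_of_length_eq_add_one (hc a ha)
    obtain ⟨y, ys, hy⟩ := List.exists_cons_of_length_eq_add_one (hc b hb)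
    rw [Join, ih hc.plus, ih hc.minus]
    simp only [Ctx.plus, Ctx.minus, hx, hy, List.headD_cons, List.tail_cons, l1]
    split_ifs with h
    · rw [abs_of_nonpos (by linarith)]
      constructor <;> intro h <;> linarith
    · rw [abs_of_pos (by linarith)]
      constructor <;> intro h <;> linarith

theorem join_ofPt {d : ℕ} (r : ℝ) (a b : Pt d) :
    Join d (topCtx r) (ofPt 0 a) (ofPt 1 b) ↔ dist a b ≤ r := by
  rw [join_iff (topCtx_hasLevel r d) (length_ofPt _ _) (length_ofPt _ _), PiLp.dist_eq_of_L1]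
  rw [topCtx, topCtx, isA_ofPt_zero, isA_ofPt_one]
  simp [ofPt, l1_ofFn, Real.dist_eq]

/-- The elements of an instance. -/
noncomputable def Inst.elts {d : ℕ} (S : Inst d) : Finset (List ℝ) :=
  S.A.image (ofPt 0) ∪ S.B.image (ofPt 1)

theorem mem_elts {d : ℕ} {S : Inst d} {e : List ℝ} :
    e ∈ S.elts ↔ (∃ p ∈ S.A, ofPt 0 p = e) ∨ ∃ p ∈ S.B, ofPt 1 p = e := by
  simp [Inst.elts]

theorem ofPt_zero_ne {d : ℕ} (p q : Pt d) : ofPt 0 p ≠ ofPt 1 q := by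
  simp [ofPt]

theorem card_elts {d : ℕ} (S : Inst d) : S.elts.card = S.card := by
  rw [Inst.elts, Finset.card_union_of_disjoint, Finset.card_image_of_injective _ (ofPt_injective 0),
    Finset.card_image_of_injective _ (ofPt_injective 1), Inst.card]
  rw [Finset.disjoint_left]
  intro e h1 h2
  obtain ⟨p, -, rfl⟩ := Finset.mem_image.1 h1
  obtain ⟨q, -, h⟩ := Finset.mem_image.1 h2
  exact ofPt_zero_ne p q h.symm

theorem length_of_mem_elts {d : ℕ} {S : Inst d} {e : List ℝ} (he : e ∈ S.elts) :
    e.length = d + 1 := by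
  rcases mem_elts.1 he with ⟨p, -, rfl⟩ | ⟨p, -, rfl⟩ <;> exact length_ofPt _ _

/-- The element of an update. -/
noncomputable def Update.elt {d : ℕ} : Update d → List ℝ
  | .insertA p => ofPt 0 p
  | .deleteA p => ofPt 0 p
  | .insertB p => ofPt 1 p
  | .deleteB p => ofPt 1 p

/-- Whether an update is an insertion. -/
def Update.op {d : ℕ} : Update d → Bool
  | .insertA _ => true
  | .deleteA _ => false
  | .insertB _ => true
  | .deleteB _ => false

theorem length_elt {d : ℕ} (u : Update d) : u.elt.length = d + 1 := by
  cases u <;> exact length_ofPt _ _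

theorem elts_apply {d : ℕ} (u : Update d) (S : Inst d) :
    (u.apply S).elts = app u.op u.elt S.elts := by
  cases u with
  | insertA p => simp [Inst.elts, Update.apply, app, Update.op, Update.elt, Finset.image_insert]
  | insertB p => simp [Inst.elts, Update.apply, app, Update.op, Update.elt, Finset.image_insert]
  | deleteA p =>
    have h : ofPt 0 p ∉ S.B.image (ofPt 1) := fun h => by
      obtain ⟨q, -, h⟩ := Finset.mem_image.1 h
      exact ofPt_zero_ne p q h.symm
    simp only [Inst.elts, Update.apply, app, Update.op, Update.elt, Bool.false_eq_true, if_false]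
    rw [Finset.image_erase (ofPt_injective 0), Finset.erase_union_distrib,
      Finset.erase_eq_of_notMem h]
  | deleteB p =>
    have h : ofPt 1 p ∉ S.A.image (ofPt 0) := fun h => by
      obtain ⟨q, -, h⟩ := Finset.mem_image.1 h
      exact ofPt_zero_ne q p h
    simp only [Inst.elts, Update.apply, app, Update.op, Update.elt, Bool.false_eq_true, if_false]
    rw [Finset.image_erase (ofPt_injective 1), Finset.erase_union_distrib,
      Finset.erase_eq_of_notMem h]

/-! ### The main theorem -/

/-- The tree `T` represents the instance `S` for the threshold `r`. -/
structure Represents {d : ℕ} (r : ℝ) (T : JTree) (S : Inst d) : Prop where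
  inv : T.Inv (d + 1) d (topCtx r)
  set_eq : T.set = S.elts

/-- The stored structure. -/
noncomputable def state (d : ℕ) (r : ℝ) (T : JTree) : Val :=
  .cons (.real r) (T.enc d (topCtx r))

/-- The potential of the whole structure. -/
noncomputable def potential (d : ℕ) (T : JTree) : ℕ :=
  T.phi (payTime (d + 1) (lamOf T.wt)) d

theorem Represents.card_eq {d : ℕ} {r : ℝ} {T : JTree} {S : Inst d} (h : Represents r T S) :
    T.set.card = S.card := by rw [h.set_eq, card_elts]

theorem JTree.Inv.card_le {D : ℕ} {T : JTree} {m : ℕ} {c : Ctx} (h : T.Inv D m c) :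
    T.set.card + 1 ≤ 2 * T.wt + 2 := by
  cases T with
  | nil => simp [wt, JTree.set]
  | leaf e => simp [wt, JTree.set]
  | node W u q l r s t =>
    have hn := h.node_inv
    rw [hn.card_node]
    have h1 := hn.card_left
    have h2 := hn.card_right
    have h3 := hn.four_mul_le
    have h4 := hn.two_le
    simp only [wt]
    omega

/-! ### Updates of the whole structure -/

theorem runUpdate_of_calls {d : ℕ} {r : ℝ} {T : JTree} {u : Update d} {Q : Val → ℕ → Prop}
    (h : Calls body .upd (.cons (encB u.op) (.cons (item (topCtx r) u.elt)
      (T.enc d (topCtx r)))) fun w k => ∀ j ≤ 50, Q (.cons (.real r) w) (k + j)) :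
    ∃ w k, code.RunUpdate (state d r T) u w k ∧ Q w k := by
  cases u with
  | insertA p =>
    have : Calls body .insertA (.cons (encPt p) (state d r T)) Q := by
      apply calls_of_wp
      rw [Update.elt, item_ofPt, topCtx, isA_ofPt_zero] at h
      simp only [body, wp, onVar, state, onCons_cons, Rat.cast_zero]
      refine h.mono fun w k hk => ?_
      -- The exact number of steps around the call of `upd`; it differs between the four operations
      -- with the size of the constant expressions.
      have := hk 22 (by omega)
      convert this using 1
      omega
    exact this
  | deleteA p =>
    have : Calls body .deleteA (.cons (encPt p) (state d r T)) Q := by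
      apply calls_of_wp
      rw [Update.elt, item_ofPt, topCtx, isA_ofPt_zero] at h
      simp only [body, wp, onVar, state, onCons_cons, Rat.cast_zero]
      refine h.mono fun w k hk => ?_
      have := hk 20 (by omega)
      convert this using 1
      omega
    exact this
  | insertB p =>
    have : Calls body .insertB (.cons (encPt p) (state d r T)) Q := by
      apply calls_of_wp
      rw [Update.elt, item_ofPt, topCtx, isA_ofPt_one] at h
      simp only [body, wp, onVar, state, onCons_cons, Rat.cast_one]
      refine h.mono fun w k hk => ?_
      have := hk 24 (by omega)
      convert this using 1
      omega
    exact this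
  | deleteB p =>
    have : Calls body .deleteB (.cons (encPt p) (state d r T)) Q := by
      apply calls_of_wp
      rw [Update.elt, item_ofPt, topCtx, isA_ofPt_one] at h
      simp only [body, wp, onVar, state, onCons_cons, Rat.cast_one]
      refine h.mono fun w k hk => ?_
      have := hk 22 (by omega)
      convert this using 1
      omega
    exact this

/-- The logarithmic parameter of the potential depends on the weight of the root. That weight
changes only when the root is rebuilt, and then the potential is zero for every choice of the
parameter. -/
theorem exists_runUpdate {d : ℕ} {r : ℝ} {T : JTree} {S : Inst d} (h : Represents r T S)
    (u : Update d) : ∃ (T' : JTree) (k : ℕ), code.RunUpdate (state d r T) u (state d r T') k ∧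
      Represents r T' (u.apply S) ∧
      k + potential d T' ≤ potential d T + updTime (d + 1) (lamOf T.wt) d := by
  have hlam := (h.inv.card_le).trans (lt_two_pow_lamOf T.wt)
  have hupd := updSpec (Nat.succ_pos d) (lamOf T.wt) T d (topCtx r) (topCtx_hasLevel r d) h.inv u.op
    u.elt (length_elt u) hlam
  obtain ⟨w, k, hrun, T', rfl, hT', hset, hk⟩ := runUpdate_of_calls (Q := fun w k => ∃ T' : JTree,
      w = state d r T' ∧ T'.Inv (d + 1) d (topCtx r) ∧ T'.set = app u.op u.elt T.set ∧
      k + potential d T' ≤ potential d T + updTime (d + 1) (lamOf T.wt) d) (hupd.mono (by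
    rintro _ k ⟨T', rfl, h1, h2, h3, h4⟩ j hj
    refine ⟨T', rfl, h1, h2, ?_⟩
    have hr := rank_le_of_wt_le (lam := lamOf T.wt) h.inv.wt_le (by omega)
    have e1 : (rank T.wt + 1) * (unit (d + 1) + payTime (d + 1) (lamOf T.wt) d +
        secUpdTime (d + 1) (lamOf T.wt) d) ≤ (4 * lamOf T.wt + 5) * (unit (d + 1) +
        payTime (d + 1) (lamOf T.wt) d + secUpdTime (d + 1) (lamOf T.wt) d) :=
      Nat.mul_le_mul_right _ (by omega)
    have e2 : potential d T' ≤ T'.phi (payTime (d + 1) (lamOf T.wt)) d := by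
      rcases h3 with h3 | ⟨-, h3⟩
      · rw [potential, h3]
      · rw [potential, h3]; exact Nat.zero_le _
    unfold updTime
    rw [show potential d T = T.phi (payTime (d + 1) (lamOf T.wt)) d from rfl]
    simp only [Nat.succ_eq_add_one] at h4
    omega))
  exact ⟨T', k, hrun, ⟨hT', by rw [hset, h.set_eq, elts_apply]⟩, hk⟩

theorem exists_runUpdates {d C : ℕ} (hd : 1 ≤ d)
    (hC : ∀ lam, updTime (d + 1) lam d ≤ C * (lam + 1) ^ (d + 3)) {r : ℝ} (us : List (Update d))
    {T : JTree} {S : Inst d} (h : Represents r T S) :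
    ∃ (T' : JTree) (k : ℕ), code.RunUpdates (state d r T) us (state d r T') k ∧
      Represents r T' (S.after us) ∧
      k + potential d T' ≤ potential d T +
        amortized (fun n => C * 6 ^ (d + 3) * polylog (4 * d) n) S us := by
  induction us generalizing T S with
  | nil => exact ⟨T, 0, .nil, h, by simp [amortized]⟩
  | cons u us ih =>
    obtain ⟨T₁, k₁, hrun, h₁, hk₁⟩ := exists_runUpdate h u
    obtain ⟨T₂, k₂, hruns, h₂, hk₂⟩ := ih h₁
    refine ⟨T₂, k₁ + k₂, .cons hrun hruns, h₂, ?_⟩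
    -- The weight belongs to the tree before the update, while the cost is charged to the size after
    -- it; the cardinalities differ by at most one.
    have hw : 3 * T.wt ≤ 4 * ((u.apply S).card + 1) := by
      have e1 := h.inv.wt_le
      have e2 := le_card_app u.op u.elt T.set
      rw [h.set_eq, ← elts_apply, card_elts, card_elts] at e2
      rw [h.set_eq, card_elts] at e1
      omega
    have := (hC (lamOf T.wt)).trans (pow_lamOf_le hd hw C)
    simp only [amortized]
    omega

/-! ### Construction, size and enumeration of the whole structure -/

theorem calls_items {d : ℕ} (r s a : ℝ) (l : List (Pt d))
    (hs : ∀ p : Pt d, (topCtx r (ofPt s p)).1 = a) (L : List (List ℝ)) :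
    Calls body .items (.cons (.cons (.real s) (.real a))
      (.cons (Val.ofList (l.map encPt)) (encI (topCtx r) L))) fun w k =>
        w = encI (topCtx r) (l.map (ofPt s) ++ L) ∧ k ≤ 60 * (l.length + 1) := by
  induction l with
  | nil =>
    apply calls_of_wp
    simp [body, wp, onVar]
  | cons p l ih =>
    apply calls_of_wp
    simp only [body, wp, onVar, List.map_cons, ofList_cons, onCons_cons, onNil_cons]
    refine ih.mono ?_
    rintro _ k ⟨rfl, hk⟩
    refine ⟨?_, by simp only [List.length_cons]; omega⟩
    rw [List.cons_append, encI_cons, item_ofPt, hs]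

theorem exists_run_build {d : ℕ} (r : ℝ) (S : Inst d) (lA lB : List (Pt d)) (hA : Lists lA S.A)
    (hB : Lists lB S.B) :
    ∃ (T : JTree) (k : ℕ), code.Run .buildMain (encInput r lA lB) (state d r T) k ∧
      Represents r T S ∧ potential d T = 0 ∧
      k ≤ (buildTime (10 * unit (d + 1)) (lamOf S.card) d + unit (d + 1) + 300) * (S.card + 1) := by
  have cA : lA.length = S.A.card := by
    rw [← List.toFinset_card_of_nodup hA.1]
    congr 1
    ext p; rw [List.mem_toFinset, hA.2]
  have cB : lB.length = S.B.card := by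
    rw [← List.toFinset_card_of_nodup hB.1]
    congr 1
    ext p; rw [List.mem_toFinset, hB.2]
  set L := lA.map (ofPt 0) ++ (lB.map (ofPt 1) ++ []) with hLdef
  have hmem : ∀ e, e ∈ L ↔ e ∈ S.elts := by
    intro e
    rw [mem_elts, hLdef, List.append_nil, List.mem_append, List.mem_map, List.mem_map]
    simp only [hA.2, hB.2]
  have hlen : L.length = S.card := by simp [hLdef, cA, cB, Inst.card]
  have hn : L.Nodup := by
    rw [hLdef, List.append_nil, List.nodup_append']
    refine ⟨hA.1.map (ofPt_injective 0), hB.1.map (ofPt_injective 1), fun e h1 h2 => ?_⟩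
    obtain ⟨p, -, rfl⟩ := List.mem_map.1 h1
    obtain ⟨q, -, h⟩ := List.mem_map.1 h2
    exact ofPt_zero_ne p q h.symm
  have hpow := lt_two_pow_lamOf S.card
  have hb := buildSpec (Nat.succ_pos d) (lamOf S.card) d (topCtx r) (topCtx_hasLevel r d) L
    (fun e he => length_of_mem_elts ((hmem e).1 he)) hn (lamOf S.card) le_rfl (by omega)
  have iB := calls_items r 1 r lB (fun p => by rw [topCtx, isA_ofPt_one]; rfl) []
  have iA := calls_items r 0 0 lA (fun p => by rw [topCtx, isA_ofPt_zero]; rfl)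
    (lB.map (ofPt 1) ++ [])
  have main : Calls body .buildMain (encInput r lA lB) fun w k => ∃ T : JTree,
      w = state d r T ∧ Represents r T S ∧ potential d T = 0 ∧
      k ≤ (buildTime (10 * unit (d + 1)) (lamOf S.card) d + unit (d + 1) + 300) * (S.card + 1) := by
    apply calls_of_wp
    rw [encI_nil] at iB
    simp only [body, wp, onVar, encInput, onCons_cons, Rat.cast_zero, Rat.cast_one]
    refine iB.mono ?_
    rintro _ k₁ ⟨rfl, hk₁⟩
    refine iA.mono ?_
    rintro _ k₂ ⟨rfl, hk₂⟩
    refine hb.mono ?_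
    rintro _ k₃ ⟨T, rfl, hT, hset, -, hphi, hk₃⟩
    refine ⟨T, rfl, ⟨hT, ?_⟩, hphi _, ?_⟩
    · rw [hset]
      ext e
      rw [List.mem_toFinset, hmem]
    · rw [hlen] at hk₃
      have e0 : S.card = lA.length + lB.length := by rw [cA, cB]; rfl
      have e1 : (buildTime (10 * unit (d + 1)) (lamOf S.card) d + unit (d + 1) + 300) *
          (S.card + 1) = buildTime (10 * unit (d + 1)) (lamOf S.card) d * S.card +
          buildTime (10 * unit (d + 1)) (lamOf S.card) d + unit (d + 1) * S.card + unit (d + 1) +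
          300 * (S.card + 1) := by ring
      rw [e1]
      simp only [buildTime, Nat.succ_eq_add_one] at hk₃ ⊢
      omega
  obtain ⟨w, k, hrun, T, rfl, h⟩ := main
  exact ⟨T, k, hrun, h⟩

theorem size_state_le {d : ℕ} {r : ℝ} {T : JTree} {S : Inst d} (h : Represents r T S) {lam : ℕ}
    (hlam : S.card ≤ 2 ^ lam) :
    (state d r T).size ≤ (sizeUnit (d + 1) + 10 +
      (4 * lam + 5) * (5 * sizeUnit (d + 1) + 2 * secSize (d + 1) lam d)) * (S.card + 1) := by
  have h1 := size_enc_le (Nat.le_succ d) (topCtx_hasLevel r d) h.inv (by rw [h.card_eq]; exact hlam)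
  have h2 := rank_le_of_wt_le h.inv.wt_le (by rw [h.card_eq]; exact hlam)
  rw [h.card_eq] at h1
  simp only [state, Val.size]
  simp only [Nat.succ_eq_add_one] at h1
  set X := 5 * sizeUnit (d + 1) + 2 * secSize (d + 1) lam d
  have h3 : S.card * ((rank T.wt + 1) * X) ≤ S.card * ((4 * lam + 5) * X) :=
    Nat.mul_le_mul_left _ (Nat.mul_le_mul_right _ (by omega))
  have h4 : (sizeUnit (d + 1) + 10 + (4 * lam + 5) * X) * (S.card + 1) =
    S.card * ((4 * lam + 5) * X) + (4 * lam + 5) * X + S.card * (sizeUnit (d + 1) + 10) +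
      sizeUnit (d + 1) + 10 := by ring
  omega

theorem exists_enumerates {d δ lam : ℕ} {r : ℝ} {T : JTree} {S : Inst d} (h : Represents r T S)
    (hlam : S.card ≤ 2 ^ lam) (hδ : 400 * (4 * lam + 6 + d * (4 * lam + 6)) + 150 ≤ δ) :
    ∃ l : List (Pt d × Pt d), code.Enumerates δ .first (state d r T) l ∧ l.Nodup ∧
      ∀ a b : Pt d, (a, b) ∈ l ↔ a ∈ S.A ∧ b ∈ S.B ∧ dist a b ≤ r := by
  have hc := topCtx_hasLevel r d
  have h1 := height_le h.inv (lam := lam) (by rw [h.card_eq]; exact hlam)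
  have h2 := rank_le_of_wt_le h.inv.wt_le (by rw [h.card_eq]; exact hlam)
  have hp : ∀ x y, (x, y) ∈ T.pairs d ↔ ∃ a b, x = ofPt 0 a ∧ y = ofPt 1 b ∧ a ∈ S.A ∧ b ∈ S.B ∧
      dist a b ≤ r := by
    intro x y
    rw [mem_pairs (Nat.succ_pos d) hc h.inv, h.set_eq, mem_elts, mem_elts]
    constructor
    · rintro ⟨⟨a, ha, rfl⟩ | ⟨a, ha, rfl⟩, ⟨b, hb, rfl⟩ | ⟨b, hb, rfl⟩, hx, hy, hj⟩
      · simp [isA_ofPt_zero] at hy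
      · exact ⟨a, b, rfl, rfl, ha, hb, (join_ofPt r a b).1 hj⟩
      · simp [isA_ofPt_one] at hx
      · simp [isA_ofPt_one] at hx
    · rintro ⟨a, b, rfl, rfl, ha, hb, hr⟩
      exact ⟨Or.inl ⟨a, ha, rfl⟩, Or.inr ⟨b, hb, rfl⟩, isA_ofPt_zero a, isA_ofPt_one b,
        (join_ofPt r a b).2 hr⟩
  refine ⟨_, enumerates_first hc h.inv r (by omega), ?_, ?_⟩
  · refine List.Nodup.map_on ?_ (nodup_pairs (Nat.succ_pos d) hc h.inv)
    rintro ⟨x, y⟩ hxy ⟨x', y'⟩ hxy' heq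
    obtain ⟨a, b, rfl, rfl, -⟩ := (hp _ _).1 hxy
    obtain ⟨a', b', rfl, rfl, -⟩ := (hp _ _).1 hxy'
    simp only [toPt_ofPt, Prod.mk.injEq] at heq
    rw [heq.1, heq.2]
  · intro a b
    rw [List.mem_map]
    constructor
    · rintro ⟨⟨x, y⟩, hxy, heq⟩
      obtain ⟨a', b', rfl, rfl, h3⟩ := (hp _ _).1 hxy
      simp only [toPt_ofPt, Prod.mk.injEq] at heq
      obtain ⟨rfl, rfl⟩ := heq
      exact h3
    · intro h3
      exact ⟨(ofPt 0 a, ofPt 1 b), (hp _ _).2 ⟨a, b, rfl, rfl, h3⟩, by simp only [toPt_ofPt]⟩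

end SimJoin

theorem mainTheorem2 :
    ∃ k : ℕ, ∀ d : ℕ, 1 ≤ d →
      ∃ (C : ℕ) (F : Type) (_ : Finite F) (P : SimJoin.Code F),
        ∀ r : ℝ, 0 < r →
        ∀ (S : SimJoin.Inst d) (lA lB : List (SimJoin.Pt d)),
          SimJoin.Lists lA S.A → SimJoin.Lists lB S.B →
          ∃ (s : SimJoin.Val) (t : ℕ),
            P.Run P.build (SimJoin.encInput r lA lB) s t ∧
            t ≤ C * (S.card + 1) * SimJoin.polylog (k * d) S.card ∧
            ∀ us : List (SimJoin.Update d), ∃ (s' : SimJoin.Val) (T : ℕ),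
              P.RunUpdates s us s' T ∧
              T ≤ SimJoin.amortized (fun n => C * SimJoin.polylog (k * d) n) S us ∧
              s'.size ≤
                C * ((S.after us).card + 1) * SimJoin.polylog (k * d) (S.after us).card ∧
              ∃ l : List (SimJoin.Pt d × SimJoin.Pt d),
                P.Enumerates (C * SimJoin.polylog (k * d) (S.after us).card) P.first s' l ∧
                l.Nodup ∧
                ∀ a b : SimJoin.Pt d,
                  (a, b) ∈ l ↔ a ∈ (S.after us).A ∧ b ∈ (S.after us).B ∧ dist a b ≤ r := by
  refine ⟨4, fun d hd => ?_⟩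
  obtain ⟨C, hC⟩ := SimJoin.exists_bounds d
  -- The factor `6 ^ (d + 3)` comes from replacing `lamOf` by the logarithm of the current size.
  refine ⟨C * 6 ^ (d + 3), SimJoin.Fn, inferInstance, SimJoin.code, fun r _ S lA lB hA hB => ?_⟩
  have hpoly : ∀ n, C * (SimJoin.lamOf n + 1) ^ (d + 3) ≤
      C * 6 ^ (d + 3) * SimJoin.polylog (4 * d) n := fun n =>
    SimJoin.pow_lamOf_le hd (by omega) C
  have hpow : ∀ n, n ≤ 2 ^ SimJoin.lamOf n := fun n => by
    have := SimJoin.lt_two_pow_lamOf n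
    omega
  obtain ⟨T, t, hrun, hT, hpot, ht⟩ := SimJoin.exists_run_build r S lA lB hA hB
  refine ⟨_, t, hrun, ht.trans ?_, fun us => ?_⟩
  · rw [mul_right_comm]
    exact Nat.mul_le_mul_right _ ((hC _).1.trans (hpoly _))
  · obtain ⟨T', k, hruns, hT', hk⟩ := SimJoin.exists_runUpdates hd (fun lam => (hC lam).2.1) us hT
    -- The new structure has potential zero, so the amortized bounds sum up to a bound for the
    -- actual time.
    refine ⟨_, k, hruns, by omega, ?_, ?_⟩
    · refine (SimJoin.size_state_le hT' (hpow _)).trans ?_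
      rw [mul_right_comm]
      exact Nat.mul_le_mul_right _ ((hC _).2.2.1.trans (hpoly _))
    · exact SimJoin.exists_enumerates hT' (hpow _) ((hC _).2.2.2.trans (hpoly _))
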